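/- Setting. Let $\mathfrak H$ be a complex separable Hilbert space with inner product $\langle\cdot,\cdot\rangle$ linear in the first argument, equipped with a conjugation $h\mapsto\bar h$ (an isometric conjugate-linear involution). Let $Z=\{Z(h):h\in\mathfrak H\}$ be a complex Gaussian isonormal process on a probability space $(\Omega,\mathcal F,P)$, that is, a jointly Gaussian family of complex random variables with $E[Z(h)]=0$, $E[Z(h)^2]=0$ and $E[Z(g)\overline{Z(h)}]=\langle g,h\rangle$ for all $g,h\in\mathfrak H$. Let $\mathfrak H^{\odot p}\otimes\mathfrak H^{\odot q}$ be the closed subspace of the Hilbert tensor power $\mathfrak H^{\otimes(p+q)}$ spanned by the tensors $(u_1\hat\otimes\cdots\hat\otimes u_p)\otimes(v_1\hat\otimes\cdots\hat\otimes v_q)$, where $\hat\otimes$ is the symmetrized tensor product. Put $$J_{m,n}(z,\rho)=\sum_{r=0}^{m\wedge n}(-1)^r r!\binom mr\binom nr z^{m-r}\bar z^{\,n-r}\rho^r .$$ Let $(e_k)$ be a complete orthonormal system of $\mathfrak H$. The complex multiple Wiener–Itô integral $I_{p,q}:\mathfrak H^{\odot p}\otimes\mathfrak H^{\odot q}\to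 L^2(\Omega)$ is the continuous linear map with $$I_{p,q}\Big(\big(\hat\otimes_k e_k^{\otimes m_k}\big)\otimes\big(\hat\otimes_k\bar e_k^{\otimes n_k}\big)\Big)=\prod_k J_{m_k,n_k}(Z(e_k),1),\qquad \sum_k m_k=p,\ \sum_k n_k=q .$$ A random variable $F=f(Z(\varphi_1),\dots,Z(\varphi_k))$ is called smooth if $\varphi_1,\dots,\varphi_k\in\mathfrak H$ and $f\in C^\infty(\mathbb C^k)$ (in the real sense) has polynomial growth together with all its partial derivatives; for such $F$, with Wirtinger derivatives $\partial_a,\bar\partial_b$, $$D^p\bar D^qF=\sum_{a_1,\dots,a_p=1}^{k}\ \sum_{b_1,\dots,b_q=1}^{k}\big(\partial_{a_1}\cdots\partial_{a_p}\bar\partial_{b_1}\cdots\bar\partial_{b_q}f\big)(Z(\varphi_1),\dots,Z(\varphi_k))\ \varphi_{a_1}\otimes\cdots\otimes\varphi_{a_p}\otimes\bar\varphi_{b_1}\otimes\cdots\otimes\bar\varphi_{b_q}.$$ The space $\mathbb D^{m,2}\cap\bar{\mathbb D}^{n,2}$ is the closure of the smooth random variables with respect to $\|F\|_{m,n,2}=\big(\sum_{p\le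 m}\sum_{q\le n}E\|D^p\bar D^qF\|^2\big)^{1/2}$: $F\in L^2(\Omega)$ belongs to it if there are smooth $F_k\to F$ in $L^2(\Omega)$ such that $D^p\bar D^qF_k$ converges in $L^2(\Omega;\mathfrak H^{\otimes(p+q)})$ for all $p\le m$, $q\le n$; the limit is denoted by $D^p\bar D^qF$. Theorem (Stroock's formula). For every $F\in L^2(\Omega,\sigma(Z),P)$ there is a unique family of kernels $f_{p,q}\in\mathfrak H^{\odot p}\otimes\mathfrak H^{\odot q}$, $p,q\ge0$, such that $$F=\sum_{p=0}^\infty\sum_{q=0}^\infty I_{p,q}(f_{p,q})$$ with (unconditional) convergence in $L^2(\Omega)$. Moreover, for all $m,n\ge0$, if $F\in\mathbb D^{m,2}\cap\bar{\mathbb D}^{n,2}$, then $$f_{p,q}=\frac1{p!\,q!}\,E\big[D^p\bar D^qF\big]\qquad\text{for all }p\le m,\ q\le n .$$ -/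

import Mathlib

open MeasureTheory ProbabilityTheory Filter Topology
open scoped ENNReal TensorProduct ComplexConjugate

noncomputable section

namespace ComplexWiener

/-! ### Hilbert tensor powers

`AlgTensor ι H` is the algebraic tensor power `⨂_{i ∈ ι} H`, with the Hermitian form
`⟪⨂ u_i, ⨂ v_i⟫ = ∏ ⟪u_i, v_i⟫` (conjugate-linear in the first variable), and
`HilbertTensor ι H` is its completion, the Hilbert tensor power `H^{⊗ι}`. -/

/-- The algebraic tensor power of `H` over the index set `ι`.  It is a separate type so that
it does not carry the projective norm. -/
def AlgTensor (ι : Type*) (H : Type*) [NormedAddCommGroup H] [InnerProductSpace ℂ H] : Type _ :=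
  PiTensorProduct ℂ (fun _ : ι => H)

section Tensor

variable {ι H : Type*} [NormedAddCommGroup H] [InnerProductSpace ℂ H]

instance : AddCommGroup (AlgTensor ι H) :=
  inferInstanceAs (AddCommGroup (PiTensorProduct ℂ (fun _ : ι => H)))

instance : Module ℂ (AlgTensor ι H) :=
  inferInstanceAs (Module ℂ (PiTensorProduct ℂ (fun _ : ι => H)))

variable (ι H) in
/-- The identification of `AlgTensor ι H` with Mathlib's tensor power. -/
def toPi : AlgTensor ι H ≃ₗ[ℂ] PiTensorProduct ℂ (fun _ : ι => H) where
  toFun x := x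
  invFun x := x
  map_add' _ _ := rfl
  map_smul' _ _ := rfl
  left_inv _ := rfl
  right_inv _ := rfl

/-- The pure tensor `⨂ v_i` in the algebraic tensor power. -/
def algTprod (v : ι → H) : AlgTensor ι H := (toPi ι H).symm (PiTensorProduct.tprod ℂ v)

lemma span_algTprod : Submodule.span ℂ (Set.range (algTprod (ι := ι) (H := H))) = ⊤ := by
  have h : Set.range (algTprod (ι := ι) (H := H)) =
      (toPi ι H).symm.toLinearMap '' Set.range (PiTensorProduct.tprod ℂ (s := fun _ : ι => H)) := by
    rw [← Set.range_comp]; rfl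
  rw [h, Submodule.span_image, PiTensorProduct.span_tprod_eq_top, Submodule.map_top,
    LinearEquiv.range]

@[elab_as_elim]
lemma algTensor_induction {motive : AlgTensor ι H → Prop} (x : AlgTensor ι H)
    (tp : ∀ v, motive (algTprod v)) (zero : motive 0)
    (add : ∀ x y, motive x → motive y → motive (x + y))
    (smul : ∀ (c : ℂ) x, motive x → motive (c • x)) : motive x := by
  have hx : x ∈ Submodule.span ℂ (Set.range (algTprod (ι := ι) (H := H))) := by
    rw [span_algTprod]; trivial
  induction hx using Submodule.span_induction with
  | mem x h => obtain ⟨v, rfl⟩ := h; exact tp v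
  | zero => exact zero
  | add x y _ _ hx hy => exact add x y hx hy
  | smul c x _ hx => exact smul c x hx

variable [Fintype ι]

/-- The linear functional `⨂ v_i ↦ ∏ ⟪u_i, v_i⟫` on the algebraic tensor power. -/
def pairing (u : ι → H) : AlgTensor ι H →ₗ[ℂ] ℂ :=
  PiTensorProduct.dualDistrib
    (PiTensorProduct.tprod ℂ (fun i => (innerSL ℂ (u i) : H →L[ℂ] ℂ).toLinearMap)) ∘ₗ
      (toPi ι H).toLinearMap

lemma pairing_algTprod (u v : ι → H) : pairing u (algTprod v) = ∏ i, inner ℂ (u i) (v i) := by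
  simp [pairing, algTprod]

lemma conj_pairing_algTprod (u v : ι → H) :
    conj (pairing u (algTprod v)) = pairing v (algTprod u) := by
  simp [pairing_algTprod, inner_conj_symm]

/-- For fixed `y`, the multilinear map `u ↦ conj (pairing u y)`. -/
def conjPairing (y : AlgTensor ι H) : MultilinearMap ℂ (fun _ : ι => H) ℂ where
  toFun u := conj (pairing u y)
  map_update_add' u i a b := by
    induction y using algTensor_induction with
    | tp v =>
      have h : algTprod (Function.update u i (a + b)) =
          algTprod (Function.update u i a) + algTprod (Function.update u i b) := by
        simp [algTprod]
      simp only [conj_pairing_algTprod, h, map_add]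
    | zero => simp
    | add x y hx hy => simp only [map_add, hx, hy]; ring
    | smul c x hx => simp only [map_smul, smul_eq_mul, map_mul, hx]; ring
  map_update_smul' u i c a := by
    induction y using algTensor_induction with
    | tp v =>
      have h : algTprod (Function.update u i (c • a)) =
          c • algTprod (Function.update u i a) := by
        simp [algTprod]
      simp only [conj_pairing_algTprod, h, map_smul]
    | zero => simp
    | add x y hx hy => simp only [map_add, hx, hy, smul_add]
    | smul d x hx => simp only [map_smul, smul_eq_mul, map_mul, hx]; ring

/-- The Hermitian form on the algebraic tensor power, conjugate-linear in the first variable. -/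
def algInner (x y : AlgTensor ι H) : ℂ :=
  conj (PiTensorProduct.lift (conjPairing y) (toPi ι H x))

lemma algInner_algTprod_left (u : ι → H) (y : AlgTensor ι H) :
    algInner (algTprod u) y = pairing u y := by
  simp [algInner, algTprod, conjPairing]

lemma algInner_add_left (x y z : AlgTensor ι H) :
    algInner (x + y) z = algInner x z + algInner y z := by
  simp [algInner]

lemma algInner_smul_left (c : ℂ) (x z : AlgTensor ι H) :
    algInner (c • x) z = conj c * algInner x z := by
  simp [algInner]

lemma algInner_zero_left (z : AlgTensor ι H) : algInner 0 z = 0 := by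
  simpa using algInner_smul_left (0 : ℂ) 0 z

lemma algInner_add_right (x y z : AlgTensor ι H) :
    algInner x (y + z) = algInner x y + algInner x z := by
  induction x using algTensor_induction with
  | tp u => simp only [algInner_algTprod_left, map_add]
  | zero => simp only [algInner_zero_left, add_zero]
  | add a b ha hb => simp only [algInner_add_left, ha, hb]; ring
  | smul c a ha => simp only [algInner_smul_left, ha]; ring

lemma algInner_smul_right (c : ℂ) (x y : AlgTensor ι H) :
    algInner x (c • y) = c * algInner x y := by
  induction x using algTensor_induction with
  | tp u => simp only [algInner_algTprod_left, map_smul, smul_eq_mul]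
  | zero => simp only [algInner_zero_left, mul_zero]
  | add a b ha hb => simp only [algInner_add_left, ha, hb]; ring
  | smul d a ha => simp only [algInner_smul_left, ha]; ring

lemma algInner_zero_right (x : AlgTensor ι H) : algInner x 0 = 0 := by
  simpa using algInner_smul_right (0 : ℂ) x 0

lemma algInner_conj_symm (x y : AlgTensor ι H) : conj (algInner y x) = algInner x y := by
  induction x using algTensor_induction with
  | tp u =>
    induction y using algTensor_induction with
    | tp v => rw [algInner_algTprod_left, algInner_algTprod_left, conj_pairing_algTprod]
    | zero => simp only [algInner_zero_left, algInner_zero_right, map_zero]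
    | add a b ha hb => simp only [algInner_add_left, algInner_add_right, map_add, ha, hb]
    | smul c a ha =>
      simp only [algInner_smul_left, algInner_smul_right, map_mul, Complex.conj_conj, ha]
  | zero => simp only [algInner_zero_left, algInner_zero_right, map_zero]
  | add a b ha hb => simp only [algInner_add_left, algInner_add_right, map_add, ha, hb]
  | smul c a ha => simp only [algInner_smul_left, algInner_smul_right, map_mul, ha]

set_option linter.unusedSectionVars false in
open scoped ComplexOrder in
/-- The Gram matrix of a family of pure tensors is positive semidefinite. -/
lemma posSemidef_prod_gram {κ : Type*} [Finite κ] (v : κ → ι → H) (s : Finset ι) :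
    (Matrix.of fun a b => ∏ i ∈ s, inner ℂ (v a i) (v b i)).PosSemidef := by
  classical
  induction s using Finset.induction_on with
  | empty =>
    have h : (Matrix.of fun a b : κ => ∏ i ∈ (∅ : Finset ι), inner ℂ (v a i) (v b i)) =
        Matrix.gram ℂ (fun _ : κ => (1 : ℂ)) := by
      ext a b; simp [Matrix.gram]
    rw [h]; exact Matrix.posSemidef_gram ℂ _
  | insert i s hi ih =>
    have h : (Matrix.of fun a b : κ => ∏ i ∈ insert i s, inner ℂ (v a i) (v b i)) =
        Matrix.hadamard (Matrix.gram ℂ (fun a => v a i))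
          (Matrix.of fun a b : κ => ∏ i ∈ s, inner ℂ (v a i) (v b i)) := by
      ext a b; simp [Matrix.gram, Finset.prod_insert hi]
    rw [h]; exact (Matrix.posSemidef_gram ℂ _).hadamard ih

open scoped ComplexOrder in
lemma algInner_self_nonneg (x : AlgTensor ι H) : 0 ≤ (algInner x x).re := by
  have hx : x ∈ Submodule.span ℂ (Set.range (algTprod (ι := ι) (H := H))) := by
    rw [span_algTprod]; trivial
  obtain ⟨n, c, g, rfl⟩ := Submodule.mem_span_set'.1 hx
  choose v hv using fun a => (g a).2
  have hl (z : AlgTensor ι H) (t : Finset (Fin n)) :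
      algInner (∑ a ∈ t, c a • (g a : AlgTensor ι H)) z
        = ∑ a ∈ t, conj (c a) * algInner (g a : AlgTensor ι H) z := by
    classical
    induction t using Finset.induction_on with
    | empty => simp [algInner_zero_left]
    | insert a t ha ih =>
      rw [Finset.sum_insert ha, Finset.sum_insert ha, algInner_add_left, algInner_smul_left, ih]
  have key : algInner (∑ a, c a • (g a : AlgTensor ι H)) (∑ a, c a • (g a : AlgTensor ι H)) =
      star c ⬝ᵥ (Matrix.of fun a b => ∏ i, inner ℂ (v a i) (v b i)).mulVec c := by
    rw [hl]
    simp only [dotProduct, Matrix.mulVec, Pi.star_apply, Matrix.of_apply]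
    refine Finset.sum_congr rfl fun a _ => ?_
    congr 1
    rw [← hv a, algInner_algTprod_left, map_sum]
    refine Finset.sum_congr rfl fun b _ => ?_
    rw [← hv b, map_smul, pairing_algTprod, smul_eq_mul, mul_comm]
  rw [key]
  exact (Complex.le_def.1 ((posSemidef_prod_gram v Finset.univ).dotProduct_mulVec_nonneg c)).1

instance instCore : PreInnerProductSpace.Core ℂ (AlgTensor ι H) where
  inner := algInner
  conj_inner_symm x y := algInner_conj_symm x y
  re_inner_nonneg x := algInner_self_nonneg x
  add_left := algInner_add_left
  smul_left x y c := algInner_smul_left c x y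

instance : SeminormedAddCommGroup (AlgTensor ι H) :=
  InnerProductSpace.Core.toSeminormedAddCommGroup (𝕜 := ℂ)

instance : InnerProductSpace ℂ (AlgTensor ι H) := InnerProductSpace.ofCore instCore

variable (ι H) in
/-- The Hilbert tensor power `H^{⊗ι}`: the completion of the algebraic one. -/
abbrev HilbertTensor : Type _ := UniformSpace.Completion (AlgTensor ι H)

/-- The pure tensor `⨂ v_i` in the Hilbert tensor power. -/
def tprod (v : ι → H) : HilbertTensor ι H := (algTprod v : AlgTensor ι H)

lemma inner_tprod (u v : ι → H) : inner ℂ (tprod u) (tprod v) = ∏ i, inner ℂ (u i) (v i) := by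
  unfold tprod
  rw [UniformSpace.Completion.inner_coe]
  exact (algInner_algTprod_left u _).trans (pairing_algTprod u v)

end Tensor

/-! ### Kernels -/

section Kernels

variable {H : Type*} [NormedAddCommGroup H] [InnerProductSpace ℂ H]

/-- The tensor `(u_1 ⊗̂ ⋯ ⊗̂ u_p) ⊗ (v_1 ⊗̂ ⋯ ⊗̂ v_q)` in `H^{⊗(p+q)}`: the pure tensor
symmetrized separately in its first `p` and in its last `q` arguments. -/
def symTprod {p q : ℕ} (u : Fin p → H) (v : Fin q → H) : HilbertTensor (Fin p ⊕ Fin q) H :=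
  ((p.factorial * q.factorial : ℂ)⁻¹) •
    ∑ π : Equiv.Perm (Fin p), ∑ σ : Equiv.Perm (Fin q), tprod (Sum.elim (u ∘ π) (v ∘ σ))

variable (H) in
/-- The space `H^{⊙p} ⊗ H^{⊙q}`, as a closed subspace of `H^{⊗(p+q)}`. -/
def SymKernel (p q : ℕ) : Submodule ℂ (HilbertTensor (Fin p ⊕ Fin q) H) :=
  (Submodule.span ℂ
    (Set.range fun w : (Fin p → H) × (Fin q → H) => symTprod w.1 w.2)).topologicalClosure

end Kernels

/-! ### Complex Gaussian isonormal processes and Wiener–Itô integrals -/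

/-- The complex Hermite polynomial `J_{m,n}(z, ρ)`. -/
def complexHermite (m n : ℕ) (z : ℂ) (ρ : ℝ) : ℂ :=
  ∑ r ∈ Finset.range (min m n + 1), (-1) ^ r * (r.factorial : ℂ) * (m.choose r : ℂ) *
    (n.choose r : ℂ) * z ^ (m - r) * conj z ^ (n - r) * (ρ : ℂ) ^ r

section Isonormal

variable {Ω H : Type*} {mΩ : MeasurableSpace Ω} [NormedAddCommGroup H] [InnerProductSpace ℂ H]

/-- `Z` is a complex Gaussian isonormal process over `H`: a centred jointly Gaussian family of
complex random variables with `E[Z(h)²] = 0` and `E[Z(g) conj Z(h)] = ⟨g, h⟩`, where `⟨g, h⟩`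
is linear in `g`, so that it is `inner ℂ h g`. -/
structure IsComplexIsonormal (P : Measure Ω) (Z : H → Ω → ℂ) : Prop where
  measurable : ∀ h, Measurable (Z h)
  isGaussianProcess : IsGaussianProcess Z P
  integral_eq_zero : ∀ h, ∫ ω, Z h ω ∂P = 0
  integral_sq_eq_zero : ∀ h, ∫ ω, Z h ω ^ 2 ∂P = 0
  integral_mul_conj : ∀ g h, ∫ ω, Z g ω * conj (Z h ω) ∂P = inner ℂ h g

/-- The σ-algebra `σ(Z)` generated by the process. -/
abbrev sigmaAlgebra (Z : H → Ω → ℂ) : MeasurableSpace Ω :=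
  ⨆ h, MeasurableSpace.comap (Z h) inferInstance

variable {ι : Type*} {P : Measure Ω} [IsProbabilityMeasure P]

open scoped Classical in
/-- For `j = (j_1, …, j_p; j_{p+1}, …, j_{p+q})`, the Fourier–Hermite polynomial
`∏_k J_{m_k, n_k}(Z(e_k), 1)`, where `m_k` and `n_k` are the numbers of occurrences of `k` among
`j_1, …, j_p` and among `j_{p+1}, …, j_{p+q}`.  Since
`J_{m,n}(√2 z, 2) = √2^{m+n} J_{m,n}(z, 1)`, this is
`√(𝐦! 𝐧!) ∏_k (2^{m_k+n_k} m_k! n_k!)^{-1/2} J_{m_k,n_k}(√2 Z(e_k), 2)`. -/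
def fourierHermite (Z : H → Ω → ℂ) (e : ι → H) {p q : ℕ} (j : Fin p ⊕ Fin q → ι) (ω : Ω) : ℂ :=
  ∏ k ∈ Finset.univ.image j,
    complexHermite (Finset.univ.filter fun a : Fin p => j (Sum.inl a) = k).card
      (Finset.univ.filter fun b : Fin q => j (Sum.inr b) = k).card (Z (e k) ω) 1

set_option linter.unusedSectionVars false in
lemma memLp_mul {X Y : Ω → ℂ} (hX : ∀ r : ℝ≥0∞, r ≠ ∞ → MemLp X r P)
    (hY : ∀ r : ℝ≥0∞, r ≠ ∞ → MemLp Y r P) (r : ℝ≥0∞) (hr : r ≠ ∞) :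
    MemLp (fun ω => X ω * Y ω) r P := by
  have h2 : (2 * r) ≠ ∞ := ENNReal.mul_ne_top (by simp) hr
  have : ENNReal.HolderTriple (2 * r) (2 * r) r := ⟨by
    rw [ENNReal.mul_inv (by simp) (by simp), ← add_mul, ENNReal.inv_two_add_inv_two, one_mul]⟩
  exact (hY _ h2).mul' (hX _ h2)

lemma memLp_pow {X : Ω → ℂ} (hX : ∀ r : ℝ≥0∞, r ≠ ∞ → MemLp X r P) (n : ℕ) (r : ℝ≥0∞)
    (hr : r ≠ ∞) : MemLp (fun ω => X ω ^ n) r P := by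
  induction n generalizing r with
  | zero => simpa using memLp_const (1 : ℂ)
  | succ n ih => simpa only [pow_succ] using memLp_mul ih hX r hr

lemma memLp_complexHermite {Z : H → Ω → ℂ} (hZ : IsComplexIsonormal P Z) (h : H) (m n : ℕ)
    (ρ : ℝ) (r : ℝ≥0∞) (hr : r ≠ ∞) :
    MemLp (fun ω => complexHermite m n (Z h ω) ρ) r P := by
  have h1 : ∀ r : ℝ≥0∞, r ≠ ∞ → MemLp (Z h) r P := fun r hr =>
    (hZ.isGaussianProcess.hasGaussianLaw_eval h).memLp hr
  have h2 : ∀ r : ℝ≥0∞, r ≠ ∞ → MemLp (fun ω => conj (Z h ω)) r P := fun r hr =>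
    (h1 r hr).star
  unfold complexHermite
  refine memLp_finsetSum _ fun k _ => ?_
  have h3 := memLp_mul (memLp_mul (memLp_pow h1 (m - k)) (memLp_pow h2 (n - k)))
    (fun r _ => memLp_const ((ρ : ℂ) ^ k)) r hr
  convert h3.const_mul ((-1) ^ k * (k.factorial : ℂ) * (m.choose k : ℂ) * (n.choose k : ℂ)) using 2
  ring

lemma memLp_fourierHermite {Z : H → Ω → ℂ} (hZ : IsComplexIsonormal P Z) (e : ι → H) {p q : ℕ}
    (j : Fin p ⊕ Fin q → ι) : MemLp (fourierHermite Z e j) 2 P := by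
  classical
  have key : ∀ (s : Finset ι) (m n : ι → ℕ) (r : ℝ≥0∞), r ≠ ∞ →
      MemLp (fun ω => ∏ k ∈ s, complexHermite (m k) (n k) (Z (e k) ω) 1) r P := by
    intro s m n
    induction s using Finset.induction_on with
    | empty => intro r _; simpa using memLp_const (1 : ℂ)
    | insert a s ha ih =>
      simp only [Finset.prod_insert ha]
      exact memLp_mul (memLp_complexHermite hZ (e a) _ _ 1) ih
  exact key _ _ _ 2 (by simp)

/-- The multiple Wiener–Itô integral `I_{p,q}(f)` of `f ∈ H^{⊙p} ⊗ H^{⊙q}`, computed in the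
orthonormal basis `e`: it is the linear isometry (for the norm `√(p! q!) ‖·‖` on the kernels)
that sends each `(⊗̂_k e_k^{⊗m_k}) ⊗ (⊗̂_k ē_k^{⊗n_k})` to the corresponding
`fourierHermite`, that is
`I_{p,q}(f) = ∑_j ⟨f, e_{j_1} ⊗ ⋯ ⊗ e_{j_p} ⊗ ē_{j_{p+1}} ⊗ ⋯ ⊗ ē_{j_{p+q}}⟩ • fourierHermite j`
with convergence in `L²`. -/
def wienerIto {Z : H → Ω → ℂ} (hZ : IsComplexIsonormal P Z) (C : H ≃ₗᵢ⋆[ℂ] H)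
    (e : HilbertBasis ι ℂ H) (p q : ℕ) (f : SymKernel H p q) : Lp ℂ 2 P :=
  ∑' j : Fin p ⊕ Fin q → ι,
    (inner ℂ (tprod (Sum.elim (fun a => e (j (Sum.inl a))) (fun b => C (e (j (Sum.inr b))))))
      (f : HilbertTensor (Fin p ⊕ Fin q) H) : ℂ) • (memLp_fourierHermite hZ e j).toLp _

end Isonormal

/-! ### Complex Malliavin derivatives -/

/-- The Wirtinger derivative `∂/∂z_j`. -/
def wirtinger {k : ℕ} (j : Fin k) (f : (Fin k → ℂ) → ℂ) (z : Fin k → ℂ) : ℂ :=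
  (1 / 2) * (fderiv ℝ f z (Pi.single j 1) - Complex.I * fderiv ℝ f z (Pi.single j Complex.I))

/-- The Wirtinger derivative `∂/∂z̄_j`. -/
def wirtingerBar {k : ℕ} (j : Fin k) (f : (Fin k → ℂ) → ℂ) (z : Fin k → ℂ) : ℂ :=
  (1 / 2) * (fderiv ℝ f z (Pi.single j 1) + Complex.I * fderiv ℝ f z (Pi.single j Complex.I))

/-- `∂_{a_1} ⋯ ∂_{a_p} ∂̄_{b_1} ⋯ ∂̄_{b_q} f`. -/
def mixedWirtinger {k p q : ℕ} (a : Fin p → Fin k) (b : Fin q → Fin k)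
    (f : (Fin k → ℂ) → ℂ) : (Fin k → ℂ) → ℂ :=
  (List.ofFn a).foldr wirtinger ((List.ofFn b).foldr wirtingerBar f)

section Malliavin

variable {Ω H : Type*} {mΩ : MeasurableSpace Ω} [NormedAddCommGroup H] [InnerProductSpace ℂ H]

/-- The iterated derivative `D^p D̄^q F` of the smooth random variable
`F = f(Z(φ_1), …, Z(φ_k))`, that is
`∑_{a,b} (∂_{a_1} ⋯ ∂_{a_p} ∂̄_{b_1} ⋯ ∂̄_{b_q} f)(Z(φ_1), …, Z(φ_k))
  φ_{a_1} ⊗ ⋯ ⊗ φ_{a_p} ⊗ φ̄_{b_1} ⊗ ⋯ ⊗ φ̄_{b_q}`. -/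
def smoothDeriv (Z : H → Ω → ℂ) (C : H ≃ₗᵢ⋆[ℂ] H) {k : ℕ} (f : (Fin k → ℂ) → ℂ) (φ : Fin k → H)
    (p q : ℕ) (ω : Ω) : HilbertTensor (Fin p ⊕ Fin q) H :=
  ∑ a : Fin p → Fin k, ∑ b : Fin q → Fin k,
    mixedWirtinger a b f (fun i => Z (φ i) ω) •
      tprod (Sum.elim (fun s => φ (a s)) (fun t => C (φ (b t))))

/-- `F` is a smooth random variable `f(Z(φ_1), …, Z(φ_k))`, where `f` is `C^∞` and has, with all
its partial derivatives, polynomial growth, and `G p q = D^p D̄^q F` for all `p, q`. -/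
def IsSmoothWithDerivs (P : Measure Ω) (Z : H → Ω → ℂ) (C : H ≃ₗᵢ⋆[ℂ] H) (F : Lp ℂ 2 P)
    (G : ∀ p q : ℕ, Lp (HilbertTensor (Fin p ⊕ Fin q) H) 2 P) : Prop :=
  ∃ (k : ℕ) (f : (Fin k → ℂ) → ℂ) (φ : Fin k → H), f.HasTemperateGrowth ∧
    (F =ᵐ[P] fun ω => f (fun i => Z (φ i) ω)) ∧
    ∀ p q, G p q =ᵐ[P] smoothDeriv Z C f φ p q

/-- `F` belongs to `𝔻^{m,2} ∩ 𝔻̄^{n,2}`, the closure of the smooth random variables in the norm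
`(∑_{p ≤ m, q ≤ n} E‖D^p D̄^q F‖²)^{1/2}`, and `G p q = D^p D̄^q F` for `p ≤ m` and `q ≤ n`:
there are smooth `F_k → F` in `L²` with `D^p D̄^q F_k → G p q` in `L²` for these `p, q`.
(The values of `G` at other `p, q` play no role.) -/
def IsSobolevWithDerivs (P : Measure Ω) (Z : H → Ω → ℂ) (C : H ≃ₗᵢ⋆[ℂ] H) (m n : ℕ)
    (F : Lp ℂ 2 P) (G : ∀ p q : ℕ, Lp (HilbertTensor (Fin p ⊕ Fin q) H) 2 P) : Prop :=
  ∃ (F' : ℕ → Lp ℂ 2 P) (G' : ℕ → ∀ p q : ℕ, Lp (HilbertTensor (Fin p ⊕ Fin q) H) 2 P),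
    (∀ k, IsSmoothWithDerivs P Z C (F' k) (G' k)) ∧ Tendsto F' atTop (𝓝 F) ∧
    ∀ p ≤ m, ∀ q ≤ n, Tendsto (fun k => G' k p q) atTop (𝓝 (G p q))

end Malliavin

end ComplexWiener

end

open ComplexWiener

/-!
The proof rests on Gaussian integration by parts. For a unit vector `h` and a smooth functional
`F` of the process, `E[F conj Z(h)] = E[⟨D F, h⟩]` and `E[F Z(h)] = E[⟨h, D̄ F⟩]`, where `D̄ F` is
written in the vectors `φ_a` themselves (`integral_comp_mul_conj`, `integral_comp_mul`). Together
with the recursion `J_{m+1,n} = z J_{m,n} - n J_{m,n-1}` this says that integrating `F` against a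
Fourier–Hermite polynomial transfers each of its indices to `F` as a derivative
(`integral_mul_hermiteProd_cons_right`). Two consequences are drawn.

* With another polynomial for `F`, the Fourier–Hermite polynomials are orthogonal, of squared norm
  `𝐦! 𝐧!`. As this is the number of permutations that fix the index, the inner product of two of
  them is a sum over permutations (`inner_hermiteL2`).
* With a smooth random variable for `F`, the inner product of `F` with the polynomial of index `j`
  is the coefficient of `E[D^p D̄^q F]` at the basis tensor of index `j`
  (`inner_hermiteL2_of_isSmoothWithDerivs`).

By the first, the series that defines `I_{p,q}` converges for every element of `H^{⊗(p+q)}` and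
defines a bounded operator `V` (`wienerItoCLM`), and `(p! q!)⁻¹ V* V` is the identity on symmetric
kernels. The kernels of `F` are therefore `f_{p,q} = (p! q!)⁻¹ V* F` (`chaosKernel`). Uniqueness
follows by applying `(p! q!)⁻¹ V*` to an expansion, and the formula follows from the second
consequence, since `V* F` has the coefficients `⟨F, Hermite_j⟩` and both sides are continuous in the
Sobolev norm.

The expansion itself holds because the Fourier–Hermite polynomials are total in `L²(σ(Z))`
(`eq_zero_of_forall_inner_hermiteL2`). If `F` is orthogonal to all of them, then
`E[F̄ Re Z(h)^n] = 0` for every `n` and every `h` in the span of the basis. Summing the exponential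
series gives `E[F̄ exp(i Re Z(h))] = 0`, by continuity for all `h`. Since `Z` is linear almost
surely, these numbers determine the finite-dimensional characteristic functions of `Z` under the signed measure `F̄ P`, so
that this measure vanishes on `σ(Z)`.
-/

namespace ComplexWiener

/-! ### Functions of temperate growth -/

section TemperateGrowth

variable {E F : Type*} [NormedAddCommGroup E] [NormedSpace ℝ E]
  [NormedAddCommGroup F] [NormedSpace ℝ F]

lemma hasTemperateGrowth_fderiv {g : E → F}
    (hg : g.HasTemperateGrowth) : (fderiv ℝ g).HasTemperateGrowth := by
  refine ⟨hg.1.fderiv_right (by simp), fun n => ?_⟩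
  obtain ⟨k, C, h⟩ := hg.2 (n + 1)
  exact ⟨k, C, fun x => by rw [norm_iteratedFDeriv_fderiv]; exact h x⟩

lemma hasTemperateGrowth_fderiv_apply {g : E → F} (hg : g.HasTemperateGrowth) (c : E) :
    (fun x => fderiv ℝ g x c).HasTemperateGrowth :=
  ((ContinuousLinearMap.apply ℝ F c).hasTemperateGrowth).comp (hasTemperateGrowth_fderiv hg)

end TemperateGrowth

/-! ### Real Gaussian integration by parts -/

section Stein

variable {Ω E : Type*} {mΩ : MeasurableSpace Ω} {P : Measure Ω}
  [NormedAddCommGroup E] [NormedSpace ℝ E] [MeasurableSpace E] [BorelSpace E]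
  [SecondCountableTopology E] [CompleteSpace E]

lemma memLp_comp_of_hasTemperateGrowth {F : Type*} [NormedAddCommGroup F] [NormedSpace ℝ F]
    {Y : Ω → E} (hY : HasGaussianLaw Y P) {g : E → F} (hg : g.HasTemperateGrowth)
    {p : ℝ≥0∞} (hp : p ≠ ∞) : MemLp (fun ω => g (Y ω)) p P := by
  have := hY.isProbabilityMeasure
  obtain ⟨k, C, h⟩ := hg.2 0
  have h1 : ∀ n : ℕ, ∀ r : ℝ≥0∞, r ≠ ∞ → MemLp (fun ω => (((1 + ‖Y ω‖) ^ n : ℝ) : ℂ)) r P := by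
    intro n r hr
    have h2 : ∀ r : ℝ≥0∞, r ≠ ∞ → MemLp (fun ω => ((1 + ‖Y ω‖ : ℝ) : ℂ)) r P := fun r hr =>
      (((memLp_const (1 : ℝ)).add (hY.memLp hr).norm)).ofReal
    simpa using memLp_pow h2 n r hr
  refine ((h1 k p hp).const_mul (C : ℂ)).of_le ?_ ?_
  · exact hg.1.continuous.comp_aestronglyMeasurable hY.aemeasurable.aestronglyMeasurable
  · refine ae_of_all _ fun ω => ?_
    have := h (Y ω)
    rw [norm_iteratedFDeriv_zero] at this
    refine this.trans ((le_abs_self _).trans_eq ?_)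
    rw [← Complex.ofReal_mul, Complex.norm_real, Real.norm_eq_abs]

lemma hasDerivAt_gaussianPDFReal (v : NNReal) (hv : v ≠ 0) (x : ℝ) :
    HasDerivAt (gaussianPDFReal 0 v) (-(x / v) * gaussianPDFReal 0 v x) x := by
  have h : HasDerivAt (fun x : ℝ => -(x - 0) ^ 2 / (2 * v)) (-(x / v)) x := by
    have := (((hasDerivAt_id x).sub_const 0).pow 2).neg.div_const (2 * (v : ℝ))
    refine this.congr_deriv ?_
    have : (v : ℝ) ≠ 0 := by exact_mod_cast hv
    simp; field_simp
  have := h.exp.const_mul ((√(2 * Real.pi * v))⁻¹)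
  rw [gaussianPDFReal_def]
  refine this.congr_deriv ?_
  ring

/-- Gaussian integration by parts on the line, from `φ'(x) = -(x / v) φ(x)` for the density `φ`. -/
lemma integral_id_mul_gaussianReal {v : NNReal} (hv : v ≠ 0) {g : ℝ → ℂ}
    (hg : g.HasTemperateGrowth) :
    ∫ x, (x : ℂ) * g x ∂(gaussianReal 0 v) = v * ∫ x, fderiv ℝ g x 1 ∂(gaussianReal 0 v) := by
  have hid : HasGaussianLaw (id : ℝ → ℝ) (gaussianReal 0 v) := IsGaussian.hasGaussianLaw_id
  have int : ∀ f : ℝ → ℂ, f.HasTemperateGrowth →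
      Integrable (fun x => f x * (gaussianPDFReal 0 v x : ℂ)) := by
    intro f hf
    have h1 := memLp_one_iff_integrable.1
      (memLp_comp_of_hasTemperateGrowth hid hf ENNReal.one_ne_top)
    rw [gaussianReal_of_var_ne_zero _ hv, integrable_withDensity_iff_integrable_smul₀'
      (measurable_gaussianPDF 0 v).aemeasurable (ae_of_all _ fun _ => gaussianPDF_lt_top)] at h1
    refine h1.congr (ae_of_all _ fun x => ?_)
    simp [toReal_gaussianPDF, mul_comm]
  have hg' : (fun x => fderiv ℝ g x 1).HasTemperateGrowth :=
    hasTemperateGrowth_fderiv_apply hg 1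
  have hv' : (v : ℂ) ≠ 0 := by exact_mod_cast hv
  have key := integral_mul_deriv_eq_deriv_mul_of_integrable (A := ℂ) (u := g)
    (v := fun x => (gaussianPDFReal 0 v x : ℂ)) (u' := fun x => fderiv ℝ g x 1)
    (v' := fun x => ((-(x / v) * gaussianPDFReal 0 v x : ℝ) : ℂ))
    (fun x _ => ((hg.1.differentiable (by simp)) x).hasFDerivAt.hasDerivAt)
    (fun x _ => (hasDerivAt_gaussianPDFReal v hv x).ofReal_comp) ?_ (int _ hg') (int _ hg)
  · rw [integral_gaussianReal_eq_integral_smul hv, integral_gaussianReal_eq_integral_smul hv]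
    have e1 : ∫ x, gaussianPDFReal 0 v x • fderiv ℝ g x 1 =
        ∫ x, fderiv ℝ g x 1 * (gaussianPDFReal 0 v x : ℂ) := by
      simp [mul_comm]
    have e2 : ∫ x, gaussianPDFReal 0 v x • ((x : ℂ) * g x) =
        -v * ∫ x, g x * ((-(x / v) * gaussianPDFReal 0 v x : ℝ) : ℂ) := by
      rw [← integral_const_mul]
      refine integral_congr_ae (ae_of_all _ fun x => ?_)
      simp only [Complex.real_smul, Complex.ofReal_mul, Complex.ofReal_neg, Complex.ofReal_div]
      field_simp
    rw [e1, e2, key]; ring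
  · have h3 : (fun x : ℝ => -((v : ℂ)⁻¹ * ((x : ℂ) * g x))).HasTemperateGrowth := by fun_prop
    refine (int _ h3).congr (ae_of_all _ fun x => ?_)
    simp only [Pi.mul_apply, Complex.ofReal_mul, Complex.ofReal_neg, Complex.ofReal_div]
    field_simp

/-- Stein's identity: for a centred Gaussian `X` jointly Gaussian with `Y`, and `c` the regression
coefficient of `Y` on `X`, `E[X g(Y)] = v E[D_c g(Y)]`.  Indeed `Y = X c + W` with `W` independent
of `X`, so that conditionally on `W` this is the one-dimensional identity. -/
theorem integral_mul_comp_of_hasGaussianLaw {X : Ω → ℝ} {Y : Ω → E}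
    (hXY : HasGaussianLaw (fun ω => (X ω, Y ω)) P) (hX : ∫ ω, X ω ∂P = 0) {v : NNReal}
    (hv : v ≠ 0) (hXv : ∫ ω, X ω ^ 2 ∂P = v) {c : E} (hc : ∫ ω, X ω • Y ω ∂P = (v : ℝ) • c)
    {g : E → ℂ} (hg : g.HasTemperateGrowth) :
    ∫ ω, (X ω : ℂ) * g (Y ω) ∂P = v * ∫ ω, fderiv ℝ g (Y ω) c ∂P := by
  have := hXY.isProbabilityMeasure
  -- `W` is uncorrelated with `X`, hence independent of it since the pair is Gaussian
  set W : Ω → E := fun ω => Y ω - X ω • c with hW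
  have hYW : ∀ ω, Y ω = X ω • c + W ω := fun ω => by simp [hW]
  have hXW : HasGaussianLaw (fun ω => (X ω, W ω)) P := by
    have := hXY.map_fun ((ContinuousLinearMap.fst ℝ ℝ E).prod
      (ContinuousLinearMap.snd ℝ ℝ E - (ContinuousLinearMap.fst ℝ ℝ E).smulRight c))
    simpa using this
  have iXY : Integrable (fun ω => X ω • Y ω) P :=
    memLp_one_iff_integrable.1 (MemLp.smul (p := 2) (q := 2) hXY.snd.memLp_two hXY.fst.memLp_two)
  have iXX : Integrable (fun ω => X ω ^ 2) P := hXY.fst.memLp_two.integrable_sq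
  have hXWi : ∫ ω, X ω • W ω ∂P = 0 := by
    have : ∀ ω, X ω • W ω = X ω • Y ω - (X ω ^ 2) • c := fun ω => by
      simp only [hW, smul_sub, smul_smul, pow_two]
    simp_rw [this]
    rw [integral_sub iXY (iXX.smul_const c), hc, integral_smul_const, hXv, sub_self]
  have ind : IndepFun X W P := by
    refine hXW.indepFun_of_covariance_strongDual fun L₁ L₂ => ?_
    have hL1 : ∀ x, L₁ x = x * L₁ 1 := fun x => by
      conv_lhs => rw [← mul_one x, ← smul_eq_mul, map_smul, smul_eq_mul]
    rw [covariance_eq_sub ((hXW.fst.map L₁).memLp_two) ((hXW.snd.map L₂).memLp_two)]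
    have e1 : ∫ ω, (L₁ ∘ X) ω ∂P = 0 := by
      have : ∀ ω, (L₁ ∘ X) ω = X ω * L₁ 1 := fun ω => hL1 _
      simp_rw [this]
      rw [integral_mul_const, hX, zero_mul]
    have iXW : Integrable (fun ω => X ω • W ω) P :=
      memLp_one_iff_integrable.1 (MemLp.smul (p := 2) (q := 2) hXW.snd.memLp_two hXW.fst.memLp_two)
    have e2 : ∫ ω, (L₁ ∘ X * L₂ ∘ W) ω ∂P = 0 := by
      have : ∀ ω, (L₁ ∘ X * L₂ ∘ W) ω = L₁ 1 * L₂ (X ω • W ω) := fun ω => by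
        simp only [Pi.mul_apply, Function.comp_apply, map_smul, smul_eq_mul]
        rw [hL1]; ring
      simp_rw [this]
      rw [integral_const_mul, L₂.integral_comp_comm iXW, hXWi, map_zero, mul_zero]
    rw [e1, e2]; simp
  have hmap := (indepFun_iff_map_prod_eq_prod_map_map hXW.fst.aemeasurable
    hXW.snd.aemeasurable).1 ind
  have hXlaw : P.map X = gaussianReal 0 v := by
    rw [hXW.fst.map_eq_gaussianReal, hX, variance_of_integral_eq_zero hXW.fst.aemeasurable hX]
    congr 1
    rw [hXv]; simp
  have : IsProbabilityMeasure (P.map W) := Measure.isProbabilityMeasure_map hXW.snd.aemeasurable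
  -- Fubini for temperate functions of the pair
  have fub : ∀ G : ℝ × E → ℂ, G.HasTemperateGrowth →
      ∫ ω, G (X ω, W ω) ∂P = ∫ w, ∫ x, G (x, w) ∂(gaussianReal 0 v) ∂(P.map W) := by
    intro G hG
    have hm : AEStronglyMeasurable G (P.map fun ω => (X ω, W ω)) :=
      hG.1.continuous.aestronglyMeasurable
    have hi : Integrable G (P.map fun ω => (X ω, W ω)) :=
      (integrable_map_measure hm hXW.aemeasurable).2
        (memLp_one_iff_integrable.1 (memLp_comp_of_hasTemperateGrowth hXW hG ENNReal.one_ne_top))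
    rw [← integral_map hXW.aemeasurable hm]
    rw [hmap, hXlaw] at hi ⊢
    exact integral_prod_symm _ hi
  have tf : (fun z : ℝ × E => z.1).HasTemperateGrowth :=
    (ContinuousLinearMap.fst ℝ ℝ E).hasTemperateGrowth
  have ts : (fun z : ℝ × E => z.2).HasTemperateGrowth :=
    (ContinuousLinearMap.snd ℝ ℝ E).hasTemperateGrowth
  have t0 : (fun z : ℝ × E => z.1 • c + z.2).HasTemperateGrowth := by fun_prop
  have t1 : (fun z : ℝ × E => (z.1 : ℂ) * g (z.1 • c + z.2)).HasTemperateGrowth :=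
    (Complex.ofRealCLM.hasTemperateGrowth.comp tf).mul (hg.comp t0)
  have t2 : (fun z : ℝ × E => fderiv ℝ g (z.1 • c + z.2) c).HasTemperateGrowth :=
    (hasTemperateGrowth_fderiv_apply hg c).comp t0
  simp_rw [hYW]
  rw [fub _ t1, fub _ t2, ← integral_const_mul]
  refine integral_congr_ae (ae_of_all _ fun w => ?_)
  have t3 : (fun x : ℝ => g (x • c + w)).HasTemperateGrowth := by fun_prop
  simp only
  rw [integral_id_mul_gaussianReal hv t3]
  congr 1
  refine integral_congr_ae (ae_of_all _ fun x => ?_)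
  have hd : HasFDerivAt (fun x : ℝ => x • c + w) ((ContinuousLinearMap.id ℝ ℝ).smulRight c) x :=
    ((hasFDerivAt_id x).smul_const c).add_const w
  have := ((hg.1.differentiable (by simp)) (x • c + w)).hasFDerivAt.comp x hd
  simp only
  erw [this.fderiv]
  simp

end Stein

/-! ### Linearity and covariances of the isonormal process -/

section Isonormal

variable {Ω H : Type*} {mΩ : MeasurableSpace Ω} [NormedAddCommGroup H] [InnerProductSpace ℂ H]
  {P : Measure Ω} {Z : H → Ω → ℂ}

namespace IsComplexIsonormal

lemma memLp_eval (hZ : IsComplexIsonormal P Z) (h : H) {p : ℝ≥0∞} (hp : p ≠ ∞) :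
    MemLp (Z h) p P :=
  (hZ.isGaussianProcess.hasGaussianLaw_eval h).memLp hp

lemma integrable_mul (hZ : IsComplexIsonormal P Z) (g h : H) :
    Integrable (fun ω => Z g ω * Z h ω) P :=
  memLp_one_iff_integrable.1
    (MemLp.mul' (hZ.memLp_eval h ENNReal.ofNat_ne_top) (hZ.memLp_eval g ENNReal.ofNat_ne_top)
      (p := 2) (q := 2))

lemma integrable_mul_conj (hZ : IsComplexIsonormal P Z) (g h : H) :
    Integrable (fun ω => Z g ω * conj (Z h ω)) P :=
  memLp_one_iff_integrable.1
    (MemLp.mul' (hZ.memLp_eval h ENNReal.ofNat_ne_top).star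
      (hZ.memLp_eval g ENNReal.ofNat_ne_top) (p := 2) (q := 2))

/-- The value `Z(h)` as an element of `L²`. -/
noncomputable def toL2 (hZ : IsComplexIsonormal P Z) (h : H) : Lp ℂ 2 P :=
  (hZ.memLp_eval h ENNReal.ofNat_ne_top).toLp (Z h)

lemma coeFn_toL2 (hZ : IsComplexIsonormal P Z) (h : H) : hZ.toL2 h =ᵐ[P] Z h :=
  MemLp.coeFn_toLp _

lemma inner_toL2 (hZ : IsComplexIsonormal P Z) (g h : H) :
    inner ℂ (hZ.toL2 g) (hZ.toL2 h) = inner ℂ g h := by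
  rw [L2.inner_def, ← hZ.integral_mul_conj h g]
  refine integral_congr_ae ?_
  filter_upwards [hZ.coeFn_toL2 g, hZ.coeFn_toL2 h] with ω h1 h2
  rw [h1, h2, RCLike.inner_apply]

lemma toL2_add (hZ : IsComplexIsonormal P Z) (g h : H) :
    hZ.toL2 (g + h) = hZ.toL2 g + hZ.toL2 h := by
  rw [← sub_eq_zero, ← inner_self_eq_zero (𝕜 := ℂ)]
  simp only [inner_sub_left, inner_sub_right, inner_add_left, inner_add_right, inner_toL2]
  ring

lemma toL2_smul (hZ : IsComplexIsonormal P Z) (c : ℂ) (h : H) :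
    hZ.toL2 (c • h) = c • hZ.toL2 h := by
  rw [← sub_eq_zero, ← inner_self_eq_zero (𝕜 := ℂ)]
  simp only [inner_sub_left, inner_sub_right, inner_smul_left, inner_smul_right, inner_toL2]
  ring

lemma norm_toL2 (hZ : IsComplexIsonormal P Z) (h : H) : ‖hZ.toL2 h‖ = ‖h‖ := by
  have := hZ.inner_toL2 h h
  rw [inner_self_eq_norm_sq_to_K, inner_self_eq_norm_sq_to_K] at this
  have h2 : ‖hZ.toL2 h‖ ^ 2 = ‖h‖ ^ 2 := by exact_mod_cast this
  exact (sq_eq_sq₀ (norm_nonneg _) (norm_nonneg _)).1 h2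

/-- The process, as a linear isometry into `L²`. -/
noncomputable def toL2Isometry (hZ : IsComplexIsonormal P Z) : H →ₗᵢ[ℂ] Lp ℂ 2 P where
  toFun := hZ.toL2
  map_add' := hZ.toL2_add
  map_smul' := hZ.toL2_smul
  norm_map' := hZ.norm_toL2

lemma eval_add_ae (hZ : IsComplexIsonormal P Z) (g h : H) :
    Z (g + h) =ᵐ[P] fun ω => Z g ω + Z h ω := by
  filter_upwards [hZ.coeFn_toL2 (g + h), hZ.coeFn_toL2 g, hZ.coeFn_toL2 h,
    Lp.coeFn_add (hZ.toL2 g) (hZ.toL2 h)] with ω h1 h2 h3 h4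
  rw [← h1, hZ.toL2_add, h4, Pi.add_apply, h2, h3]

lemma eval_smul_ae (hZ : IsComplexIsonormal P Z) (c : ℂ) (h : H) :
    Z (c • h) =ᵐ[P] fun ω => c * Z h ω := by
  filter_upwards [hZ.coeFn_toL2 (c • h), hZ.coeFn_toL2 h,
    Lp.coeFn_smul c (hZ.toL2 h)] with ω h1 h2 h3
  rw [← h1, hZ.toL2_smul, h3, Pi.smul_apply, h2, smul_eq_mul]

lemma eval_sum_ae (hZ : IsComplexIsonormal P Z) {α : Type*} (s : Finset α)
    (c : α → ℂ) (h : α → H) :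
    Z (∑ a ∈ s, c a • h a) =ᵐ[P] fun ω => ∑ a ∈ s, c a * Z (h a) ω := by
  classical
  induction s using Finset.induction_on with
  | empty => simpa using hZ.eval_smul_ae 0 0
  | insert a s ha ih =>
    simp only [Finset.sum_insert ha]
    filter_upwards [hZ.eval_add_ae (c a • h a) (∑ a ∈ s, c a • h a),
      hZ.eval_smul_ae (c a) (h a), ih] with ω h1 h2 h3
    rw [h1, h2, h3]

lemma integral_mul (hZ : IsComplexIsonormal P Z) (g h : H) : ∫ ω, Z g ω * Z h ω ∂P = 0 := by
  have h1 := hZ.integral_sq_eq_zero (g + h)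
  have h3 : ∫ ω, Z (g + h) ω ^ 2 ∂P =
      ∫ ω, (Z g ω ^ 2 + Z h ω ^ 2) + 2 * (Z g ω * Z h ω) ∂P := by
    refine integral_congr_ae ?_
    filter_upwards [hZ.eval_add_ae g h] with ω h
    rw [h]; ring
  have i (g : H) : Integrable (fun ω => Z g ω ^ 2) P := by
    simpa only [pow_two] using hZ.integrable_mul g g
  have i1 : Integrable (fun ω => Z g ω ^ 2 + Z h ω ^ 2) P := (i g).add (i h)
  rw [h3, integral_add i1 ((hZ.integrable_mul g h).const_mul 2),
    integral_add (i g) (i h), integral_const_mul, hZ.integral_sq_eq_zero,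
    hZ.integral_sq_eq_zero] at h1
  simpa using h1

lemma integral_re_mul (hZ : IsComplexIsonormal P Z) (h g : H) :
    ∫ ω, ((Z h ω).re : ℂ) * Z g ω ∂P = 1 / 2 * inner ℂ h g := by
  have : ∀ ω, ((Z h ω).re : ℂ) * Z g ω = 1 / 2 * (Z h ω * Z g ω + Z g ω * conj (Z h ω)) :=
    fun ω => by rw [Complex.re_eq_add_conj]; ring
  simp_rw [this]
  rw [integral_const_mul, integral_add (hZ.integrable_mul h g) (hZ.integrable_mul_conj g h),
    hZ.integral_mul, hZ.integral_mul_conj, zero_add]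

lemma integral_im_mul (hZ : IsComplexIsonormal P Z) (h g : H) :
    ∫ ω, ((Z h ω).im : ℂ) * Z g ω ∂P = 1 / 2 * (Complex.I * inner ℂ h g) := by
  have : ∀ ω, ((Z h ω).im : ℂ) * Z g ω =
      -Complex.I / 2 * (Z h ω * Z g ω - Z g ω * conj (Z h ω)) := fun ω => by
    rw [Complex.im_eq_sub_conj]
    field_simp
    linear_combination (Z h ω - conj (Z h ω)) * Z g ω * Complex.I_sq
  simp_rw [this]
  rw [integral_const_mul, integral_sub (hZ.integrable_mul h g) (hZ.integrable_mul_conj g h),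
    hZ.integral_mul, hZ.integral_mul_conj]
  ring

lemma hasGaussianLaw_pi (hZ : IsComplexIsonormal P Z) {κ : Type*} [Fintype κ] (φ : κ → H) :
    HasGaussianLaw (fun ω a => Z (φ a) ω) P := by
  classical
  have h1 := hZ.isGaussianProcess.hasGaussianLaw (Finset.univ.image φ)
  exact h1.map_fun (ContinuousLinearMap.pi fun a =>
    ContinuousLinearMap.proj (R := ℝ) (φ := fun _ : Finset.univ.image φ => ℂ)
      ⟨φ a, Finset.mem_image_of_mem _ (Finset.mem_univ a)⟩)

lemma hasGaussianLaw_clm_pi (hZ : IsComplexIsonormal P Z) {κ : Type*} [Fintype κ] (φ : κ → H)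
    (L : ℂ →L[ℝ] ℝ) (h : H) :
    HasGaussianLaw (fun ω => (L (Z h ω), fun a => Z (φ a) ω)) P := by
  have h1 := hZ.hasGaussianLaw_pi (fun o : Option κ => o.elim h φ)
  exact h1.map_fun ((L.comp (ContinuousLinearMap.proj (R := ℝ) none)).prod
    (ContinuousLinearMap.pi fun a => ContinuousLinearMap.proj (R := ℝ) (some a)))

end IsComplexIsonormal

end Isonormal

/-! ### Directional Wirtinger derivatives -/

section Wirtinger

variable {E E' : Type*} [NormedAddCommGroup E] [NormedSpace ℂ E]
  [NormedAddCommGroup E'] [NormedSpace ℂ E']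

/-- The Wirtinger derivative in the direction `c`, that is `∑_a c_a ∂/∂z_a` on `ℂ^κ`; it is
complex linear in `c`. -/
noncomputable def dirW (c : E) (g : E → ℂ) (z : E) : ℂ :=
  (1 / 2) * (fderiv ℝ g z c - Complex.I * fderiv ℝ g z (Complex.I • c))

/-- The conjugate Wirtinger derivative in the direction `c`, that is
`∑_a conj (c_a) ∂/∂z̄_a` on `ℂ^κ`; it is conjugate linear in `c`. -/
noncomputable def dirWbar (c : E) (g : E → ℂ) (z : E) : ℂ :=
  (1 / 2) * (fderiv ℝ g z c + Complex.I * fderiv ℝ g z (Complex.I • c))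

lemma hasTemperateGrowth_dirW {g : E → ℂ} (hg : g.HasTemperateGrowth) (c : E) :
    (dirW c g).HasTemperateGrowth := by
  have h1 := hasTemperateGrowth_fderiv_apply hg c
  have h2 := hasTemperateGrowth_fderiv_apply hg (Complex.I • c)
  unfold dirW
  fun_prop

lemma hasTemperateGrowth_dirWbar {g : E → ℂ} (hg : g.HasTemperateGrowth) (c : E) :
    (dirWbar c g).HasTemperateGrowth := by
  have h1 := hasTemperateGrowth_fderiv_apply hg c
  have h2 := hasTemperateGrowth_fderiv_apply hg (Complex.I • c)
  unfold dirWbar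
  fun_prop

variable {f g : E → ℂ} {z : E}

lemma dirW_mul (hf : DifferentiableAt ℝ f z) (hg : DifferentiableAt ℝ g z) (c : E) :
    dirW c (fun x => f x * g x) z = dirW c f z * g z + f z * dirW c g z := by
  simp only [dirW, fderiv_fun_mul hf hg, add_apply,
    smul_apply, smul_eq_mul]
  ring

lemma dirWbar_mul (hf : DifferentiableAt ℝ f z) (hg : DifferentiableAt ℝ g z) (c : E) :
    dirWbar c (fun x => f x * g x) z = dirWbar c f z * g z + f z * dirWbar c g z := by
  simp only [dirWbar, fderiv_fun_mul hf hg, add_apply,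
    smul_apply, smul_eq_mul]
  ring

lemma dirW_add (hf : DifferentiableAt ℝ f z) (hg : DifferentiableAt ℝ g z) (c : E) :
    dirW c (fun x => f x + g x) z = dirW c f z + dirW c g z := by
  simp only [dirW, fderiv_fun_add hf hg, add_apply]
  ring

lemma dirWbar_add (hf : DifferentiableAt ℝ f z) (hg : DifferentiableAt ℝ g z) (c : E) :
    dirWbar c (fun x => f x + g x) z = dirWbar c f z + dirWbar c g z := by
  simp only [dirWbar, fderiv_fun_add hf hg, add_apply]
  ring

lemma fderiv_conj_comp (hf : DifferentiableAt ℝ f z) (c : E) :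
    fderiv ℝ (fun x => conj (f x)) z c = conj (fderiv ℝ f z c) := by
  have h := (Complex.conjCLE.toContinuousLinearMap.hasFDerivAt.comp z hf.hasFDerivAt).fderiv
  have : (fun x => conj (f x)) = Complex.conjCLE.toContinuousLinearMap ∘ f := by
    ext; simp
  rw [this, h]; simp

lemma dirW_conj (hf : DifferentiableAt ℝ f z) (c : E) :
    dirW c (fun x => conj (f x)) z = conj (dirWbar c f z) := by
  simp [dirW, dirWbar, fderiv_conj_comp hf, map_ofNat]
  ring

lemma dirWbar_conj (hf : DifferentiableAt ℝ f z) (c : E) :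
    dirWbar c (fun x => conj (f x)) z = conj (dirW c f z) := by
  simp [dirW, dirWbar, fderiv_conj_comp hf, map_ofNat]

lemma fderiv_comp_clm (L : E' →L[ℂ] E) {y : E'} (hf : DifferentiableAt ℝ f (L y)) (c : E') :
    fderiv ℝ (fun x => f (L x)) y c = fderiv ℝ f (L y) (L c) := by
  have h := (hf.hasFDerivAt.comp y (L.restrictScalars ℝ).hasFDerivAt).fderiv
  have : (fun x => f (L x)) = f ∘ L := rfl
  rw [this, h]; simp

lemma dirW_comp_clm (L : E' →L[ℂ] E) {y : E'} (hf : DifferentiableAt ℝ f (L y)) (c : E') :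
    dirW c (fun x => f (L x)) y = dirW (L c) f (L y) := by
  simp only [dirW, fderiv_comp_clm L hf, map_smul]

lemma dirWbar_comp_clm (L : E' →L[ℂ] E) {y : E'} (hf : DifferentiableAt ℝ f (L y)) (c : E') :
    dirWbar c (fun x => f (L x)) y = dirWbar (L c) f (L y) := by
  simp only [dirWbar, fderiv_comp_clm L hf, map_smul]

lemma fderiv_smul_eq (g : E → ℂ) (z : E) (a : ℂ) (c : E) :
    fderiv ℝ g z (a • c) = a.re * fderiv ℝ g z c + a.im * fderiv ℝ g z (Complex.I • c) := by
  have h : a • c = a.re • c + a.im • (Complex.I • c) := by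
    conv_lhs => rw [← Complex.re_add_im a, add_smul, mul_smul]
    rfl
  rw [h, map_add, map_smul, map_smul]
  simp

lemma dirW_smul (g : E → ℂ) (z : E) (a : ℂ) (c : E) : dirW (a • c) g z = a * dirW c g z := by
  simp only [dirW]
  rw [smul_smul, fderiv_smul_eq, fderiv_smul_eq g z (Complex.I * a)]
  simp only [Complex.mul_re, Complex.mul_im, Complex.I_re, Complex.I_im]
  conv_rhs => rw [← Complex.re_add_im a]
  push_cast
  linear_combination (1 / 2 * (a.im : ℂ) * fderiv ℝ g z (Complex.I • c)) * Complex.I_sq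

lemma dirWbar_smul (g : E → ℂ) (z : E) (a : ℂ) (c : E) :
    dirWbar (a • c) g z = conj a * dirWbar c g z := by
  simp only [dirWbar]
  rw [smul_smul, fderiv_smul_eq, fderiv_smul_eq g z (Complex.I * a)]
  simp only [Complex.mul_re, Complex.mul_im, Complex.I_re, Complex.I_im]
  conv_rhs => rw [← Complex.re_add_im a]
  simp only [map_add, map_mul, Complex.conj_ofReal, Complex.conj_I]
  push_cast
  linear_combination (1 / 2 * (a.im : ℂ) * fderiv ℝ g z (Complex.I • c)) * Complex.I_sq

lemma dirW_sum {α : Type*} (s : Finset α) (c : α → E) (g : E → ℂ) (z : E) :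
    dirW (∑ a ∈ s, c a) g z = ∑ a ∈ s, dirW (c a) g z := by
  simp only [dirW, Finset.smul_sum, map_sum]
  rw [← Finset.mul_sum, Finset.sum_sub_distrib, Finset.mul_sum]

lemma dirWbar_sum {α : Type*} (s : Finset α) (c : α → E) (g : E → ℂ) (z : E) :
    dirWbar (∑ a ∈ s, c a) g z = ∑ a ∈ s, dirWbar (c a) g z := by
  simp only [dirWbar, Finset.smul_sum, map_sum]
  rw [← Finset.mul_sum, Finset.sum_add_distrib, Finset.mul_sum]

lemma pi_eq_sum_smul_single {k : ℕ} (c : Fin k → ℂ) :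
    c = ∑ a, c a • (Pi.single a 1 : Fin k → ℂ) := by
  ext i; simp [Finset.sum_apply, Pi.single_apply]

lemma I_smul_single {k : ℕ} (a : Fin k) :
    (Pi.single a Complex.I : Fin k → ℂ) = Complex.I • (Pi.single a 1 : Fin k → ℂ) := by
  ext i; simp [Pi.single_apply]

lemma dirW_eq_sum_wirtinger {k : ℕ} (c : Fin k → ℂ) (g : (Fin k → ℂ) → ℂ) (z : Fin k → ℂ) :
    dirW c g z = ∑ a, c a * wirtinger a g z := by
  conv_lhs => rw [pi_eq_sum_smul_single c, dirW_sum]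
  refine Finset.sum_congr rfl fun a _ => ?_
  rw [dirW_smul, wirtinger, dirW, I_smul_single]

lemma dirWbar_eq_sum_wirtingerBar {k : ℕ} (c : Fin k → ℂ) (g : (Fin k → ℂ) → ℂ)
    (z : Fin k → ℂ) : dirWbar c g z = ∑ a, conj (c a) * wirtingerBar a g z := by
  conv_lhs => rw [pi_eq_sum_smul_single c, dirWbar_sum]
  refine Finset.sum_congr rfl fun a _ => ?_
  rw [dirWbar_smul, wirtingerBar, dirWbar, I_smul_single]

end Wirtinger

/-! ### Complex Gaussian integration by parts -/

section ComplexStein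

variable {Ω H : Type*} {mΩ : MeasurableSpace Ω} [NormedAddCommGroup H] [InnerProductSpace ℂ H]
  {P : Measure Ω} {Z : H → Ω → ℂ} {κ : Type*} [Fintype κ]

/-- The regression coefficient of the vector `Z(φ)` on a real coordinate of `Z(h)`: the real part
has `b = 1` and the imaginary part `b = i`. -/
lemma integral_clm_smul_pi [IsProbabilityMeasure P] (hZ : IsComplexIsonormal P Z) (φ : κ → H)
    (L : ℂ →L[ℝ] ℝ) (h : H) (b : ℂ)
    (hL : ∀ g, ∫ ω, ((L (Z h ω) : ℝ) : ℂ) * Z g ω ∂P = 1 / 2 * (b * inner ℂ h g)) :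
    ∫ ω, L (Z h ω) • (fun a => Z (φ a) ω) ∂P =
      ((1 / 2 : NNReal) : ℝ) • b • fun a => (inner ℂ h (φ a) : ℂ) := by
  ext a
  have hi : ∀ a, Integrable (fun ω => (L (Z h ω) • (fun a => Z (φ a) ω) : κ → ℂ) a) P := fun a =>
    memLp_one_iff_integrable.1 (MemLp.smul (p := 2) (q := 2)
      (hZ.memLp_eval (φ a) ENNReal.ofNat_ne_top)
      (L.comp_memLp' (hZ.memLp_eval h ENNReal.ofNat_ne_top)))
  rw [eval_integral hi]
  simpa using hL (φ a)

/-- Stein's identity for a real coordinate `L (Z(h))`, which has variance `1 / 2` when `‖h‖ = 1`. -/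
lemma integral_mul_comp_re_im [IsProbabilityMeasure P] (hZ : IsComplexIsonormal P Z) (φ : κ → H)
    (L : ℂ →L[ℝ] ℝ) {h : H} (hh : ‖h‖ = 1) (b : ℂ) (hb : L b = 1)
    (hL : ∀ g, ∫ ω, ((L (Z h ω) : ℝ) : ℂ) * Z g ω ∂P = 1 / 2 * (b * inner ℂ h g))
    {g : (κ → ℂ) → ℂ} (hg : g.HasTemperateGrowth) :
    ∫ ω, (L (Z h ω) : ℂ) * g (fun a => Z (φ a) ω) ∂P =
      1 / 2 * ∫ ω, fderiv ℝ g (fun a => Z (φ a) ω) (b • fun a => inner ℂ h (φ a)) ∂P := by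
  have hZi : Integrable (Z h) P :=
    memLp_one_iff_integrable.1 (hZ.memLp_eval h ENNReal.one_ne_top)
  have hXX : ∫ ω, L (Z h ω) ^ 2 ∂P = ((1 / 2 : NNReal) : ℝ) := by
    have h1 := hL h
    have hi : Integrable (fun ω => ((L (Z h ω) : ℝ) : ℂ) * Z h ω) P :=
      memLp_one_iff_integrable.1 (MemLp.mul' (p := 2) (q := 2)
        (hZ.memLp_eval h ENNReal.ofNat_ne_top)
        (MemLp.ofReal (f := fun ω => L (Z h ω))
          (L.comp_memLp' (hZ.memLp_eval h ENNReal.ofNat_ne_top))))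
    have h2 := L.integral_comp_comm hi
    rw [h1, inner_self_eq_norm_sq_to_K, hh] at h2
    have h3 : ∀ ω, L (((L (Z h ω) : ℝ) : ℂ) * Z h ω) = L (Z h ω) ^ 2 := fun ω => by
      rw [← Complex.real_smul, map_smul, smul_eq_mul, pow_two]
    simp_rw [h3] at h2
    rw [h2]
    have h4 : (1 / 2 * (b * ((1 : ℝ) : ℂ) ^ 2) : ℂ) = ((1 / 2 : ℝ)) • b := by
      simp
    erw [h4, map_smul, hb]
    simp
  have h0 : ∫ ω, L (Z h ω) ∂P = 0 := by
    rw [L.integral_comp_comm hZi, hZ.integral_eq_zero, map_zero]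
  have := integral_mul_comp_of_hasGaussianLaw (hZ.hasGaussianLaw_clm_pi φ L h) h0
    (v := 1 / 2) (by simp) hXX (integral_clm_smul_pi hZ φ L h b hL) hg
  simpa using this

lemma integrable_fderiv_comp (hZ : IsComplexIsonormal P Z) (φ : κ → H) {g : (κ → ℂ) → ℂ}
    (hg : g.HasTemperateGrowth) (c : κ → ℂ) :
    Integrable (fun ω => fderiv ℝ g (fun a => Z (φ a) ω) c) P :=
  memLp_one_iff_integrable.1 (memLp_comp_of_hasTemperateGrowth (hZ.hasGaussianLaw_pi φ)
    (hasTemperateGrowth_fderiv_apply hg c) ENNReal.one_ne_top)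

lemma integrable_clm_mul_comp (hZ : IsComplexIsonormal P Z) (φ : κ → H) (L : ℂ →L[ℝ] ℝ) (h : H)
    {g : (κ → ℂ) → ℂ} (hg : g.HasTemperateGrowth) :
    Integrable (fun ω => (L (Z h ω) : ℂ) * g (fun a => Z (φ a) ω)) P :=
  memLp_one_iff_integrable.1 (MemLp.mul' (p := 2) (q := 2)
        (memLp_comp_of_hasTemperateGrowth (hZ.hasGaussianLaw_pi φ) hg ENNReal.ofNat_ne_top)
        (MemLp.ofReal (f := fun ω => L (Z h ω))
          (L.comp_memLp' (hZ.memLp_eval h ENNReal.ofNat_ne_top))))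

variable [IsProbabilityMeasure P]

/-- Gaussian integration by parts: `E[g(Z(φ)) conj Z(h)] = E[∑_a ⟨φ_a, h⟩ (∂_a g)(Z(φ))]`. -/
theorem integral_comp_mul_conj (hZ : IsComplexIsonormal P Z) (φ : κ → H) {h : H} (hh : ‖h‖ = 1)
    {g : (κ → ℂ) → ℂ} (hg : g.HasTemperateGrowth) :
    ∫ ω, g (fun a => Z (φ a) ω) * conj (Z h ω) ∂P =
      ∫ ω, dirW (fun a => (inner ℂ h (φ a) : ℂ)) g (fun a => Z (φ a) ω) ∂P := by
  have hre := integral_mul_comp_re_im hZ φ Complex.reCLM hh 1 (by simp)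
    (by simpa using hZ.integral_re_mul h) hg
  have him := integral_mul_comp_re_im hZ φ Complex.imCLM hh Complex.I (by simp)
    (by simpa using hZ.integral_im_mul h) hg
  have e : ∀ ω, g (fun a => Z (φ a) ω) * conj (Z h ω) =
      (Complex.reCLM (Z h ω) : ℂ) * g (fun a => Z (φ a) ω) -
        Complex.I * ((Complex.imCLM (Z h ω) : ℂ) * g (fun a => Z (φ a) ω)) := fun ω => by
    conv_lhs => rw [← Complex.re_add_im (Z h ω)]
    simp only [map_add, map_mul, Complex.conj_ofReal, Complex.conj_I, Complex.reCLM_apply,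
      Complex.imCLM_apply]
    ring
  simp_rw [e]
  rw [integral_sub (integrable_clm_mul_comp hZ φ _ h hg)
    ((integrable_clm_mul_comp hZ φ _ h hg).const_mul _), integral_const_mul, hre, him]
  simp only [dirW]
  rw [integral_const_mul, integral_sub (integrable_fderiv_comp hZ φ hg _)
    ((integrable_fderiv_comp hZ φ hg _).const_mul _), integral_const_mul, one_smul]
  ring

/-- The conjugate form of Gaussian integration by parts, with `∂̄` in place of `∂`. -/
theorem integral_comp_mul (hZ : IsComplexIsonormal P Z) (φ : κ → H) {h : H} (hh : ‖h‖ = 1)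
    {g : (κ → ℂ) → ℂ} (hg : g.HasTemperateGrowth) :
    ∫ ω, g (fun a => Z (φ a) ω) * Z h ω ∂P =
      ∫ ω, dirWbar (fun a => (inner ℂ h (φ a) : ℂ)) g (fun a => Z (φ a) ω) ∂P := by
  have hre := integral_mul_comp_re_im hZ φ Complex.reCLM hh 1 (by simp)
    (by simpa using hZ.integral_re_mul h) hg
  have him := integral_mul_comp_re_im hZ φ Complex.imCLM hh Complex.I (by simp)
    (by simpa using hZ.integral_im_mul h) hg
  have e : ∀ ω, g (fun a => Z (φ a) ω) * Z h ω =
      (Complex.reCLM (Z h ω) : ℂ) * g (fun a => Z (φ a) ω) +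
        Complex.I * ((Complex.imCLM (Z h ω) : ℂ) * g (fun a => Z (φ a) ω)) := fun ω => by
    conv_lhs => rw [← Complex.re_add_im (Z h ω)]
    simp only [Complex.reCLM_apply, Complex.imCLM_apply]
    ring
  simp_rw [e]
  rw [integral_add (integrable_clm_mul_comp hZ φ _ h hg)
    ((integrable_clm_mul_comp hZ φ _ h hg).const_mul _), integral_const_mul, hre, him]
  simp only [dirWbar]
  rw [integral_const_mul, integral_add (integrable_fderiv_comp hZ φ hg _)
    ((integrable_fderiv_comp hZ φ hg _).const_mul _), integral_const_mul, one_smul]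
  ring

end ComplexStein

/-! ### Smooth functionals and their directional derivatives -/

section SmoothFunctional

variable {Ω H : Type*} {mΩ : MeasurableSpace Ω} [NormedAddCommGroup H] [InnerProductSpace ℂ H]
  {P : Measure Ω} {Z : H → Ω → ℂ}

/-- `F` is a smooth functional `g(Z(φ))` of the process, and `F₁ = ⟨D F, h⟩` and
`F₂ = ⟨h, D̄ F⟩` are its directional derivatives, where `⟨·, ·⟩` is linear in the first variable
and `D̄ F` stands for `∑_a (∂̄_a g)(Z(φ)) φ_a`.  All three are functions of `ω`, not classes
modulo null sets. -/
def HasSmoothDerivs (Z : H → Ω → ℂ) (h : H) (F F₁ F₂ : Ω → ℂ) : Prop :=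
  ∃ (κ : Type) (_ : Fintype κ) (φ : κ → H) (g : (κ → ℂ) → ℂ), g.HasTemperateGrowth ∧
    (F = fun ω => g fun a => Z (φ a) ω) ∧
    (F₁ = fun ω => dirW (fun a => (inner ℂ h (φ a) : ℂ)) g fun a => Z (φ a) ω) ∧
    (F₂ = fun ω => dirWbar (fun a => (inner ℂ h (φ a) : ℂ)) g fun a => Z (φ a) ω)

namespace HasSmoothDerivs

variable {h : H} {F F₁ F₂ G G₁ G₂ : Ω → ℂ}

lemma memLp (hZ : IsComplexIsonormal P Z) (hF : HasSmoothDerivs Z h F F₁ F₂) {p : ℝ≥0∞}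
    (hp : p ≠ ∞) : MemLp F p P := by
  obtain ⟨κ, _, φ, g, hg, rfl, -, -⟩ := hF
  exact memLp_comp_of_hasTemperateGrowth (hZ.hasGaussianLaw_pi φ) hg hp

lemma memLp_left (hZ : IsComplexIsonormal P Z) (hF : HasSmoothDerivs Z h F F₁ F₂) {p : ℝ≥0∞}
    (hp : p ≠ ∞) : MemLp F₁ p P := by
  obtain ⟨κ, _, φ, g, hg, -, rfl, -⟩ := hF
  exact memLp_comp_of_hasTemperateGrowth (hZ.hasGaussianLaw_pi φ) (hasTemperateGrowth_dirW hg _) hp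

lemma integral_mul_conj [IsProbabilityMeasure P] (hZ : IsComplexIsonormal P Z)
    (hF : HasSmoothDerivs Z h F F₁ F₂) (hh : ‖h‖ = 1) :
    ∫ ω, F ω * conj (Z h ω) ∂P = ∫ ω, F₁ ω ∂P := by
  obtain ⟨κ, _, φ, g, hg, rfl, rfl, -⟩ := hF
  exact integral_comp_mul_conj hZ φ hh hg

lemma integral_mul [IsProbabilityMeasure P] (hZ : IsComplexIsonormal P Z)
    (hF : HasSmoothDerivs Z h F F₁ F₂) (hh : ‖h‖ = 1) :
    ∫ ω, F ω * Z h ω ∂P = ∫ ω, F₂ ω ∂P := by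
  obtain ⟨κ, _, φ, g, hg, rfl, -, rfl⟩ := hF
  exact integral_comp_mul hZ φ hh hg

lemma const (Z : H → Ω → ℂ) (h : H) (c : ℂ) :
    HasSmoothDerivs Z h (fun _ => c) (fun _ => 0) (fun _ => 0) := by
  refine ⟨Empty, inferInstance, Empty.elim, fun _ => c, .const c, rfl, ?_, ?_⟩ <;>
  · ext ω; simp [dirW, dirWbar]

lemma eval (Z : H → Ω → ℂ) (h k : H) :
    HasSmoothDerivs Z h (Z k) (fun _ => inner ℂ h k) (fun _ => 0) := by
  have hd : ∀ z : Unit → ℂ, fderiv ℝ (fun z : Unit → ℂ => z ()) z =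
      ContinuousLinearMap.proj (R := ℝ) () := fun z =>
    (ContinuousLinearMap.proj (R := ℝ) (φ := fun _ : Unit => ℂ) ()).hasFDerivAt.fderiv
  refine ⟨Unit, inferInstance, fun _ => k, fun z => z (),
    (ContinuousLinearMap.proj (R := ℝ) (φ := fun _ : Unit => ℂ) ()).hasTemperateGrowth,
    rfl, ?_, ?_⟩
  · ext ω
    simp only [dirW, hd, ContinuousLinearMap.proj_apply, Pi.smul_apply, smul_eq_mul]
    linear_combination (1 / 2 * (inner ℂ h k : ℂ)) * Complex.I_sq
  · ext ω
    simp only [dirWbar, hd, ContinuousLinearMap.proj_apply, Pi.smul_apply, smul_eq_mul]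
    linear_combination (-1 / 2 * (inner ℂ h k : ℂ)) * Complex.I_sq

lemma conj_comp (hF : HasSmoothDerivs Z h F F₁ F₂) :
    HasSmoothDerivs Z h (fun ω => conj (F ω)) (fun ω => conj (F₂ ω))
      (fun ω => conj (F₁ ω)) := by
  obtain ⟨κ, _, φ, g, hg, rfl, rfl, rfl⟩ := hF
  refine ⟨κ, inferInstance, φ, fun z => (starRingEnd ℂ) (g z),
    Complex.conjCLE.toContinuousLinearMap.hasTemperateGrowth.comp hg, rfl, ?_, ?_⟩
  · ext ω; rw [dirW_conj (hg.1.differentiable (by simp) _)]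
  · ext ω; rw [dirWbar_conj (hg.1.differentiable (by simp) _)]

/-- Two smooth functionals can be written with the same vectors `φ_a`. -/
lemma exists_common (hF : HasSmoothDerivs Z h F F₁ F₂) (hG : HasSmoothDerivs Z h G G₁ G₂) :
    ∃ (κ : Type) (_ : Fintype κ) (φ : κ → H) (f g : (κ → ℂ) → ℂ), f.HasTemperateGrowth ∧
      g.HasTemperateGrowth ∧ (F = fun ω => f fun a => Z (φ a) ω) ∧
      (F₁ = fun ω => dirW (fun a => (inner ℂ h (φ a) : ℂ)) f fun a => Z (φ a) ω) ∧
      (F₂ = fun ω => dirWbar (fun a => (inner ℂ h (φ a) : ℂ)) f fun a => Z (φ a) ω) ∧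
      (G = fun ω => g fun a => Z (φ a) ω) ∧
      (G₁ = fun ω => dirW (fun a => (inner ℂ h (φ a) : ℂ)) g fun a => Z (φ a) ω) ∧
      (G₂ = fun ω => dirWbar (fun a => (inner ℂ h (φ a) : ℂ)) g fun a => Z (φ a) ω) := by
  obtain ⟨κ, _, φ, f, hf, rfl, rfl, rfl⟩ := hF
  obtain ⟨κ', _, φ', g, hg, rfl, rfl, rfl⟩ := hG
  let L : (κ ⊕ κ' → ℂ) →L[ℂ] (κ → ℂ) :=
    ContinuousLinearMap.pi fun a => ContinuousLinearMap.proj (Sum.inl a)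
  let L' : (κ ⊕ κ' → ℂ) →L[ℂ] (κ' → ℂ) :=
    ContinuousLinearMap.pi fun a => ContinuousLinearMap.proj (Sum.inr a)
  refine ⟨κ ⊕ κ', inferInstance, Sum.elim φ φ', fun z => f (L z), fun z => g (L' z),
    hf.comp (L.restrictScalars ℝ).hasTemperateGrowth,
    hg.comp (L'.restrictScalars ℝ).hasTemperateGrowth, rfl, ?_, ?_, rfl, ?_, ?_⟩
  · ext ω; rw [dirW_comp_clm L (hf.1.differentiable (by simp) _)]; rfl
  · ext ω; rw [dirWbar_comp_clm L (hf.1.differentiable (by simp) _)]; rfl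
  · ext ω; rw [dirW_comp_clm L' (hg.1.differentiable (by simp) _)]; rfl
  · ext ω; rw [dirWbar_comp_clm L' (hg.1.differentiable (by simp) _)]; rfl

lemma mul (hF : HasSmoothDerivs Z h F F₁ F₂) (hG : HasSmoothDerivs Z h G G₁ G₂) :
    HasSmoothDerivs Z h (fun ω => F ω * G ω) (fun ω => F₁ ω * G ω + F ω * G₁ ω)
      (fun ω => F₂ ω * G ω + F ω * G₂ ω) := by
  obtain ⟨κ, _, φ, f, g, hf, hg, rfl, rfl, rfl, rfl, rfl, rfl⟩ := hF.exists_common hG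
  refine ⟨κ, inferInstance, φ, fun z => f z * g z, hf.mul hg, rfl, ?_, ?_⟩
  · ext ω; rw [dirW_mul (hf.1.differentiable (by simp) _) (hg.1.differentiable (by simp) _)]
  · ext ω; rw [dirWbar_mul (hf.1.differentiable (by simp) _) (hg.1.differentiable (by simp) _)]

lemma add (hF : HasSmoothDerivs Z h F F₁ F₂) (hG : HasSmoothDerivs Z h G G₁ G₂) :
    HasSmoothDerivs Z h (fun ω => F ω + G ω) (fun ω => F₁ ω + G₁ ω) (fun ω => F₂ ω + G₂ ω) := by
  obtain ⟨κ, _, φ, f, g, hf, hg, rfl, rfl, rfl, rfl, rfl, rfl⟩ := hF.exists_common hG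
  refine ⟨κ, inferInstance, φ, fun z => f z + g z, hf.add hg, rfl, ?_, ?_⟩
  · ext ω; rw [dirW_add (hf.1.differentiable (by simp) _) (hg.1.differentiable (by simp) _)]
  · ext ω; rw [dirWbar_add (hf.1.differentiable (by simp) _) (hg.1.differentiable (by simp) _)]

lemma const_mul (hF : HasSmoothDerivs Z h F F₁ F₂) (c : ℂ) :
    HasSmoothDerivs Z h (fun ω => c * F ω) (fun ω => c * F₁ ω) (fun ω => c * F₂ ω) := by
  simpa using (const Z h c).mul hF

/-- A product of functionals whose derivatives in the direction `h` vanish has the same property. -/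
lemma prod_of_eq_zero {α : Type*} (s : Finset α) (f : α → Ω → ℂ)
    (hf : ∀ a ∈ s, HasSmoothDerivs Z h (f a) (fun _ => 0) (fun _ => 0)) :
    HasSmoothDerivs Z h (fun ω => ∏ a ∈ s, f a ω) (fun _ => 0) (fun _ => 0) := by
  classical
  induction s using Finset.induction_on with
  | empty => simpa using const Z h 1
  | insert a s ha ih =>
    simp only [Finset.prod_insert ha]
    simpa using (hf a (Finset.mem_insert_self a s)).mul
      (ih fun b hb => hf b (Finset.mem_insert_of_mem hb))

end HasSmoothDerivs

end SmoothFunctional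

/-! ### Recursions for complex Hermite polynomials -/

section Hermite

/-- The sum that defines `J_{m,n}` may be taken over `r ≤ m`, since `n.choose r = 0` for `r > n`. -/
lemma complexHermite_eq_sum_range_left (m n : ℕ) (z : ℂ) (ρ : ℝ) :
    complexHermite m n z ρ = ∑ r ∈ Finset.range (m + 1), (-1) ^ r * (r.factorial : ℂ) *
      (m.choose r : ℂ) * (n.choose r : ℂ) * z ^ (m - r) * conj z ^ (n - r) * (ρ : ℂ) ^ r := by
  refine Finset.sum_subset (by gcongr; omega) fun r hr hr' => ?_
  simp only [Finset.mem_range] at hr hr'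
  rw [Nat.choose_eq_zero_of_lt (show n < r by omega)]
  simp

lemma complexHermite_conj (m n : ℕ) (z : ℂ) (ρ : ℝ) :
    conj (complexHermite m n z ρ) = complexHermite n m z ρ := by
  simp only [complexHermite, map_sum, map_mul, map_pow, map_neg, map_one, map_natCast,
    Complex.conj_conj, Complex.conj_ofReal, min_comm m n]
  exact Finset.sum_congr rfl fun r _ => by ring

@[simp] lemma complexHermite_zero_zero (z : ℂ) (ρ : ℝ) : complexHermite 0 0 z ρ = 1 := by
  simp [complexHermite]

lemma complexHermite_zero_left (n : ℕ) (z : ℂ) (ρ : ℝ) :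
    complexHermite 0 n z ρ = conj z ^ n := by
  simp [complexHermite]

/-- The three-term recursion `J_{m+1,n} = z J_{m,n} - n ρ J_{m,n-1}`. -/
lemma complexHermite_succ_left (m n : ℕ) (z : ℂ) (ρ : ℝ) :
    complexHermite (m + 1) n z ρ =
      z * complexHermite m n z ρ - n * ρ * complexHermite m (n - 1) z ρ := by
  have e1 : complexHermite m n z ρ = ∑ r ∈ Finset.range (m + 1 + 1), (-1) ^ r *
      (r.factorial : ℂ) * (m.choose r : ℂ) * (n.choose r : ℂ) * z ^ (m - r) * conj z ^ (n - r) *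
      (ρ : ℂ) ^ r := by
    rw [Finset.sum_range_succ, ← complexHermite_eq_sum_range_left]
    simp
  rw [e1, complexHermite_eq_sum_range_left, complexHermite_eq_sum_range_left m (n - 1),
    Finset.sum_range_succ' _ (m + 1), Finset.sum_range_succ' _ (m + 1), mul_add,
    Finset.mul_sum, Finset.mul_sum,
    add_sub_right_comm, ← Finset.sum_sub_distrib]
  congr 1
  · refine Finset.sum_congr rfl fun r hr => ?_
    have hr' : r ≤ m := by simpa [Nat.lt_succ_iff] using hr
    rcases n with _ | n
    · simp
    have h1 : ((n + 1 : ℕ) : ℂ) * (n.choose r : ℂ) =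
        ((n + 1).choose (r + 1) : ℂ) * ((r + 1 : ℕ) : ℂ) := by
      exact_mod_cast Nat.add_one_mul_choose_eq n r
    have h2 : z * ((m.choose (r + 1) : ℂ) * z ^ (m - (r + 1))) =
        (m.choose (r + 1) : ℂ) * z ^ (m - r) := by
      rcases hr'.eq_or_lt with rfl | hlt
      · simp
      · rw [show m - r = m - (r + 1) + 1 by omega]; ring
    rw [Nat.factorial_succ, Nat.choose_succ_succ m r, Nat.add_sub_add_right, Nat.add_sub_add_right,
      Nat.add_sub_cancel]
    push_cast at h1 ⊢
    linear_combination
      ((-1) ^ r * (r.factorial : ℂ) * (m.choose r : ℂ) * z ^ (m - r) * conj z ^ (n - r) *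
        (ρ : ℂ) ^ (r + 1)) * h1 -
      ((-1) ^ (r + 1) * ((r + 1) * r.factorial : ℂ) * ((n + 1).choose (r + 1) : ℂ) *
        conj z ^ (n - r) * (ρ : ℂ) ^ (r + 1)) * h2
  · simp; ring

variable {Ω H : Type*} [NormedAddCommGroup H] [InnerProductSpace ℂ H] {Z : H → Ω → ℂ}

/-- `∂ J_{m,n} = m J_{m-1,n}` and `∂̄ J_{m,n} = n J_{m,n-1}`. -/
lemma hasSmoothDerivs_complexHermite (h k : H) (m n : ℕ) :
    HasSmoothDerivs Z h (fun ω => complexHermite m n (Z k ω) 1)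
      (fun ω => m * complexHermite (m - 1) n (Z k ω) 1 * inner ℂ h k)
      (fun ω => n * complexHermite m (n - 1) (Z k ω) 1 * inner ℂ k h) := by
  induction m generalizing n with
  | zero =>
    simp only [complexHermite_zero_left]
    induction n with
    | zero => simpa using HasSmoothDerivs.const Z h 1
    | succ n ih =>
      simp only [pow_succ]
      convert ih.mul (HasSmoothDerivs.eval Z h k).conj_comp using 1
      · ext ω; simp
      · ext ω
        rcases n with _ | n
        · simp
        · simp; ring
  | succ m ih =>
    convert ((HasSmoothDerivs.eval Z h k).mul (ih n)).add
      ((ih (n - 1)).const_mul (-(n : ℂ))) using 1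
    · ext ω; rw [complexHermite_succ_left]; push_cast; ring
    · ext ω
      rcases m with _ | m
      · simp; ring
      · simp only [Nat.add_sub_cancel]
        rw [complexHermite_succ_left m n]
        push_cast; ring
    · ext ω
      rw [complexHermite_succ_left]
      push_cast
      rcases n with _ | n
      · simp
      · simp; ring

end Hermite

/-! ### Fourier–Hermite polynomials indexed by multisets -/

section MultisetHermite

section Algebra

variable {Ω H ι : Type*} {Z : H → Ω → ℂ} [DecidableEq ι] {e : ι → H}

/-- The Fourier–Hermite polynomial `∏_k J_{m_k, n_k}(Z(e_k), 1)`, where the multi-indices `m` and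
`n` are the multiplicities of the multisets `M` and `N`. -/
noncomputable def hermiteProd (Z : H → Ω → ℂ) (e : ι → H) (M N : Multiset ι) (ω : Ω) : ℂ :=
  ∏ k ∈ (M + N).toFinset, complexHermite (M.count k) (N.count k) (Z (e k) ω) 1

lemma hermiteProd_eq_prod (M N : Multiset ι) (ω : Ω) {s : Finset ι} (hs : (M + N).toFinset ⊆ s) :
    hermiteProd Z e M N ω =
      ∏ k ∈ s, complexHermite (M.count k) (N.count k) (Z (e k) ω) 1 := by
  refine Finset.prod_subset hs fun k _ hk => ?_
  simp only [Multiset.mem_toFinset, Multiset.mem_add, not_or] at hk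
  simp [Multiset.count_eq_zero_of_notMem hk.1, Multiset.count_eq_zero_of_notMem hk.2]

lemma hermiteProd_eq_mul_prod_erase (M N : Multiset ι) (k : ι) {s : Finset ι}
    (hs : (M + N).toFinset ⊆ s) (hk : k ∈ s) (ω : Ω) :
    hermiteProd Z e M N ω = complexHermite (M.count k) (N.count k) (Z (e k) ω) 1 *
      ∏ l ∈ s.erase k, complexHermite (M.count l) (N.count l) (Z (e l) ω) 1 := by
  rw [hermiteProd_eq_prod M N ω hs]
  exact (Finset.mul_prod_erase s
    (fun k => complexHermite (M.count k) (N.count k) (Z (e k) ω) 1) hk).symm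

lemma hermiteProd_conj (M N : Multiset ι) (ω : Ω) :
    conj (hermiteProd Z e M N ω) = hermiteProd Z e N M ω := by
  simp only [hermiteProd, map_prod, complexHermite_conj, add_comm M N]

@[simp] lemma hermiteProd_zero (ω : Ω) : hermiteProd Z e 0 0 ω = 1 := by
  simp [hermiteProd]

/-- The recursion `z J_{m,n} = J_{m+1,n} + n J_{m,n-1}` in the variable `z = Z(e_k)`: multiplication
by `Z(e_k)` preserves the span of the Fourier–Hermite polynomials. -/
lemma hermiteProd_cons_left (M N : Multiset ι) (k : ι) (ω : Ω) :
    hermiteProd Z e (k ::ₘ M) N ω = Z (e k) ω * hermiteProd Z e M N ω -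
      N.count k * hermiteProd Z e M (N.erase k) ω := by
  have s1 : (M + N).toFinset ⊆ (k ::ₘ M + N).toFinset := by
    intro x; simp; tauto
  have s2 : (M + N.erase k).toFinset ⊆ (k ::ₘ M + N).toFinset := by
    intro x; simp only [Multiset.mem_toFinset, Multiset.mem_add, Multiset.mem_cons]
    rintro (h | h)
    · tauto
    · exact Or.inr (Multiset.mem_of_mem_erase h)
  have hk : k ∈ (k ::ₘ M + N).toFinset := by simp
  rw [hermiteProd_eq_mul_prod_erase (k ::ₘ M) N k subset_rfl hk,
    hermiteProd_eq_mul_prod_erase M N k s1 hk,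
    hermiteProd_eq_mul_prod_erase M (N.erase k) k s2 hk, Multiset.count_cons_self,
    Multiset.count_erase_self, complexHermite_succ_left]
  have r1 : ∀ l ∈ (k ::ₘ M + N).toFinset.erase k, complexHermite ((k ::ₘ M).count l)
      (N.count l) (Z (e l) ω) 1 = complexHermite (M.count l) (N.count l) (Z (e l) ω) 1 := by
    intro l hl
    rw [Multiset.count_cons_of_ne (Finset.ne_of_mem_erase hl)]
  have r2 : ∀ l ∈ (k ::ₘ M + N).toFinset.erase k, complexHermite (M.count l)
      ((N.erase k).count l) (Z (e l) ω) 1 =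
        complexHermite (M.count l) (N.count l) (Z (e l) ω) 1 := by
    intro l hl
    rw [Multiset.count_erase_of_ne (Finset.ne_of_mem_erase hl)]
  rw [Finset.prod_congr rfl r1, Finset.prod_congr rfl r2]
  push_cast
  ring

lemma hermiteProd_cons_right (M N : Multiset ι) (k : ι) (ω : Ω) :
    hermiteProd Z e M (k ::ₘ N) ω = conj (Z (e k) ω) * hermiteProd Z e M N ω -
      M.count k * hermiteProd Z e (M.erase k) N ω := by
  rw [← hermiteProd_conj, hermiteProd_cons_left]
  simp [hermiteProd_conj]

end Algebra

variable {Ω H ι : Type*} {mΩ : MeasurableSpace Ω} [NormedAddCommGroup H] [InnerProductSpace ℂ H]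
  {P : Measure Ω} {Z : H → Ω → ℂ} [DecidableEq ι] {e : ι → H}

/-- Differentiation in the direction `e_k` lowers the multiplicity of `k`: orthonormality kills the
derivatives of the factors in the other variables. -/
lemma hasSmoothDerivs_hermiteProd (he : Orthonormal ℂ e) (M N : Multiset ι) (k : ι) :
    HasSmoothDerivs Z (e k) (hermiteProd Z e M N)
      (fun ω => M.count k * hermiteProd Z e (M.erase k) N ω)
      (fun ω => N.count k * hermiteProd Z e M (N.erase k) ω) := by
  have hk : k ∈ insert k (M + N).toFinset := by simp
  have s0 : (M + N).toFinset ⊆ insert k (M + N).toFinset := by simp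
  have s1 : (M.erase k + N).toFinset ⊆ insert k (M + N).toFinset := by
    intro x; simp only [Multiset.mem_toFinset, Multiset.mem_add, Finset.mem_insert]
    rintro (h | h)
    · exact Or.inr (Or.inl (Multiset.mem_of_mem_erase h))
    · tauto
  have s2 : (M + N.erase k).toFinset ⊆ insert k (M + N).toFinset := by
    intro x; simp only [Multiset.mem_toFinset, Multiset.mem_add, Finset.mem_insert]
    rintro (h | h)
    · tauto
    · exact Or.inr (Or.inr (Multiset.mem_of_mem_erase h))
  -- the factors in the variables `Z(e_l)`, `l ≠ k`, behave as constants
  have hrest : HasSmoothDerivs Z (e k) (fun ω => ∏ l ∈ (insert k (M + N).toFinset).erase k,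
      complexHermite (M.count l) (N.count l) (Z (e l) ω) 1) (fun _ => 0) (fun _ => 0) := by
    refine HasSmoothDerivs.prod_of_eq_zero _ _ fun l hl => ?_
    have hlk := Finset.ne_of_mem_erase hl
    have := hasSmoothDerivs_complexHermite (Z := Z) (e k) (e l) (M.count l) (N.count l)
    simpa [he.2 hlk, he.2 hlk.symm] using this
  have hkk : (inner ℂ (e k) (e k) : ℂ) = 1 := by
    rw [inner_self_eq_norm_sq_to_K, he.1 k]; simp
  have := (hasSmoothDerivs_complexHermite (Z := Z) (e k) (e k) (M.count k) (N.count k)).mul hrest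
  convert this using 1
  · ext ω; exact hermiteProd_eq_mul_prod_erase M N k s0 hk ω
  · ext ω
    rw [hermiteProd_eq_mul_prod_erase (M.erase k) N k s1 hk, Multiset.count_erase_self, hkk]
    have r1 : ∀ l ∈ (insert k (M + N).toFinset).erase k, complexHermite ((M.erase k).count l)
        (N.count l) (Z (e l) ω) 1 = complexHermite (M.count l) (N.count l) (Z (e l) ω) 1 := by
      intro l hl
      rw [Multiset.count_erase_of_ne (Finset.ne_of_mem_erase hl)]
    rw [Finset.prod_congr rfl r1]
    ring
  · ext ω
    rw [hermiteProd_eq_mul_prod_erase M (N.erase k) k s2 hk, Multiset.count_erase_self, hkk]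
    have r1 : ∀ l ∈ (insert k (M + N).toFinset).erase k, complexHermite (M.count l)
        ((N.erase k).count l) (Z (e l) ω) 1 =
          complexHermite (M.count l) (N.count l) (Z (e l) ω) 1 := by
      intro l hl
      rw [Multiset.count_erase_of_ne (Finset.ne_of_mem_erase hl)]
    rw [Finset.prod_congr rfl r1]
    ring

lemma memLp_hermiteProd (hZ : IsComplexIsonormal P Z) (e : ι → H) (M N : Multiset ι)
    {p : ℝ≥0∞} (hp : p ≠ ∞) : MemLp (hermiteProd Z e M N) p P := by
  have := hZ.isGaussianProcess.isProbabilityMeasure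
  have key : ∀ s : Finset ι, ∀ p : ℝ≥0∞, p ≠ ∞ → MemLp (fun ω => ∏ k ∈ s,
      complexHermite (M.count k) (N.count k) (Z (e k) ω) 1) p P := by
    intro s
    induction s using Finset.induction_on with
    | empty => intro p _; simpa using memLp_const (1 : ℂ)
    | insert a s ha ih =>
      simp only [Finset.prod_insert ha]
      exact memLp_mul (memLp_complexHermite hZ (e a) _ _ 1) ih
  exact key _ p hp

variable [IsProbabilityMeasure P]

/-- Integration by parts against a Hermite polynomial: a factor `e_k` is moved to `F` as a
derivative. -/
lemma integral_mul_hermiteProd_cons_right (hZ : IsComplexIsonormal P Z) (he : Orthonormal ℂ e)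
    {F F₁ F₂ : Ω → ℂ} {k : ι} (hF : HasSmoothDerivs Z (e k) F F₁ F₂) (M N : Multiset ι) :
    ∫ ω, F ω * hermiteProd Z e M (k ::ₘ N) ω ∂P = ∫ ω, F₁ ω * hermiteProd Z e M N ω ∂P := by
  have hFG := hF.mul (hasSmoothDerivs_hermiteProd (Z := Z) he M N k)
  have h1 := hFG.integral_mul_conj hZ (he.1 k)
  have tt : (2 : ℝ≥0∞) ≠ ∞ := ENNReal.ofNat_ne_top
  have i1 : Integrable (fun ω => F₁ ω * hermiteProd Z e M N ω) P :=
    memLp_one_iff_integrable.1 (MemLp.mul' (p := 2) (q := 2) (memLp_hermiteProd hZ e M N tt)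
      (hF.memLp_left hZ tt))
  have i2 : Integrable (fun ω => F ω * (M.count k * hermiteProd Z e (M.erase k) N ω)) P :=
    memLp_one_iff_integrable.1 (MemLp.mul' (p := 2) (q := 2)
      ((memLp_hermiteProd hZ e (M.erase k) N tt).const_mul _) (hF.memLp hZ tt))
  have i3 : Integrable (fun ω => F ω * hermiteProd Z e M N ω * conj (Z (e k) ω)) P :=
    memLp_one_iff_integrable.1 (MemLp.mul' (p := 2) (q := 2)
      (hZ.memLp_eval (e k) tt).star (hFG.memLp hZ tt))
  have e1 : ∀ ω, F ω * hermiteProd Z e M (k ::ₘ N) ω = F ω * hermiteProd Z e M N ω *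
      conj (Z (e k) ω) - F ω * (M.count k * hermiteProd Z e (M.erase k) N ω) := fun ω => by
    rw [hermiteProd_cons_right]; ring
  simp_rw [e1]
  rw [integral_sub i3 i2, h1, integral_add i1 i2]
  ring

lemma integral_mul_hermiteProd_cons_left (hZ : IsComplexIsonormal P Z) (he : Orthonormal ℂ e)
    {F F₁ F₂ : Ω → ℂ} {k : ι} (hF : HasSmoothDerivs Z (e k) F F₁ F₂) (M N : Multiset ι) :
    ∫ ω, F ω * hermiteProd Z e (k ::ₘ M) N ω ∂P = ∫ ω, F₂ ω * hermiteProd Z e M N ω ∂P := by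
  have h := integral_mul_hermiteProd_cons_right hZ he hF.conj_comp N M
  have c : ∀ G : Ω → ℂ, ∀ M N : Multiset ι, ∫ ω, G ω * hermiteProd Z e M N ω ∂P =
      conj (∫ ω, conj (G ω) * hermiteProd Z e N M ω ∂P) := fun G M N => by
    rw [← integral_conj]
    simp [hermiteProd_conj]
  rw [c F, h, ← c F₂]

end MultisetHermite

/-! ### Counting permutations that carry one finite sequence to another -/

section Multiplicity

variable {ι : Type*} [DecidableEq ι]

/-- The product `∏_k m_k!` of the factorials of the multiplicities of a multiset. -/
def multFactorial (M : Multiset ι) : ℕ := ∏ k ∈ M.toFinset, (M.count k).factorial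

@[simp] lemma multFactorial_zero : multFactorial (0 : Multiset ι) = 1 := by simp [multFactorial]

lemma multFactorial_eq_count_mul_erase {M : Multiset ι} {k : ι} (hk : k ∈ M) :
    multFactorial M = M.count k * multFactorial (M.erase k) := by
  have hk' : k ∈ M.toFinset := Multiset.mem_toFinset.2 hk
  have h1 : multFactorial (M.erase k) = ∏ l ∈ M.toFinset, ((M.erase k).count l).factorial := by
    refine Finset.prod_subset (fun l hl => ?_) fun l _ hl => ?_
    · exact Multiset.mem_toFinset.2 (Multiset.mem_of_mem_erase (Multiset.mem_toFinset.1 hl))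
    · rw [Multiset.count_eq_zero_of_notMem (fun h => hl (Multiset.mem_toFinset.2 h))]; rfl
  have h2 : ∀ l ∈ M.toFinset.erase k, ((M.erase k).count l).factorial =
      (M.count l).factorial := fun l hl => by
    rw [Multiset.count_erase_of_ne (Finset.ne_of_mem_erase hl)]
  rw [h1, multFactorial, ← Finset.mul_prod_erase _ _ hk', ← Finset.mul_prod_erase _ _ hk',
    Finset.prod_congr rfl h2, Multiset.count_erase_self, ← mul_assoc,
    Nat.mul_factorial_pred (Multiset.count_pos.2 hk).ne']

open scoped Classical in
/-- The number of permutations carrying one finite sequence to another. -/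
lemma card_perm_comp_eq {p : ℕ} (f g : Fin p → ι) :
    (Finset.univ.filter fun π : Equiv.Perm (Fin p) => f ∘ π = g).card =
      if Finset.univ.val.map f = Finset.univ.val.map g then
        multFactorial (Finset.univ.val.map f) else 0 := by
  split_ifs with h
  · obtain ⟨π₀, hπ₀⟩ : ∃ π₀ : Equiv.Perm (Fin p), f ∘ π₀ = g := by
      have hc : ∀ c, Fintype.card {a // g a = c} = Fintype.card {a // f a = c} := fun c => by
        have := congrArg (Multiset.count c) h
        rw [Multiset.count_map, Multiset.count_map] at this
        rw [Fintype.card_subtype, Fintype.card_subtype]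
        simp only [eq_comm (b := c)]
        exact this.symm
      refine ⟨Equiv.ofFiberEquiv fun c => Fintype.equivOfCardEq (hc c), ?_⟩
      ext a
      exact Equiv.ofFiberEquiv_map _ a
    have h1 : (Finset.univ.filter fun π : Equiv.Perm (Fin p) => f ∘ π = g).card =
        (Finset.univ.filter fun π : Equiv.Perm (Fin p) => f ∘ π = f).card := by
      refine Finset.card_equiv (Equiv.mulRight π₀⁻¹) fun π => ?_
      simp only [Finset.mem_filter, Finset.mem_univ, true_and, Equiv.coe_mulRight]
      rw [← hπ₀]
      constructor
      · intro h
        ext x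
        have := congrFun h (π₀⁻¹ x)
        simpa using this
      · intro h
        ext x
        have := congrFun h (π₀ x)
        simpa using this
    have h2 := DomMulAct.stabilizer_card' f
    rw [h1, ← Fintype.card_subtype, h2, multFactorial]
    have h3 : (Finset.univ.val.map f).toFinset = Finset.univ.image f := rfl
    rw [h3]
    refine Finset.prod_congr rfl fun i _ => ?_
    rw [Multiset.count_map, Fintype.card_subtype]
    congr 1
    simp only [eq_comm]
    rfl
  · rw [Finset.card_eq_zero, Finset.filter_eq_empty_iff]
    rintro π - rfl
    apply h
    rw [← Multiset.map_map]
    congr 1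
    exact (congrArg Finset.val (Finset.map_univ_equiv π)).symm

end Multiplicity

/-! ### Orthogonality of the Fourier–Hermite polynomials -/

section Orthogonality

variable {Ω H ι : Type*} {mΩ : MeasurableSpace Ω} [NormedAddCommGroup H] [InnerProductSpace ℂ H]
  {P : Measure Ω} {Z : H → Ω → ℂ} [DecidableEq ι] {e : ι → H} [IsProbabilityMeasure P]

/-- A Fourier–Hermite polynomial of positive degree is centred: integrate by parts against `1`. -/
lemma integral_hermiteProd (hZ : IsComplexIsonormal P Z) (he : Orthonormal ℂ e)
    (M N : Multiset ι) :
    ∫ ω, hermiteProd Z e M N ω ∂P = if M = 0 ∧ N = 0 then 1 else 0 := by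
  rcases M.empty_or_exists_mem with rfl | ⟨k, hk⟩
  · rcases N.empty_or_exists_mem with rfl | ⟨k, hk⟩
    · simp
    · obtain ⟨N, rfl⟩ := Multiset.exists_cons_of_mem hk
      simpa using integral_mul_hermiteProd_cons_right hZ he (HasSmoothDerivs.const Z (e k) 1) 0 N
  · obtain ⟨M, rfl⟩ := Multiset.exists_cons_of_mem hk
    simpa using integral_mul_hermiteProd_cons_left hZ he (HasSmoothDerivs.const Z (e k) 1) M N

lemma count_mul_ite_erase (M M' : Multiset ι) (k : ι) (Q : Prop) [Decidable Q] (c : ℂ) :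
    (M.count k : ℂ) * (if M.erase k = M' ∧ Q then (multFactorial (M.erase k) : ℂ) * c else 0) =
      if M = k ::ₘ M' ∧ Q then (multFactorial M : ℂ) * c else 0 := by
  by_cases hk : k ∈ M
  · have h : M = k ::ₘ M' ↔ M.erase k = M' := by
      constructor
      · rintro rfl; simp
      · rintro rfl; exact (Multiset.cons_erase hk).symm
    rw [multFactorial_eq_count_mul_erase hk]
    simp only [h]
    split_ifs <;> push_cast <;> ring
  · have h : M ≠ k ::ₘ M' := by rintro rfl; simp at hk
    simp [Multiset.count_eq_zero_of_notMem hk, h]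

/-- The Fourier–Hermite polynomials are orthogonal, of squared norm `𝐦! 𝐧!`. -/
theorem integral_hermiteProd_mul (hZ : IsComplexIsonormal P Z) (he : Orthonormal ℂ e)
    (M N M' N' : Multiset ι) :
    ∫ ω, hermiteProd Z e M N ω * hermiteProd Z e N' M' ω ∂P =
      if M = M' ∧ N = N' then (multFactorial M : ℂ) * multFactorial N else 0 := by
  induction M' using Multiset.induction_on generalizing M with
  | empty =>
    induction N' using Multiset.induction_on generalizing N with
    | empty =>
      simp only [hermiteProd_zero, mul_one]
      rw [integral_hermiteProd hZ he]
      split_ifs with h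
      · simp [h.1, h.2]
      · rfl
    | cons k N' ih =>
      rw [integral_mul_hermiteProd_cons_left hZ he (hasSmoothDerivs_hermiteProd he M N k)]
      simp_rw [mul_assoc]
      rw [integral_const_mul, ih]
      have := count_mul_ite_erase N N' k (M = 0) (multFactorial M)
      simp only [and_comm (a := M = 0), mul_comm (multFactorial M : ℂ)]
      convert this
  | cons k M' ih =>
    rw [integral_mul_hermiteProd_cons_right hZ he (hasSmoothDerivs_hermiteProd he M N k)]
    simp_rw [mul_assoc]
    rw [integral_const_mul, ih]
    exact count_mul_ite_erase M M' k (N = N') (multFactorial N)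

end Orthogonality

/-! ### Fourier–Hermite polynomials indexed by finite sequences -/

section FourierHermite

variable {Ω H ι : Type*} {mΩ : MeasurableSpace Ω} [NormedAddCommGroup H] [InnerProductSpace ℂ H]
  {P : Measure Ω} {Z : H → Ω → ℂ} {e : ι → H} [IsProbabilityMeasure P]

set_option linter.unusedSectionVars false in
open scoped Classical in
lemma fourierHermite_eq_hermiteProd (Z : H → Ω → ℂ) (e : ι → H) {p q : ℕ}
    (j : Fin p ⊕ Fin q → ι) :
    fourierHermite Z e j = hermiteProd Z e (Finset.univ.val.map (j ∘ Sum.inl))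
      (Finset.univ.val.map (j ∘ Sum.inr)) := by
  ext ω
  rw [hermiteProd_eq_prod (s := Finset.univ.image j), fourierHermite]
  · refine Finset.prod_congr rfl fun k _ => ?_
    rw [Multiset.count_map, Multiset.count_map]
    simp only [eq_comm (a := k)]
    rfl
  · intro x
    simp only [Multiset.mem_toFinset, Multiset.mem_add, Multiset.mem_map, Finset.mem_image]
    rintro (⟨a, -, rfl⟩ | ⟨a, -, rfl⟩)
    · exact ⟨_, Finset.mem_univ _, rfl⟩
    · exact ⟨_, Finset.mem_univ _, rfl⟩

/-- The Fourier–Hermite polynomial of a multi-index, as an element of `L²`. -/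
noncomputable def hermiteL2 (hZ : IsComplexIsonormal P Z) (e : ι → H) {p q : ℕ}
    (j : Fin p ⊕ Fin q → ι) : Lp ℂ 2 P :=
  (memLp_fourierHermite hZ e j).toLp _

lemma inner_hermiteL2_eq_integral (hZ : IsComplexIsonormal P Z) (e : ι → H) {p q : ℕ}
    (j : Fin p ⊕ Fin q → ι) (F : Lp ℂ 2 P) :
    inner ℂ (hermiteL2 hZ e j) F = ∫ ω, F ω * conj (fourierHermite Z e j ω) ∂P := by
  rw [L2.inner_def]
  refine integral_congr_ae ?_
  filter_upwards [(memLp_fourierHermite hZ e j).coeFn_toLp] with ω h1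
  rw [hermiteL2, h1, RCLike.inner_apply]

open scoped Classical in
/-- The inner product of two Fourier–Hermite polynomials of the same degree, as a sum over the
permutations that carry one multi-index to the other. -/
theorem inner_hermiteL2 (hZ : IsComplexIsonormal P Z) (he : Orthonormal ℂ e) {p q : ℕ}
    (j j' : Fin p ⊕ Fin q → ι) :
    inner ℂ (hermiteL2 hZ e j) (hermiteL2 hZ e j') =
      ∑ π : Equiv.Perm (Fin p) × Equiv.Perm (Fin q),
        if j ∘ Sum.map π.1 π.2 = j' then (1 : ℂ) else 0 := by
  have h1 : ∫ ω, (hermiteL2 hZ e j' : Ω → ℂ) ω * conj (fourierHermite Z e j ω) ∂P =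
      ∫ ω, fourierHermite Z e j' ω * conj (fourierHermite Z e j ω) ∂P := by
    refine integral_congr_ae ?_
    filter_upwards [(memLp_fourierHermite hZ e j').coeFn_toLp] with ω h1
    rw [hermiteL2, h1]
  rw [inner_hermiteL2_eq_integral, h1]
  simp only [fourierHermite_eq_hermiteProd, hermiteProd_conj]
  rw [integral_hermiteProd_mul hZ he]
  have h2 : ∀ π : Equiv.Perm (Fin p) × Equiv.Perm (Fin q), (j ∘ Sum.map π.1 π.2 = j') ↔
      ((j ∘ Sum.inl) ∘ π.1 = j' ∘ Sum.inl ∧ (j ∘ Sum.inr) ∘ π.2 = j' ∘ Sum.inr) := by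
    intro π
    constructor
    · rintro rfl; exact ⟨rfl, rfl⟩
    · rintro ⟨h1, h2⟩
      ext x
      rcases x with x | x
      · exact congrFun h1 x
      · exact congrFun h2 x
  rw [Finset.sum_boole]
  simp only [h2]
  have h3 : (Finset.univ.filter fun π : Equiv.Perm (Fin p) × Equiv.Perm (Fin q) =>
      (j ∘ Sum.inl) ∘ π.1 = j' ∘ Sum.inl ∧ (j ∘ Sum.inr) ∘ π.2 = j' ∘ Sum.inr) =
      (Finset.univ.filter fun π : Equiv.Perm (Fin p) => (j ∘ Sum.inl) ∘ π = j' ∘ Sum.inl) ×ˢ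
      (Finset.univ.filter fun π : Equiv.Perm (Fin q) => (j ∘ Sum.inr) ∘ π = j' ∘ Sum.inr) := by
    ext π; simp
  rw [h3, Finset.card_product, card_perm_comp_eq, card_perm_comp_eq]
  simp only [eq_comm (b := Finset.univ.val.map (j ∘ Sum.inl)),
    eq_comm (b := Finset.univ.val.map (j ∘ Sum.inr))]
  split_ifs with a b c d
  · rw [← a.1, ← a.2]; push_cast; rfl
  all_goals first | (exfalso; tauto) | simp

lemma inner_hermiteL2_of_ne (hZ : IsComplexIsonormal P Z) (he : Orthonormal ℂ e) {p q p' q' : ℕ}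
    (j : Fin p ⊕ Fin q → ι) (j' : Fin p' ⊕ Fin q' → ι) (h : (p, q) ≠ (p', q')) :
    inner ℂ (hermiteL2 hZ e j) (hermiteL2 hZ e j') = 0 := by
  classical
  have h1 : ∫ ω, (hermiteL2 hZ e j' : Ω → ℂ) ω * conj (fourierHermite Z e j ω) ∂P =
      ∫ ω, fourierHermite Z e j' ω * conj (fourierHermite Z e j ω) ∂P := by
    refine integral_congr_ae ?_
    filter_upwards [(memLp_fourierHermite hZ e j').coeFn_toLp] with ω h1
    rw [hermiteL2, h1]
  rw [inner_hermiteL2_eq_integral, h1]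
  simp only [fourierHermite_eq_hermiteProd, hermiteProd_conj]
  rw [integral_hermiteProd_mul hZ he, if_neg]
  rintro ⟨h1, h2⟩
  apply h
  have h1 := congrArg Multiset.card h1
  have h2 := congrArg Multiset.card h2
  simp at h1 h2
  rw [h1, h2]

end FourierHermite

/-! ### Iterated Wirtinger derivatives in coordinates -/

section IteratedDerivs

variable {ι H : Type*} [NormedAddCommGroup H] [InnerProductSpace ℂ H]

lemma wirtinger_eq_dirW {k : ℕ} (a : Fin k) : wirtinger a = dirW (Pi.single a (1 : ℂ)) := by
  ext f z; rw [wirtinger, dirW, I_smul_single]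

lemma wirtingerBar_eq_dirWbar {k : ℕ} (a : Fin k) :
    wirtingerBar a = dirWbar (Pi.single a (1 : ℂ)) := by
  ext f z; rw [wirtingerBar, dirWbar, I_smul_single]

section Foldr

variable {α E : Type*} [NormedAddCommGroup E] [NormedSpace ℂ E]

lemma hasTemperateGrowth_foldr_dirW (c : α → E) (l : List α) {f : E → ℂ}
    (hf : f.HasTemperateGrowth) : (l.foldr (fun a => dirW (c a)) f).HasTemperateGrowth := by
  induction l with
  | nil => exact hf
  | cons a l ih => exact hasTemperateGrowth_dirW ih _

lemma hasTemperateGrowth_foldr_dirWbar (c : α → E) (l : List α) {f : E → ℂ}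
    (hf : f.HasTemperateGrowth) : (l.foldr (fun a => dirWbar (c a)) f).HasTemperateGrowth := by
  induction l with
  | nil => exact hf
  | cons a l ih => exact hasTemperateGrowth_dirWbar ih _

lemma fderiv_sum_const_mul {β : Type*} (s : Finset β) (r : β → ℂ) {g : β → E → ℂ}
    (hg : ∀ b, (g b).HasTemperateGrowth) (z c : E) :
    fderiv ℝ (fun z => ∑ b ∈ s, r b * g b z) z c = ∑ b ∈ s, r b * fderiv ℝ (g b) z c := by
  have hd : ∀ b, DifferentiableAt ℝ (g b) z := fun b => (hg b).1.differentiable (by simp) z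
  rw [fderiv_fun_sum fun b _ => (hd b).const_mul (r b), sum_apply]
  refine Finset.sum_congr rfl fun b _ => ?_
  rw [fderiv_const_mul (hd b)]
  rfl

lemma dirW_sum_const_mul {β : Type*} (s : Finset β) (r : β → ℂ) {g : β → E → ℂ}
    (hg : ∀ b, (g b).HasTemperateGrowth) (c : E) :
    dirW c (fun z => ∑ b ∈ s, r b * g b z) = fun z => ∑ b ∈ s, r b * dirW c (g b) z := by
  ext z
  simp only [dirW, fderiv_sum_const_mul s r hg]
  rw [Finset.mul_sum, ← Finset.sum_sub_distrib, Finset.mul_sum]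
  exact Finset.sum_congr rfl fun b _ => by ring

lemma dirWbar_sum_const_mul {β : Type*} (s : Finset β) (r : β → ℂ) {g : β → E → ℂ}
    (hg : ∀ b, (g b).HasTemperateGrowth) (c : E) :
    dirWbar c (fun z => ∑ b ∈ s, r b * g b z) = fun z => ∑ b ∈ s, r b * dirWbar c (g b) z := by
  ext z
  simp only [dirWbar, fderiv_sum_const_mul s r hg]
  rw [Finset.mul_sum, ← Finset.sum_add_distrib, Finset.mul_sum]
  exact Finset.sum_congr rfl fun b _ => by ring

lemma foldr_dirW_sum_const_mul {β : Type*} (s : Finset β) (r : β → ℂ) {g : β → E → ℂ}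
    (hg : ∀ b, (g b).HasTemperateGrowth) (c : α → E) (l : List α) :
    l.foldr (fun a => dirW (c a)) (fun z => ∑ b ∈ s, r b * g b z) =
      fun z => ∑ b ∈ s, r b * l.foldr (fun a => dirW (c a)) (g b) z := by
  induction l with
  | nil => rfl
  | cons a l ih =>
    simp only [List.foldr_cons]
    rw [ih, dirW_sum_const_mul s r fun b => hasTemperateGrowth_foldr_dirW c l (hg b)]

end Foldr

lemma sum_pi_fin_succ {k q : ℕ} {A : Type*} [AddCommMonoid A] (F : (Fin (q + 1) → Fin k) → A) :
    ∑ b, F b = ∑ b₀ : Fin k, ∑ b : Fin q → Fin k, F (Fin.cons b₀ b) := by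
  rw [← (Fin.consEquiv fun _ => Fin k).sum_comp, Fintype.sum_prod_type]
  rfl

/-- Iterated directional Wirtinger derivatives, expanded in the coordinate directions. -/
lemma foldr_dirW_eq_sum {k p : ℕ} (c : Fin p → Fin k → ℂ) {f : (Fin k → ℂ) → ℂ}
    (hf : f.HasTemperateGrowth) :
    (List.ofFn c).foldr dirW f = fun z => ∑ a : Fin p → Fin k,
      (∏ s, c s (a s)) * (List.ofFn a).foldr wirtinger f z := by
  have e : (wirtinger : Fin k → _) = fun a => dirW (Pi.single a (1 : ℂ)) := by
    ext1 a; exact wirtinger_eq_dirW a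
  induction p with
  | zero => ext z; simp
  | succ p ih =>
    rw [List.ofFn_succ, List.foldr_cons, ih]
    ext z
    rw [dirW_eq_sum_wirtinger, sum_pi_fin_succ]
    refine Finset.sum_congr rfl fun a₀ _ => ?_
    rw [wirtinger_eq_dirW, dirW_sum_const_mul _ _ fun a => by
      rw [e]; exact hasTemperateGrowth_foldr_dirW _ _ hf, Finset.mul_sum]
    refine Finset.sum_congr rfl fun a _ => ?_
    rw [Fin.prod_univ_succ, List.ofFn_succ, List.foldr_cons, wirtinger_eq_dirW]
    simp only [Fin.cons_zero, Fin.cons_succ]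
    ring

lemma foldr_dirWbar_eq_sum {k q : ℕ} (c : Fin q → Fin k → ℂ) {f : (Fin k → ℂ) → ℂ}
    (hf : f.HasTemperateGrowth) :
    (List.ofFn c).foldr dirWbar f = fun z => ∑ b : Fin q → Fin k,
      (∏ t, conj (c t (b t))) * (List.ofFn b).foldr wirtingerBar f z := by
  have e : (wirtingerBar : Fin k → _) = fun a => dirWbar (Pi.single a (1 : ℂ)) := by
    ext1 a; exact wirtingerBar_eq_dirWbar a
  induction q with
  | zero => ext z; simp
  | succ q ih =>
    rw [List.ofFn_succ, List.foldr_cons, ih]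
    ext z
    rw [dirWbar_eq_sum_wirtingerBar, sum_pi_fin_succ]
    refine Finset.sum_congr rfl fun b₀ _ => ?_
    rw [wirtingerBar_eq_dirWbar, dirWbar_sum_const_mul _ _ fun a => by
      rw [e]; exact hasTemperateGrowth_foldr_dirWbar _ _ hf, Finset.mul_sum]
    refine Finset.sum_congr rfl fun b _ => ?_
    rw [Fin.prod_univ_succ, List.ofFn_succ, List.foldr_cons, wirtingerBar_eq_dirWbar]
    simp only [Fin.cons_zero, Fin.cons_succ]
    ring

/-- The contraction of the array of mixed partial derivatives with vectors `c_s` and `d_t` is an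
iterated directional derivative. -/
lemma sum_mixedWirtinger_eq_foldr {k p q : ℕ} (c : Fin p → Fin k → ℂ) (d : Fin q → Fin k → ℂ)
    {f : (Fin k → ℂ) → ℂ} (hf : f.HasTemperateGrowth) (z : Fin k → ℂ) :
    ∑ a : Fin p → Fin k, ∑ b : Fin q → Fin k,
        mixedWirtinger a b f z * ((∏ s, c s (a s)) * ∏ t, conj (d t (b t))) =
      (List.ofFn c).foldr dirW ((List.ofFn d).foldr dirWbar f) z := by
  have e : (wirtinger : Fin k → _) = fun a => dirW (Pi.single a (1 : ℂ)) := by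
    ext1 a; exact wirtinger_eq_dirW a
  have e' : (wirtingerBar : Fin k → _) = fun a => dirWbar (Pi.single a (1 : ℂ)) := by
    ext1 a; exact wirtingerBar_eq_dirWbar a
  have hb : ((List.ofFn d).foldr dirWbar f).HasTemperateGrowth :=
    hasTemperateGrowth_foldr_dirWbar id (List.ofFn d) hf
  rw [foldr_dirW_eq_sum c hb]
  refine Finset.sum_congr rfl fun a _ => ?_
  rw [foldr_dirWbar_eq_sum d hf, e, foldr_dirW_sum_const_mul _ _ fun b => by
      rw [e']; exact hasTemperateGrowth_foldr_dirWbar _ _ hf, Finset.mul_sum]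
  refine Finset.sum_congr rfl fun b _ => ?_
  rw [mixedWirtinger, e]
  ring

end IteratedDerivs

/-! ### The formula for smooth random variables -/

section Stroock

/-- A conjugate-linear isometry reverses inner products, by polarization. -/
lemma inner_map_conjugation {H : Type*} [NormedAddCommGroup H] [InnerProductSpace ℂ H]
    (C : H ≃ₗᵢ⋆[ℂ] H) (x y : H) : inner ℂ (C x) (C y) = inner ℂ y x := by
  rw [← inner_conj_symm y x, inner_eq_sum_norm_sq_div_four, inner_eq_sum_norm_sq_div_four x y]
  have h1 : Complex.I • C y = C (-(Complex.I • y)) := by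
    rw [map_neg, C.map_smulₛₗ]; simp
  simp only [RCLike.I_to_complex]
  rw [h1, ← map_add, ← map_sub, ← map_add, ← map_sub]
  simp only [LinearIsometryEquiv.norm_map]
  simp [map_ofNat, sub_neg_eq_add, ← sub_eq_add_neg]
  ring

variable {Ω H ι : Type*} {mΩ : MeasurableSpace Ω} [NormedAddCommGroup H] [InnerProductSpace ℂ H]
  {P : Measure Ω} {Z : H → Ω → ℂ} {e : ι → H}

/-- The tensor `e_{j_1} ⊗ ⋯ ⊗ e_{j_p} ⊗ ē_{j_{p+1}} ⊗ ⋯ ⊗ ē_{j_{p+q}}`. -/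
noncomputable def basisTensor (C : H ≃ₗᵢ⋆[ℂ] H) (e : ι → H) {p q : ℕ} (j : Fin p ⊕ Fin q → ι) :
    HilbertTensor (Fin p ⊕ Fin q) H :=
  tprod (Sum.elim (fun a => e (j (Sum.inl a))) (fun b => C (e (j (Sum.inr b)))))

/-- The coefficient of `D^p D̄^q F` at a basis tensor is an iterated directional derivative in the
directions `e_{j_1}, …, e_{j_{p+q}}`. -/
lemma inner_basisTensor_smoothDeriv (C : H ≃ₗᵢ⋆[ℂ] H) {k p q : ℕ} {f : (Fin k → ℂ) → ℂ}
    (hf : f.HasTemperateGrowth) (φ : Fin k → H) (j : Fin p ⊕ Fin q → ι) (ω : Ω) :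
    inner ℂ (basisTensor C e j) (smoothDeriv Z C f φ p q ω) =
      (List.ofFn fun s a => (inner ℂ (e (j (Sum.inl s))) (φ a) : ℂ)).foldr dirW
        ((List.ofFn fun t b => (inner ℂ (e (j (Sum.inr t))) (φ b) : ℂ)).foldr dirWbar f)
        (fun i => Z (φ i) ω) := by
  rw [← sum_mixedWirtinger_eq_foldr _ _ hf, smoothDeriv, inner_sum]
  refine Finset.sum_congr rfl fun a _ => ?_
  rw [inner_sum]
  refine Finset.sum_congr rfl fun b _ => ?_
  rw [inner_smul_right, basisTensor, inner_tprod, Fintype.prod_sum_type]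
  simp [inner_map_conjugation]

variable [IsProbabilityMeasure P]

/-- Repeated integration by parts: each derivative becomes an index of the Fourier–Hermite
polynomial. -/
lemma integral_foldr_dirW_mul [DecidableEq ι] (hZ : IsComplexIsonormal P Z)
    (he : Orthonormal ℂ e) {k : ℕ} (φ : Fin k → H) {f : (Fin k → ℂ) → ℂ}
    (hf : f.HasTemperateGrowth) (l : List ι) (M N : Multiset ι) :
    ∫ ω, l.foldr (fun i => dirW fun a => (inner ℂ (e i) (φ a) : ℂ)) f (fun a => Z (φ a) ω) *
        hermiteProd Z e M N ω ∂P =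
      ∫ ω, f (fun a => Z (φ a) ω) * hermiteProd Z e M (l + N) ω ∂P := by
  induction l generalizing N with
  | nil => simp
  | cons i l ih =>
    have h := integral_mul_hermiteProd_cons_right hZ he (k := i)
      (F := fun ω => l.foldr (fun i => dirW fun a => (inner ℂ (e i) (φ a) : ℂ)) f
        (fun a => Z (φ a) ω))
      ⟨Fin k, inferInstance, φ, _, hasTemperateGrowth_foldr_dirW _ l hf, rfl, rfl, rfl⟩ M N
    simp only [List.foldr_cons]
    rw [← h, ih, ← Multiset.cons_coe, Multiset.add_cons, Multiset.cons_add]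

lemma integral_foldr_dirWbar_mul [DecidableEq ι] (hZ : IsComplexIsonormal P Z)
    (he : Orthonormal ℂ e) {k : ℕ} (φ : Fin k → H) {f : (Fin k → ℂ) → ℂ}
    (hf : f.HasTemperateGrowth) (l : List ι) (M N : Multiset ι) :
    ∫ ω, l.foldr (fun i => dirWbar fun a => (inner ℂ (e i) (φ a) : ℂ)) f (fun a => Z (φ a) ω) *
        hermiteProd Z e M N ω ∂P =
      ∫ ω, f (fun a => Z (φ a) ω) * hermiteProd Z e (l + M) N ω ∂P := by
  induction l generalizing M with
  | nil => simp
  | cons i l ih =>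
    have h := integral_mul_hermiteProd_cons_left hZ he (k := i)
      (F := fun ω => l.foldr (fun i => dirWbar fun a => (inner ℂ (e i) (φ a) : ℂ)) f
        (fun a => Z (φ a) ω))
      ⟨Fin k, inferInstance, φ, _, hasTemperateGrowth_foldr_dirWbar _ l hf, rfl, rfl, rfl⟩ M N
    simp only [List.foldr_cons]
    rw [← h, ih, ← Multiset.cons_coe, Multiset.add_cons, Multiset.cons_add]

lemma integrable_coeFn_Lp_two {E : Type*} [NormedAddCommGroup E] (G : Lp E 2 P) :
    Integrable G P :=
  (Lp.memLp G).integrable (by norm_num)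

/-- Stroock's formula, tested on basis tensors, for smooth random variables. -/
theorem inner_hermiteL2_of_isSmoothWithDerivs (hZ : IsComplexIsonormal P Z)
    (he : Orthonormal ℂ e) (C : H ≃ₗᵢ⋆[ℂ] H) {F : Lp ℂ 2 P}
    {G : ∀ p q : ℕ, Lp (HilbertTensor (Fin p ⊕ Fin q) H) 2 P}
    (hF : IsSmoothWithDerivs P Z C F G) {p q : ℕ} (j : Fin p ⊕ Fin q → ι) :
    inner ℂ (hermiteL2 hZ e j) F = inner ℂ (basisTensor C e j) (∫ ω, G p q ω ∂P) := by
  classical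
  obtain ⟨k, f, φ, hf, hF, hG⟩ := hF
  rw [← integral_inner (integrable_coeFn_Lp_two _), inner_hermiteL2_eq_integral]
  have h1 : ∫ ω, inner ℂ (basisTensor C e j) (G p q ω) ∂P =
      ∫ ω, inner ℂ (basisTensor C e j) (smoothDeriv Z C f φ p q ω) ∂P := by
    refine integral_congr_ae ?_
    filter_upwards [hG p q] with ω h
    rw [h]
  have h2 : ∫ ω, F ω * conj (fourierHermite Z e j ω) ∂P =
      ∫ ω, f (fun i => Z (φ i) ω) * conj (fourierHermite Z e j ω) ∂P := by
    refine integral_congr_ae ?_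
    filter_upwards [hF] with ω h
    rw [h]
  rw [h1, h2]
  simp only [inner_basisTensor_smoothDeriv C hf, fourierHermite_eq_hermiteProd, hermiteProd_conj]
  have e1 := integral_foldr_dirW_mul hZ he φ
    (hasTemperateGrowth_foldr_dirWbar (fun i a => (inner ℂ (e i) (φ a) : ℂ))
      (List.ofFn (j ∘ Sum.inr)) hf) (List.ofFn (j ∘ Sum.inl)) 0 0
  have e2 := integral_foldr_dirWbar_mul hZ he φ hf (List.ofFn (j ∘ Sum.inr)) 0
    (List.ofFn (j ∘ Sum.inl) + 0)
  have e3 : ∀ {r : ℕ} (u : Fin r → ι), ((List.ofFn u : List ι) : Multiset ι) =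
      Finset.univ.val.map u := fun u => by
    rw [Fin.univ_val_map]
  rw [e2] at e1
  simp only [add_zero, e3, hermiteProd_zero, mul_one] at e1
  rw [← e1]
  have e4 : (List.ofFn fun s a => (inner ℂ (e (j (Sum.inl s))) (φ a) : ℂ)) =
      (List.ofFn (j ∘ Sum.inl)).map fun i a => (inner ℂ (e i) (φ a) : ℂ) := by
    rw [List.map_ofFn]; rfl
  have e5 : (List.ofFn fun s a => (inner ℂ (e (j (Sum.inr s))) (φ a) : ℂ)) =
      (List.ofFn (j ∘ Sum.inr)).map fun i a => (inner ℂ (e i) (φ a) : ℂ) := by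
    rw [List.map_ofFn]; rfl
  simp only [e4, e5, List.foldr_map]

end Stroock

/-! ### From Hermite polynomials to characters -/

section Characters

variable {Ω H ι : Type*} {mΩ : MeasurableSpace Ω} [NormedAddCommGroup H] [InnerProductSpace ℂ H]
  {P : Measure Ω} {Z : H → Ω → ℂ}

section Polynomials

variable [DecidableEq ι]

/-- The space of polynomials in the variables `Z(e_k)` and `conj Z(e_k)`, as the span of the
Fourier–Hermite polynomials. -/
def hermiteSpan (Z : H → Ω → ℂ) (e : ι → H) : Submodule ℂ (Ω → ℂ) :=
  Submodule.span ℂ (Set.range fun M : Multiset ι × Multiset ι => hermiteProd Z e M.1 M.2)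

set_option linter.unusedSectionVars false in
lemma mul_mem_hermiteSpan (Z : H → Ω → ℂ) (e : ι → H) (k : ι) {G : Ω → ℂ}
    (hG : G ∈ hermiteSpan Z e) : (fun ω => Z (e k) ω * G ω) ∈ hermiteSpan Z e := by
  induction hG using Submodule.span_induction with
  | mem G hG =>
    obtain ⟨⟨M, N⟩, rfl⟩ := hG
    have : (fun ω => Z (e k) ω * hermiteProd Z e M N ω) = hermiteProd Z e (k ::ₘ M) N +
        (N.count k : ℂ) • hermiteProd Z e M (N.erase k) := by
      ext ω
      simp [hermiteProd_cons_left]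
    simp only
    rw [this]
    exact add_mem (Submodule.subset_span ⟨(_, _), rfl⟩)
      (Submodule.smul_mem _ _ (Submodule.subset_span ⟨(_, _), rfl⟩))
  | zero => convert (hermiteSpan Z e).zero_mem using 1; ext ω; simp
  | add G G' _ _ h1 h2 => simpa [mul_add] using! add_mem h1 h2
  | smul c G _ h1 =>
    have : (fun ω => Z (e k) ω * (c • G) ω) = c • fun ω => Z (e k) ω * G ω := by
      ext ω; simp; ring
    rw [this]
    exact Submodule.smul_mem _ _ h1

set_option linter.unusedSectionVars false in
lemma conj_mem_hermiteSpan (Z : H → Ω → ℂ) (e : ι → H) {G : Ω → ℂ}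
    (hG : G ∈ hermiteSpan Z e) : (fun ω => conj (G ω)) ∈ hermiteSpan Z e := by
  induction hG using Submodule.span_induction with
  | mem G hG =>
    obtain ⟨⟨M, N⟩, rfl⟩ := hG
    simp only [hermiteProd_conj]
    exact Submodule.subset_span ⟨(_, _), rfl⟩
  | zero => convert (hermiteSpan Z e).zero_mem using 1; ext ω; simp
  | add G G' _ _ h1 h2 => simpa using! add_mem h1 h2
  | smul c G _ h1 =>
    have : (fun ω => conj ((c • G) ω)) = conj c • fun ω => conj (G ω) := by
      ext ω; simp
    rw [this]
    exact Submodule.smul_mem _ _ h1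

set_option linter.unusedSectionVars false in
lemma one_mem_hermiteSpan (Z : H → Ω → ℂ) (e : ι → H) : (fun _ => 1) ∈ hermiteSpan Z e := by
  refine Submodule.subset_span ⟨(0, 0), ?_⟩
  ext ω; simp

/-- For `h` in the span of the `e_k`, the variable `Re Z(h)` has a version all of whose powers
are polynomials. -/
lemma exists_pow_mem_hermiteSpan (hZ : IsComplexIsonormal P Z) (e : ι → H) {h : H}
    (hh : h ∈ Submodule.span ℂ (Set.range e)) :
    ∃ Y : Ω → ℂ, Z h =ᵐ[P] Y ∧ ∀ n : ℕ, (fun ω => ((Y ω).re : ℂ) ^ n) ∈ hermiteSpan Z e := by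
  obtain ⟨Y, hY, hm⟩ : ∃ Y : Ω → ℂ, Z h =ᵐ[P] Y ∧
      ∀ G ∈ hermiteSpan Z e, (fun ω => Y ω * G ω) ∈ hermiteSpan Z e := by
    induction hh using Submodule.span_induction with
    | mem x hx =>
      obtain ⟨k, rfl⟩ := hx
      exact ⟨Z (e k), ae_eq_rfl, fun G hG => mul_mem_hermiteSpan Z e k hG⟩
    | zero =>
      refine ⟨0, ?_, fun G hG => by
        convert (hermiteSpan Z e).zero_mem using 1; ext ω; simp⟩
      filter_upwards [hZ.eval_smul_ae 0 0] with ω h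
      simpa using h
    | add x y _ _ hx hy =>
      obtain ⟨X, hX, hX'⟩ := hx
      obtain ⟨Y, hY, hY'⟩ := hy
      refine ⟨fun ω => X ω + Y ω, ?_, fun G hG => ?_⟩
      · filter_upwards [hZ.eval_add_ae x y, hX, hY] with ω h1 h2 h3
        rw [h1, h2, h3]
      · simpa [add_mul] using! add_mem (hX' G hG) (hY' G hG)
    | smul c x _ hx =>
      obtain ⟨X, hX, hX'⟩ := hx
      refine ⟨fun ω => c * X ω, ?_, fun G hG => ?_⟩
      · filter_upwards [hZ.eval_smul_ae c x, hX] with ω h1 h2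
        rw [h1, h2]
      · simpa [mul_assoc] using! Submodule.smul_mem _ c (hX' G hG)
  refine ⟨Y, hY, fun n => ?_⟩
  induction n with
  | zero => simpa using one_mem_hermiteSpan Z e
  | succ n ih =>
    have h1 := hm _ ih
    have h2 := conj_mem_hermiteSpan Z e (hm _ (conj_mem_hermiteSpan Z e ih))
    have : (fun ω => ((Y ω).re : ℂ) ^ (n + 1)) = (1 / 2 : ℂ) •
        ((fun ω => Y ω * ((Y ω).re : ℂ) ^ n) +
          fun ω => conj (Y ω * conj (((Y ω).re : ℂ) ^ n))) := by
      ext ω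
      simp only [Pi.smul_apply, Pi.add_apply, map_mul, Complex.conj_conj, smul_eq_mul]
      rw [pow_succ, ← add_mul, Complex.re_eq_add_conj]
      ring
    rw [this]
    exact Submodule.smul_mem _ _ (add_mem h1 h2)

end Polynomials

lemma memLp_exp_abs_re (hZ : IsComplexIsonormal P Z) (h : H) :
    MemLp (fun ω => Real.exp |(Z h ω).re|) 2 P := by
  have hG : HasGaussianLaw (fun ω => (Z h ω).re) P :=
    (hZ.isGaussianProcess.hasGaussianLaw_eval h).map_fun Complex.reCLM
  have hi : ∀ t : ℝ, Integrable (fun ω => Real.exp (t * (Z h ω).re)) P := fun t => by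
    have h1 := integrable_exp_mul_gaussianReal (μ := P[fun ω => (Z h ω).re])
      (v := Var[fun ω => (Z h ω).re; P].toNNReal) t
    rw [← hG.map_eq_gaussianReal, integrable_map_measure (by fun_prop) hG.aemeasurable] at h1
    exact h1
  have h2 := integrable_exp_mul_abs (hi 2) (hi (-2))
  have hm : Measurable fun ω => Real.exp |(Z h ω).re| := by
    have := hZ.measurable h
    fun_prop
  rw [memLp_two_iff_integrable_sq hm.aestronglyMeasurable]
  refine h2.congr (ae_of_all _ fun ω => ?_)
  simp only
  rw [← Real.exp_nat_mul]; norm_num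

/-- If `F` is orthogonal to all powers of `Y = Re Z(h)`, then it is orthogonal to `exp(i Y)`, by
expanding the exponential; the series is dominated by `|F| exp |Y|`. -/
lemma integral_mul_exp_eq_zero_of_pow (hZ : IsComplexIsonormal P Z) (h : H) {F : Ω → ℂ}
    (hF : MemLp F 2 P) (h0 : ∀ n : ℕ, ∫ ω, F ω * ((Z h ω).re : ℂ) ^ n ∂P = 0) :
    ∫ ω, F ω * Complex.exp ((Z h ω).re * Complex.I) ∂P = 0 := by
  have hm : Measurable fun ω => (Z h ω).re := Complex.measurable_re.comp (hZ.measurable h)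
  have hs : ∀ ω, HasSum (fun n : ℕ => ‖F ω‖ * (|(Z h ω).re| ^ n / n.factorial))
      (‖F ω‖ * Real.exp |(Z h ω).re|) := fun ω => by
    have := NormedSpace.expSeries_div_hasSum_exp (|(Z h ω).re|)
    rw [← Real.exp_eq_exp_ℝ] at this
    exact this.mul_left _
  have key := hasSum_integral_of_dominated_convergence (μ := P)
    (F := fun (n : ℕ) ω => F ω * (((Z h ω).re * Complex.I) ^ n / (n.factorial : ℂ)))
    (f := fun ω => F ω * Complex.exp ((Z h ω).re * Complex.I))
    (fun n ω => ‖F ω‖ * (|(Z h ω).re| ^ n / n.factorial)) ?_ ?_ ?_ ?_ ?_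
  · have h1 : ∀ n : ℕ, ∫ ω, F ω * (((Z h ω).re * Complex.I) ^ n / (n.factorial : ℂ)) ∂P = 0 := by
      intro n
      have : ∀ ω, F ω * (((Z h ω).re * Complex.I) ^ n / (n.factorial : ℂ)) =
          (Complex.I ^ n / n.factorial) * (F ω * ((Z h ω).re : ℂ) ^ n) := fun ω => by
        rw [mul_pow]; ring
      simp_rw [this]
      rw [integral_const_mul, h0, mul_zero]
    simp only [h1] at key
    exact key.unique hasSum_zero
  · intro n
    refine hF.aestronglyMeasurable.mul (Measurable.aestronglyMeasurable ?_)
    fun_prop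
  · intro n
    refine ae_of_all _ fun ω => ?_
    simp
  · exact ae_of_all _ fun ω => (hs ω).summable
  · simp only [fun ω => (hs ω).tsum_eq]
    exact memLp_one_iff_integrable.1
      (MemLp.mul' (p := 2) (q := 2) (memLp_exp_abs_re hZ h) hF.norm)
  · refine ae_of_all _ fun ω => ?_
    have := NormedSpace.expSeries_div_hasSum_exp (((Z h ω).re : ℂ) * Complex.I)
    rw [← Complex.exp_eq_exp_ℂ] at this
    exact this.mul_left _

/-- The constant `1` is subtracted so that the function vanishes at `0` and acts on `L²` by
composition. -/
lemma lipschitzWith_exp_re_mul_I :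
    LipschitzWith 1 fun z : ℂ => Complex.exp (z.re * Complex.I) - 1 := by
  refine LipschitzWith.of_dist_le_mul fun z w => ?_
  rw [dist_eq_norm, dist_eq_norm, sub_sub_sub_cancel_right, NNReal.coe_one, one_mul]
  have h1 : Complex.exp (z.re * Complex.I) - Complex.exp (w.re * Complex.I) =
      Complex.exp (w.re * Complex.I) * (Complex.exp (Complex.I * ((z.re - w.re : ℝ) : ℂ)) - 1) := by
    rw [mul_sub, ← Complex.exp_add, mul_one]
    congr 2
    push_cast; ring
  rw [h1, norm_mul, Complex.norm_exp_ofReal_mul_I, one_mul]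
  refine (Real.norm_exp_I_mul_ofReal_sub_one_le).trans ?_
  rw [← Complex.sub_re]
  exact Complex.abs_re_le_norm _

variable [IsProbabilityMeasure P]

/-- If `F ∈ L²` is orthogonal to the Fourier–Hermite polynomials, then it is orthogonal to all
`exp(i Re Z(h))`. -/
lemma integral_conj_mul_exp_eq_zero [DecidableEq ι] (hZ : IsComplexIsonormal P Z) {e : ι → H}
    (he : (Submodule.span ℂ (Set.range e)).topologicalClosure = ⊤) (F : Lp ℂ 2 P)
    (hF : ∀ M N : Multiset ι, ∫ ω, conj (F ω) * hermiteProd Z e M N ω ∂P = 0) (h : H) :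
    ∫ ω, conj (F ω) * Complex.exp ((Z h ω).re * Complex.I) ∂P = 0 := by
  have hFm : MemLp (fun ω => conj (F ω)) 2 P := (Lp.memLp F).star
  have hspan : ∀ G ∈ hermiteSpan Z e, MemLp G 2 P ∧ ∫ ω, conj (F ω) * G ω ∂P = 0 := by
    intro G hG
    have hi : ∀ G : Ω → ℂ, MemLp G 2 P → Integrable (fun ω => conj (F ω) * G ω) P := fun G hG =>
      memLp_one_iff_integrable.1 (MemLp.mul' (p := 2) (q := 2) hG hFm)
    induction hG using Submodule.span_induction with
    | mem G hG =>
      obtain ⟨⟨M, N⟩, rfl⟩ := hG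
      exact ⟨memLp_hermiteProd hZ e M N ENNReal.ofNat_ne_top, hF M N⟩
    | zero => simp
    | add G G' _ _ h1 h2 =>
      refine ⟨h1.1.add h2.1, ?_⟩
      simp only [Pi.add_apply, mul_add]
      rw [integral_add (hi G h1.1) (hi G' h2.1), h1.2, h2.2, add_zero]
    | smul c G _ h1 =>
      refine ⟨h1.1.const_smul c, ?_⟩
      simp only [Pi.smul_apply, smul_eq_mul, mul_left_comm _ c]
      rw [integral_const_mul, h1.2, mul_zero]
  -- first for `h` in the dense span of `e`; the integral is continuous in `h`
  have hdense : ∀ h ∈ Submodule.span ℂ (Set.range e),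
      ∫ ω, conj (F ω) * Complex.exp ((Z h ω).re * Complex.I) ∂P = 0 := by
    intro h hh
    refine integral_mul_exp_eq_zero_of_pow hZ h hFm fun n => ?_
    obtain ⟨Y, hY, hn⟩ := exists_pow_mem_hermiteSpan hZ e hh
    rw [← (hspan _ (hn n)).2]
    refine integral_congr_ae ?_
    filter_upwards [hY] with ω h
    rw [h]
  have h0 : (fun z : ℂ => Complex.exp (z.re * Complex.I) - 1) 0 = 0 := by simp
  have heq : ∀ h, ∫ ω, conj (F ω) * Complex.exp ((Z h ω).re * Complex.I) ∂P =
      inner ℂ F (lipschitzWith_exp_re_mul_I.compLp h0 (hZ.toL2 h)) + ∫ ω, conj (F ω) ∂P := by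
    intro h
    have h2 : ∫ ω, inner ℂ (F ω) ((lipschitzWith_exp_re_mul_I.compLp h0 (hZ.toL2 h) :
        Lp ℂ 2 P) ω) ∂P = ∫ ω, conj (F ω) * (Complex.exp ((Z h ω).re * Complex.I) - 1) ∂P := by
      refine integral_congr_ae ?_
      filter_upwards [lipschitzWith_exp_re_mul_I.coeFn_compLp h0 (hZ.toL2 h),
        hZ.coeFn_toL2 h] with ω h1 h2
      rw [h1, Function.comp_apply, h2, RCLike.inner_apply, mul_comm]
    have hi1 : Integrable (fun ω => conj (F ω)) P := hFm.integrable (by norm_num)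
    have hi2 : Integrable (fun ω => conj (F ω) * Complex.exp ((Z h ω).re * Complex.I)) P := by
      refine hi1.mul_bdd (c := 1) (Measurable.aestronglyMeasurable ?_) (ae_of_all _ fun ω => ?_)
      · have := hZ.measurable h
        fun_prop
      · rw [Complex.norm_exp_ofReal_mul_I]
    rw [L2.inner_def, h2]
    simp only [mul_sub, mul_one]
    rw [integral_sub hi2 hi1]
    ring
  have hcont : Continuous fun h => ∫ ω, conj (F ω) * Complex.exp ((Z h ω).re * Complex.I) ∂P := by
    simp only [heq]
    refine Continuous.add ?_ continuous_const
    exact Continuous.inner continuous_const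
      ((lipschitzWith_exp_re_mul_I.continuous_compLp h0).comp hZ.toL2Isometry.continuous)
  have hcl : IsClosed {h | ∫ ω, conj (F ω) * Complex.exp ((Z h ω).re * Complex.I) ∂P = 0} :=
    isClosed_eq hcont continuous_const
  have : h ∈ (Submodule.span ℂ (Set.range e)).topologicalClosure := by rw [he]; trivial
  exact closure_minimal hdense hcl this

end Characters

/-! ### Totality of the Fourier–Hermite polynomials -/

section Uniqueness

variable {Ω H : Type*} {mΩ : MeasurableSpace Ω} [NormedAddCommGroup H] [InnerProductSpace ℂ H]
  {P : Measure Ω} {Z : H → Ω → ℂ}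

/-- Every real linear functional on `ℂ^I` is the real part of a complex linear one. -/
lemma strongDual_pi_apply {I : Type*} [Fintype I] [DecidableEq I] (L : StrongDual ℝ (I → ℂ))
    (x : I → ℂ) :
    L x = (∑ i, ((L (Pi.single i 1) : ℂ) - L (Pi.single i Complex.I) * Complex.I) * x i).re := by
  have h1 : x = ∑ i, ((x i).re • (Pi.single i (1 : ℂ) : I → ℂ) +
      (x i).im • (Pi.single i Complex.I : I → ℂ)) := by
    ext k
    simp [Finset.sum_apply, Pi.single_apply, Finset.sum_add_distrib, Complex.re_add_im]
  conv_lhs => rw [h1]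
  rw [map_sum, Complex.re_sum]
  refine Finset.sum_congr rfl fun i _ => ?_
  simp
  ring

set_option linter.unusedSectionVars false in
lemma sigmaAlgebra_eq_comap (Z : H → Ω → ℂ) :
    sigmaAlgebra Z = MeasurableSpace.comap (fun ω h => Z h ω) MeasurableSpace.pi := by
  simp only [sigmaAlgebra, MeasurableSpace.pi, MeasurableSpace.comap_iSup,
    MeasurableSpace.comap_comp]
  rfl

lemma sigmaAlgebra_le (hZ : IsComplexIsonormal P Z) : sigmaAlgebra Z ≤ mΩ :=
  iSup_le fun h => (hZ.measurable h).comap_le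

/-- A real integrable function `u` with `E[u exp(i Re Z(h))] = 0` for all `h` has integral zero
over every event of `σ(Z)`: the laws of `Z` under `u⁺ P` and `u⁻ P` have the same
finite-dimensional characteristic functions. -/
lemma setIntegral_eq_zero_of_integral_mul_exp (hZ : IsComplexIsonormal P Z) {u : Ω → ℝ}
    (hu : Integrable u P) (hum : Measurable u)
    (h0 : ∀ h, ∫ ω, (u ω : ℂ) * Complex.exp ((Z h ω).re * Complex.I) ∂P = 0)
    {A : Set Ω} (hA : MeasurableSet[sigmaAlgebra Z] A) : ∫ ω in A, u ω ∂P = 0 := by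
  classical
  set X : Ω → H → ℂ := fun ω h => Z h ω with hX
  have hXm : Measurable X := measurable_pi_iff.2 hZ.measurable
  -- the measures `u⁺ P` and `u⁻ P`
  let μ : Measure Ω := P.withDensity fun ω => ENNReal.ofReal (u ω)
  let ν : Measure Ω := P.withDensity fun ω => ENNReal.ofReal (-u ω)
  have hμ : IsFiniteMeasure μ := isFiniteMeasure_withDensity_ofReal hu.2
  have hν : IsFiniteMeasure ν := isFiniteMeasure_withDensity_ofReal hu.neg.2
  have hproj : ∀ I : Finset H, (ν.map X).map I.restrict = (μ.map X).map I.restrict := by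
    intro I
    have hr : Measurable (I.restrict : (H → ℂ) → (I → ℂ)) := by fun_prop
    rw [Measure.map_map hr hXm, Measure.map_map hr hXm]
    have hm : Measurable (I.restrict ∘ X) := hr.comp hXm
    have : IsFiniteMeasure (ν.map (I.restrict ∘ X)) := Measure.isFiniteMeasure_map _ _
    have : IsFiniteMeasure (μ.map (I.restrict ∘ X)) := Measure.isFiniteMeasure_map _ _
    refine Measure.ext_of_charFunDual (funext fun L => ?_)
    rw [charFunDual_apply, charFunDual_apply,
      integral_map hm.aemeasurable (Measurable.aestronglyMeasurable (by fun_prop)),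
      integral_map hm.aemeasurable (Measurable.aestronglyMeasurable (by fun_prop)),
      integral_withDensity_eq_integral_toReal_smul (by fun_prop)
        (ae_of_all _ fun _ => ENNReal.ofReal_lt_top),
      integral_withDensity_eq_integral_toReal_smul (by fun_prop)
        (ae_of_all _ fun _ => ENNReal.ofReal_lt_top)]
    set c : I → ℂ := fun i => (L (Pi.single i 1) : ℂ) - L (Pi.single i Complex.I) * Complex.I
    have hL : ∀ᵐ ω ∂P, L ((I.restrict ∘ X) ω) = (Z (∑ i : I, c i • (i : H)) ω).re := by
      filter_upwards [hZ.eval_sum_ae Finset.univ c fun i : I => (i : H)] with ω h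
      rw [h, strongDual_pi_apply]
      rfl
    have hint : ∀ v : Ω → ℝ, Integrable v P → Integrable
        (fun ω => v ω • Complex.exp (L ((I.restrict ∘ X) ω) * Complex.I)) P := fun v hv => by
      simp only [Complex.real_smul]
      refine hv.ofReal.mul_bdd (c := 1) (Measurable.aestronglyMeasurable (by fun_prop))
        (ae_of_all _ fun ω => ?_)
      rw [Complex.norm_exp_ofReal_mul_I]
    have hi1 : Integrable (fun ω => (ENNReal.ofReal (u ω)).toReal) P := by
      simpa [ENNReal.toReal_ofReal'] using hu.pos_part
    have hi2 : Integrable (fun ω => (ENNReal.ofReal (-u ω)).toReal) P := by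
      simpa [ENNReal.toReal_ofReal'] using hu.neg_part
    rw [eq_comm, ← sub_eq_zero, ← integral_sub (hint _ hi1) (hint _ hi2), ← h0 (∑ i : I, c i • i)]
    refine integral_congr_ae ?_
    filter_upwards [hL] with ω h
    rw [h, ← sub_smul, Complex.real_smul]
    congr 2
    rw [ENNReal.toReal_ofReal', ENNReal.toReal_ofReal', max_zero_sub_max_neg_zero_eq_self]
  have hfin : ∀ I : Finset H, IsFiniteMeasure ((μ.map X).map I.restrict) := fun I => by
    have : IsFiniteMeasure (μ.map X) := Measure.isFiniteMeasure_map _ _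
    exact Measure.isFiniteMeasure_map _ _
  have heq : μ.map X = ν.map X :=
    IsProjectiveLimit.unique (P := fun I : Finset H => (μ.map X).map I.restrict)
      (fun I => rfl) hproj
  rw [sigmaAlgebra_eq_comap] at hA
  obtain ⟨B, hB, rfl⟩ := hA
  have hA' : MeasurableSet (X ⁻¹' B) := hXm hB
  have h1 : μ (X ⁻¹' B) = ν (X ⁻¹' B) := by
    rw [← Measure.map_apply hXm hB, ← Measure.map_apply hXm hB, heq]
  rw [withDensity_apply _ hA', withDensity_apply _ hA'] at h1
  rw [integral_eq_lintegral_pos_part_sub_lintegral_neg_part hu.integrableOn]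
  exact sub_eq_zero.2 (congrArg ENNReal.toReal h1)

variable [IsProbabilityMeasure P]

/-- The variables `exp(i Re Z(h))` are total in `L²(σ(Z))`. -/
lemma eq_zero_of_integral_conj_mul_exp (hZ : IsComplexIsonormal P Z) (F : Lp ℂ 2 P)
    (hF : F ∈ lpMeas ℂ ℂ (sigmaAlgebra Z) 2 P)
    (h0 : ∀ h, ∫ ω, conj (F ω) * Complex.exp ((Z h ω).re * Complex.I) ∂P = 0) : F = 0 := by
  have hFi : Integrable F P := integrable_coeFn_Lp_two F
  have hFci : Integrable (fun ω => conj (F ω)) P :=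
    (Lp.memLp F).star.integrable (by norm_num)
  have hFm : Measurable F := (Lp.stronglyMeasurable F).measurable
  have hexp : ∀ (G : Ω → ℂ) h, Integrable G P →
      Integrable (fun ω => G ω * Complex.exp ((Z h ω).re * Complex.I)) P := fun G h hG => by
    refine hG.mul_bdd (c := 1) (Measurable.aestronglyMeasurable ?_) (ae_of_all _ fun ω => ?_)
    · have := hZ.measurable h
      fun_prop
    · rw [Complex.norm_exp_ofReal_mul_I]
  -- conjugation of the hypothesis at `-h`
  have h0' : ∀ h, ∫ ω, F ω * Complex.exp ((Z h ω).re * Complex.I) ∂P = 0 := fun h => by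
    have h1 := congrArg conj (h0 (-h))
    rw [← integral_conj, map_zero] at h1
    rw [← h1]
    refine integral_congr_ae ?_
    filter_upwards [hZ.eval_smul_ae (-1) h] with ω h2
    rw [neg_one_smul] at h2
    rw [h2, map_mul, Complex.conj_conj, ← Complex.exp_conj]
    congr 2
    simp
  have hre : ∀ h, ∫ ω, ((F ω).re : ℂ) * Complex.exp ((Z h ω).re * Complex.I) ∂P = 0 := fun h => by
    have : ∀ ω, ((F ω).re : ℂ) * Complex.exp ((Z h ω).re * Complex.I) =
        1 / 2 * (F ω * Complex.exp ((Z h ω).re * Complex.I) +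
          conj (F ω) * Complex.exp ((Z h ω).re * Complex.I)) := fun ω => by
      rw [Complex.re_eq_add_conj (F ω)]; ring
    simp_rw [this]
    rw [integral_const_mul, integral_add (hexp _ h hFi) (hexp _ h hFci), h0, h0']
    simp
  have him : ∀ h, ∫ ω, ((F ω).im : ℂ) * Complex.exp ((Z h ω).re * Complex.I) ∂P = 0 := fun h => by
    have : ∀ ω, ((F ω).im : ℂ) * Complex.exp ((Z h ω).re * Complex.I) =
        1 / (2 * Complex.I) * (F ω * Complex.exp ((Z h ω).re * Complex.I) -
          conj (F ω) * Complex.exp ((Z h ω).re * Complex.I)) := fun ω => by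
      rw [Complex.im_eq_sub_conj (F ω)]; ring
    simp_rw [this]
    rw [integral_const_mul, integral_sub (hexp _ h hFi) (hexp _ h hFci), h0, h0']
    simp
  have hset : ∀ A, MeasurableSet[sigmaAlgebra Z] A → ∫ ω in A, F ω ∂P = 0 := fun A hA => by
    have h1 := setIntegral_eq_zero_of_integral_mul_exp hZ hFi.re
      (Complex.measurable_re.comp hFm) hre hA
    have h2 := setIntegral_eq_zero_of_integral_mul_exp hZ hFi.im
      (Complex.measurable_im.comp hFm) him hA
    rw [← integral_re_add_im hFi.integrableOn, h1, h2]
    simp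
  have := Lp.ae_eq_zero_of_forall_setIntegral_eq_zero' ℂ (sigmaAlgebra_le hZ) F two_ne_zero
    ENNReal.ofNat_ne_top (fun s _ _ => hFi.integrableOn) (fun s hs _ => hset s hs)
    (mem_lpMeas_iff_aestronglyMeasurable.1 hF)
  exact (Lp.eq_zero_iff_ae_eq_zero).2 this

/-- The Fourier–Hermite polynomials are total in `L²(σ(Z))`. -/
theorem eq_zero_of_forall_inner_hermiteL2 {ι : Type*} (hZ : IsComplexIsonormal P Z) {e : ι → H}
    (he : (Submodule.span ℂ (Set.range e)).topologicalClosure = ⊤) (F : Lp ℂ 2 P)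
    (hF : F ∈ lpMeas ℂ ℂ (sigmaAlgebra Z) 2 P)
    (h0 : ∀ (p q : ℕ) (j : Fin p ⊕ Fin q → ι), inner ℂ (hermiteL2 hZ e j) F = 0) : F = 0 := by
  classical
  refine eq_zero_of_integral_conj_mul_exp hZ F hF
    (integral_conj_mul_exp_eq_zero hZ he F fun M N => ?_)
  obtain ⟨l, rfl⟩ := Quot.exists_rep M
  obtain ⟨l', rfl⟩ := Quot.exists_rep N
  have h1 := h0 l.length l'.length (Sum.elim l.get l'.get)
  rw [inner_hermiteL2_eq_integral, fourierHermite_eq_hermiteProd] at h1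
  have e1 : ∀ l : List ι, Finset.univ.val.map l.get = (l : Multiset ι) := fun l => by
    rw [Fin.univ_val_map, List.ofFn_get]
  rw [Sum.elim_comp_inl, Sum.elim_comp_inr, e1, e1] at h1
  have h2 := congrArg conj h1
  rw [← integral_conj, map_zero] at h2
  simpa using h2

end Uniqueness

/-! ### Total families in Hilbert tensor powers -/

section TensorBasis

variable {κ H : Type*} [NormedAddCommGroup H] [InnerProductSpace ℂ H] [Fintype κ]

lemma norm_tprod (u : κ → H) : ‖tprod u‖ = ∏ i, ‖u i‖ := by
  have h := inner_tprod u u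
  simp only [inner_self_eq_norm_sq_to_K] at h
  have h2 : ‖tprod u‖ ^ 2 = (∏ i, ‖u i‖) ^ 2 := by
    rw [← Finset.prod_pow]; exact_mod_cast h
  exact (sq_eq_sq₀ (norm_nonneg _) (Finset.prod_nonneg fun _ _ => norm_nonneg _)).1 h2

lemma tprod_update_add [DecidableEq κ] (u : κ → H) (i : κ) (a b : H) :
    tprod (Function.update u i (a + b)) =
      tprod (Function.update u i a) + tprod (Function.update u i b) := by
  have h : algTprod (Function.update u i (a + b)) =
      algTprod (Function.update u i a) + algTprod (Function.update u i b) :=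
    (congrArg (toPi κ H).symm (MultilinearMap.map_update_add _ u i a b)).trans
      (map_add (toPi κ H).symm _ _)
  exact (congrArg _ h).trans (UniformSpace.Completion.coe_add _ _)

lemma tprod_update_smul [DecidableEq κ] (u : κ → H) (i : κ) (c : ℂ) (a : H) :
    tprod (Function.update u i (c • a)) = c • tprod (Function.update u i a) := by
  have h : algTprod (Function.update u i (c • a)) = c • algTprod (Function.update u i a) :=
    (congrArg (toPi κ H).symm (MultilinearMap.map_update_smul _ u i c a)).trans
      (map_smul (toPi κ H).symm _ _)
  exact (congrArg _ h).trans (UniformSpace.Completion.coe_smul _ _)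

/-- The pure tensor as a continuous linear function of one of its factors. -/
noncomputable def tprodUpdate [DecidableEq κ] (u : κ → H) (i : κ) :
    H →L[ℂ] HilbertTensor κ H :=
  LinearMap.mkContinuous
    { toFun := fun h => tprod (Function.update u i h)
      map_add' := tprod_update_add u i
      map_smul' := tprod_update_smul u i }
    (∏ l ∈ Finset.univ.erase i, ‖u l‖) fun h => by
      simp only [LinearMap.coe_mk, AddHom.coe_mk]
      rw [norm_tprod, ← Finset.mul_prod_erase _ _ (Finset.mem_univ i), mul_comm,
        Function.update_self]
      refine le_of_eq (congrArg (· * _) (Finset.prod_congr rfl fun l hl => ?_))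
      rw [Function.update_of_ne (Finset.ne_of_mem_erase hl)]

/-- The pure tensors of elements of total families are total in the Hilbert tensor power. -/
lemma eq_zero_of_forall_inner_tprod {ι : Type*} (b : κ → ι → H)
    (hb : ∀ i, (Submodule.span ℂ (Set.range (b i))).topologicalClosure = ⊤)
    (x : HilbertTensor κ H) (hx : ∀ j : κ → ι, inner ℂ x (tprod fun i => b i (j i)) = 0) :
    x = 0 := by
  classical
  -- replace the total families by arbitrary vectors in one factor at a time
  have h1 : ∀ (s : Finset κ) (u : κ → H), (∀ i ∉ s, u i ∈ Set.range (b i)) →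
      inner ℂ x (tprod u) = 0 := by
    intro s
    induction s using Finset.induction_on with
    | empty =>
      intro u hu
      choose j hj using fun i => hu i (Finset.notMem_empty i)
      rw [← hx j]
      congr 2
      exact (funext hj).symm
    | insert i s _ ih =>
      intro u hu
      have h2 : u i ∈ (Submodule.span ℂ (Set.range (b i))).topologicalClosure := by
        rw [hb]; trivial
      let Λ : H →L[ℂ] ℂ := (innerSL ℂ x).comp (tprodUpdate u i)
      have h3 : Submodule.span ℂ (Set.range (b i)) ≤ LinearMap.ker Λ.toLinearMap := by
        rw [Submodule.span_le]
        rintro _ ⟨k, rfl⟩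
        refine ih _ fun l hl => ?_
        by_cases hli : l = i
        · subst hli; simp
        · rw [Function.update_of_ne hli]
          exact hu l (by simp [hli, hl])
      have h4 : u i ∈ LinearMap.ker Λ.toLinearMap :=
        Submodule.topologicalClosure_minimal _ h3 Λ.isClosed_ker h2
      have h5 : inner ℂ x (tprod (Function.update u i (u i))) = 0 := h4
      rwa [Function.update_eq_self] at h5
  have h2 : ∀ y : HilbertTensor κ H, inner ℂ x y = 0 := by
    intro y
    induction y using UniformSpace.Completion.induction_on with
    | hp => exact isClosed_eq (by fun_prop) continuous_const
    | ih a =>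
      induction a using algTensor_induction with
      | tp v => exact h1 Finset.univ v fun i hi => absurd (Finset.mem_univ i) hi
      | zero => exact (congrArg _ UniformSpace.Completion.coe_zero).trans (inner_zero_right x)
      | add a b ha hb => rw [UniformSpace.Completion.coe_add, inner_add_right, ha, hb, add_zero]
      | smul c a ha => rw [UniformSpace.Completion.coe_smul, inner_smul_right, ha, mul_zero]
  exact inner_self_eq_zero.1 (h2 x)

end TensorBasis

/-! ### Kernels and symmetric coefficients -/

section BasisTensor

variable {ι H : Type*} [NormedAddCommGroup H] [InnerProductSpace ℂ H] {p q : ℕ}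

lemma orthonormal_basisTensor (C : H ≃ₗᵢ⋆[ℂ] H) {e : ι → H} (he : Orthonormal ℂ e) :
    Orthonormal ℂ (basisTensor C e : (Fin p ⊕ Fin q → ι) → _) := by
  classical
  rw [orthonormal_iff_ite] at he ⊢
  intro j j'
  rw [basisTensor, basisTensor, inner_tprod, Fintype.prod_sum_type]
  simp only [Sum.elim_inl, Sum.elim_inr, inner_map_conjugation, he]
  split_ifs with h
  · subst h; simp
  · obtain ⟨x, hx⟩ := Function.ne_iff.1 h
    rcases x with x | x
    · rw [Finset.prod_eq_zero (Finset.mem_univ x) (if_neg hx), zero_mul]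
    · rw [Finset.prod_eq_zero (Finset.mem_univ x) (if_neg (Ne.symm hx)), mul_zero]

/-- An element of `H^{⊗(p+q)}` is determined by its coefficients with respect to the basis
tensors. -/
lemma ext_inner_basisTensor [CompleteSpace H] (C : H ≃ₗᵢ⋆[ℂ] H) (hC : ∀ h, C (C h) = h)
    (e : HilbertBasis ι ℂ H) {x y : HilbertTensor (Fin p ⊕ Fin q) H}
    (h : ∀ j, inner ℂ (basisTensor C e j) x = inner ℂ (basisTensor C e j) y) : x = y := by
  rw [← sub_eq_zero]
  refine eq_zero_of_forall_inner_tprod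
    (Sum.elim (fun _ => (e : ι → H)) (fun _ k => C (e k))) ?_ _ fun j => ?_
  · rintro (i | i)
    · exact e.dense_span
    · rw [Submodule.topologicalClosure_eq_top_iff, Submodule.eq_bot_iff]
      intro y hy
      have h1 : C y ∈ (Submodule.span ℂ (Set.range e))ᗮ := by
        rw [Submodule.mem_orthogonal']
        intro u hu
        induction hu using Submodule.span_induction with
        | mem u hu =>
          obtain ⟨k, rfl⟩ := hu
          rw [← hC (e k), inner_map_conjugation]
          exact (Submodule.mem_orthogonal _ _).1 hy _ (Submodule.subset_span ⟨k, rfl⟩)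
        | zero => simp
        | add a b _ _ ha hb => rw [inner_add_right, ha, hb, add_zero]
        | smul c a _ ha => rw [inner_smul_right, ha, mul_zero]
      rw [(Submodule.topologicalClosure_eq_top_iff).1 e.dense_span, Submodule.mem_bot] at h1
      simpa using h1
  · rw [← inner_conj_symm]
    have h1 : (fun i => Sum.elim (fun _ => (e : ι → H)) (fun _ k => C (e k)) i (j i)) =
        Sum.elim (fun a => e (j (Sum.inl a))) (fun b => C (e (j (Sum.inr b)))) := by
      ext (i | i) <;> rfl
    rw [h1, ← basisTensor, inner_sub_right, h j, sub_self, map_zero]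

lemma inner_tprod_comp_perm {κ : Type*} [Fintype κ] (ρ : Equiv.Perm κ) (w z : κ → H) :
    inner ℂ (tprod (w ∘ ρ)) (tprod z) = inner ℂ (tprod w) (tprod (z ∘ ρ.symm)) := by
  rw [inner_tprod, inner_tprod]
  exact Fintype.prod_equiv ρ _ _ fun i => by simp

lemma basisTensor_comp_map (C : H ≃ₗᵢ⋆[ℂ] H) (e : ι → H) (j : Fin p ⊕ Fin q → ι)
    (π : Equiv.Perm (Fin p) × Equiv.Perm (Fin q)) :
    basisTensor C e (j ∘ Sum.map π.1 π.2) =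
      tprod ((Sum.elim (fun a => e (j (Sum.inl a))) (fun b => C (e (j (Sum.inr b))))) ∘
        Equiv.sumCongr π.1 π.2) := by
  rw [basisTensor]
  congr 1
  ext (i | i) <;> rfl

/-- The elements of `H^{⊙p} ⊗ H^{⊙q}` have symmetric coefficients. -/
lemma inner_basisTensor_comp_of_mem_symKernel (C : H ≃ₗᵢ⋆[ℂ] H) (e : ι → H)
    {x : HilbertTensor (Fin p ⊕ Fin q) H} (hx : x ∈ SymKernel H p q) (j : Fin p ⊕ Fin q → ι)
    (π : Equiv.Perm (Fin p) × Equiv.Perm (Fin q)) :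
    inner ℂ (basisTensor C e (j ∘ Sum.map π.1 π.2)) x = inner ℂ (basisTensor C e j) x := by
  let S : Submodule ℂ (HilbertTensor (Fin p ⊕ Fin q) H) :=
    LinearMap.ker (innerSL ℂ (basisTensor C e (j ∘ Sum.map π.1 π.2)) -
      innerSL ℂ (basisTensor C e j)).toLinearMap
  suffices h : SymKernel H p q ≤ S by
    have h1 := h hx
    simpa [S, sub_eq_zero] using h1
  refine Submodule.topologicalClosure_minimal _ ?_ (ContinuousLinearMap.isClosed_ker _)
  rw [Submodule.span_le]
  rintro _ ⟨⟨u, v⟩, rfl⟩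
  have h1 : inner ℂ (basisTensor C e (j ∘ Sum.map π.1 π.2)) (symTprod u v) =
      inner ℂ (basisTensor C e j) (symTprod u v) := by
    rw [symTprod, inner_smul_right, inner_smul_right, inner_sum, inner_sum]
    congr 1
    simp only [inner_sum]
    refine Fintype.sum_equiv (Equiv.mulRight π.1⁻¹) _ _ fun α => ?_
    refine Fintype.sum_equiv (Equiv.mulRight π.2⁻¹) _ _ fun β => ?_
    rw [basisTensor_comp_map, inner_tprod_comp_perm, basisTensor]
    congr 2
    ext (i | i) <;> rfl
  simpa [S, sub_eq_zero] using h1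

lemma symTprod_basis (C : H ≃ₗᵢ⋆[ℂ] H) (e : ι → H) (j : Fin p ⊕ Fin q → ι) :
    symTprod (fun a => e (j (Sum.inl a))) (fun b => C (e (j (Sum.inr b)))) =
      (p.factorial * q.factorial : ℂ)⁻¹ •
        ∑ π : Equiv.Perm (Fin p) × Equiv.Perm (Fin q), basisTensor C e (j ∘ Sum.map π.1 π.2) := by
  rw [symTprod, Fintype.sum_prod_type]
  rfl

lemma factorial_mul_factorial_ne_zero (p q : ℕ) : (p.factorial * q.factorial : ℂ) ≠ 0 :=
  mul_ne_zero (Nat.cast_ne_zero.2 p.factorial_ne_zero) (Nat.cast_ne_zero.2 q.factorial_ne_zero)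

lemma card_perm_prod (p q : ℕ) :
    Fintype.card (Equiv.Perm (Fin p) × Equiv.Perm (Fin q)) = p.factorial * q.factorial := by
  rw [Fintype.card_prod, Fintype.card_perm, Fintype.card_perm, Fintype.card_fin, Fintype.card_fin]

/-- Conversely, an element of `H^{⊗(p+q)}` with symmetric coefficients belongs to
`H^{⊙p} ⊗ H^{⊙q}`. -/
lemma mem_symKernel_of_inner_basisTensor_comp [CompleteSpace H] (C : H ≃ₗᵢ⋆[ℂ] H)
    (hC : ∀ h, C (C h) = h) (e : HilbertBasis ι ℂ H) {x : HilbertTensor (Fin p ⊕ Fin q) H}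
    (hx : ∀ j (π : Equiv.Perm (Fin p) × Equiv.Perm (Fin q)),
      inner ℂ (basisTensor C e (j ∘ Sum.map π.1 π.2)) x = inner ℂ (basisTensor C e j) x) :
    x ∈ SymKernel H p q := by
  have : IsClosed (SymKernel H p q : Set (HilbertTensor (Fin p ⊕ Fin q) H)) :=
    Submodule.isClosed_topologicalClosure _
  have : CompleteSpace (SymKernel H p q) := this.completeSpace_coe
  set y := (SymKernel H p q).starProjection x with hy
  have hyS : y ∈ SymKernel H p q := Submodule.starProjection_apply_mem _ x
  suffices h : x = y by rw [h]; exact hyS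
  refine ext_inner_basisTensor C hC e fun j => ?_
  -- the coefficients of `x - y` are symmetric, so that they are equal to their averages over
  -- permutations, which are inner products with symmetrized tensors
  have h1 : inner ℂ (symTprod (fun a => e (j (Sum.inl a))) (fun b => C (e (j (Sum.inr b)))))
      (x - y) = 0 :=
    (Submodule.mem_orthogonal _ _).1 (Submodule.sub_starProjection_mem_orthogonal x) _
      (Submodule.le_topologicalClosure _ (Submodule.subset_span ⟨(_, _), rfl⟩))
  rw [symTprod_basis, inner_smul_left, sum_inner] at h1
  simp only [inner_sub_right, hx, inner_basisTensor_comp_of_mem_symKernel C e hyS] at h1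
  rw [Finset.sum_const, Finset.card_univ, card_perm_prod, nsmul_eq_mul] at h1
  have h2 := factorial_mul_factorial_ne_zero p q
  rw [mul_eq_zero, mul_eq_zero] at h1
  rcases h1 with h1 | h1 | h1
  · simp [Nat.factorial_ne_zero] at h1
  · exact absurd h1 (by push_cast; exact h2)
  · exact sub_eq_zero.1 h1

end BasisTensor

/-! ### The Wiener–Itô integral as a bounded operator -/

section Integral

variable {Ω H ι : Type*} {mΩ : MeasurableSpace Ω} [NormedAddCommGroup H] [InnerProductSpace ℂ H]
  {P : Measure Ω} [IsProbabilityMeasure P] {Z : H → Ω → ℂ} {e : ι → H} {p q : ℕ}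

open scoped Classical in
/-- A Bessel-type bound.  By `inner_hermiteL2` the squared norm is a sum over `p! q!` permutations
`π` of `∑_j conj (c_j) c_{j ∘ π}`, and each of these sums is at most `∑_j |c_j|²`. -/
lemma norm_sq_sum_smul_hermiteL2_le (hZ : IsComplexIsonormal P Z) (he : Orthonormal ℂ e)
    (s : Finset (Fin p ⊕ Fin q → ι)) (c : (Fin p ⊕ Fin q → ι) → ℂ) :
    ‖∑ j ∈ s, c j • hermiteL2 hZ e j‖ ^ 2 ≤ (p.factorial * q.factorial : ℝ) *
      ∑ j ∈ s, ‖c j‖ ^ 2 := by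
  have h1 : (‖∑ j ∈ s, c j • hermiteL2 hZ e j‖ ^ 2 : ℝ) =
      ‖∑ j ∈ s, ∑ j' ∈ s, ∑ π : Equiv.Perm (Fin p) × Equiv.Perm (Fin q),
        conj (c j) * c j' * (if j ∘ Sum.map π.1 π.2 = j' then (1 : ℂ) else 0)‖ := by
    have h2 : inner ℂ (∑ j ∈ s, c j • hermiteL2 hZ e j) (∑ j ∈ s, c j • hermiteL2 hZ e j) =
        ∑ j ∈ s, ∑ j' ∈ s, ∑ π : Equiv.Perm (Fin p) × Equiv.Perm (Fin q),
          conj (c j) * c j' * (if j ∘ Sum.map π.1 π.2 = j' then (1 : ℂ) else 0) := by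
      rw [sum_inner]
      refine Finset.sum_congr rfl fun j _ => ?_
      rw [inner_sum]
      refine Finset.sum_congr rfl fun j' _ => ?_
      rw [inner_smul_left, inner_smul_right, inner_hermiteL2 hZ he, ← Finset.mul_sum, mul_assoc]
    rw [← h2, inner_self_eq_norm_sq_to_K]
    simp
  -- `|c_j c_{j'}| ≤ |c_j|² / 2 + |c_{j'}|² / 2`; given `π`, each of `j`, `j'` determines the other
  have hle : ∀ j j' : Fin p ⊕ Fin q → ι, ∀ π : Equiv.Perm (Fin p) × Equiv.Perm (Fin q),
      ‖conj (c j) * c j' * (if j ∘ Sum.map π.1 π.2 = j' then (1 : ℂ) else 0)‖ ≤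
        (if j ∘ Sum.map π.1 π.2 = j' then ‖c j‖ ^ 2 / 2 else 0) +
        (if j = j' ∘ Sum.map π.1.symm π.2.symm then ‖c j'‖ ^ 2 / 2 else 0) := by
    intro j j' π
    by_cases h : j ∘ Sum.map π.1 π.2 = j'
    · have h' : j = j' ∘ Sum.map π.1.symm π.2.symm := by
        rw [← h]; ext (i | i) <;> simp
      rw [if_pos h, if_pos h, if_pos h', mul_one, norm_mul, RCLike.norm_conj]
      nlinarith [sq_nonneg (‖c j‖ - ‖c j'‖)]
    · rw [if_neg h, mul_zero, norm_zero]
      positivity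
  have hcard : (p.factorial * q.factorial : ℝ) =
      ∑ _π : Equiv.Perm (Fin p) × Equiv.Perm (Fin q), (1 : ℝ) := by
    rw [Finset.sum_const, Finset.card_univ, card_perm_prod]
    simp
  rw [h1]
  calc _ ≤ ∑ j ∈ s, ∑ j' ∈ s, ∑ π : Equiv.Perm (Fin p) × Equiv.Perm (Fin q),
        ((if j ∘ Sum.map π.1 π.2 = j' then ‖c j‖ ^ 2 / 2 else 0) +
        (if j = j' ∘ Sum.map π.1.symm π.2.symm then ‖c j'‖ ^ 2 / 2 else 0)) := by
        refine (norm_sum_le _ _).trans (Finset.sum_le_sum fun j _ => ?_)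
        refine (norm_sum_le _ _).trans (Finset.sum_le_sum fun j' _ => ?_)
        exact (norm_sum_le _ _).trans (Finset.sum_le_sum fun π _ => hle j j' π)
    _ = ∑ π : Equiv.Perm (Fin p) × Equiv.Perm (Fin q),
        ((∑ j ∈ s, ∑ j' ∈ s, if j ∘ Sum.map π.1 π.2 = j' then ‖c j‖ ^ 2 / 2 else 0) +
        ∑ j' ∈ s, ∑ j ∈ s, if j = j' ∘ Sum.map π.1.symm π.2.symm then ‖c j'‖ ^ 2 / 2 else 0) := by
        have : ∀ j ∈ s, (∑ j' ∈ s, ∑ π : Equiv.Perm (Fin p) × Equiv.Perm (Fin q),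
          ((if j ∘ Sum.map π.1 π.2 = j' then ‖c j‖ ^ 2 / 2 else 0) +
          (if j = j' ∘ Sum.map π.1.symm π.2.symm then ‖c j'‖ ^ 2 / 2 else 0))) =
          ∑ π : Equiv.Perm (Fin p) × Equiv.Perm (Fin q), ∑ j' ∈ s,
          ((if j ∘ Sum.map π.1 π.2 = j' then ‖c j‖ ^ 2 / 2 else 0) +
          (if j = j' ∘ Sum.map π.1.symm π.2.symm then ‖c j'‖ ^ 2 / 2 else 0)) := fun j _ =>
            Finset.sum_comm
        rw [Finset.sum_congr rfl this, Finset.sum_comm]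
        refine Finset.sum_congr rfl fun π _ => ?_
        simp only [Finset.sum_add_distrib]
        congr 1
        exact Finset.sum_comm
    _ ≤ ∑ _π : Equiv.Perm (Fin p) × Equiv.Perm (Fin q),
        ((∑ j ∈ s, ‖c j‖ ^ 2 / 2) + ∑ j' ∈ s, ‖c j'‖ ^ 2 / 2) := by
        refine Finset.sum_le_sum fun π _ => add_le_add ?_ ?_
        · refine Finset.sum_le_sum fun j _ => ?_
          rw [Finset.sum_ite_eq]
          split_ifs
          · exact le_rfl
          · positivity
        · refine Finset.sum_le_sum fun j _ => ?_
          rw [Finset.sum_ite_eq']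
          split_ifs
          · exact le_rfl
          · positivity
    _ = _ := by
        rw [hcard, Finset.sum_mul]
        refine Finset.sum_congr rfl fun π _ => ?_
        rw [← Finset.sum_add_distrib, one_mul]
        exact Finset.sum_congr rfl fun j _ => by ring

lemma summable_smul_hermiteL2 (hZ : IsComplexIsonormal P Z) (he : Orthonormal ℂ e)
    {c : (Fin p ⊕ Fin q → ι) → ℂ} (hc : Summable fun j => ‖c j‖ ^ 2) :
    Summable fun j => c j • hermiteL2 hZ e j := by
  rw [summable_iff_vanishing_norm] at hc ⊢
  intro ε hε
  have hK : (0 : ℝ) < p.factorial * q.factorial := by positivity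
  obtain ⟨s, hs⟩ := hc (ε ^ 2 / (p.factorial * q.factorial)) (by positivity)
  refine ⟨s, fun t ht => ?_⟩
  have h1 := hs t ht
  rw [Real.norm_of_nonneg (Finset.sum_nonneg fun _ _ => by positivity), lt_div_iff₀ hK] at h1
  have h2 := norm_sq_sum_smul_hermiteL2_le hZ he t c
  exact lt_of_pow_lt_pow_left₀ 2 hε.le (h2.trans_lt (by linarith))

/-- The Wiener–Itô integral, extended from `H^{⊙p} ⊗ H^{⊙q}` to a bounded operator on all of
`H^{⊗(p+q)}` by the same series; the extension ignores the part of a kernel that is not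
symmetric. -/
noncomputable def wienerItoCLM (hZ : IsComplexIsonormal P Z) (he : Orthonormal ℂ e)
    (C : H ≃ₗᵢ⋆[ℂ] H) (p q : ℕ) : HilbertTensor (Fin p ⊕ Fin q) H →L[ℂ] Lp ℂ 2 P :=
  have hs : ∀ x : HilbertTensor (Fin p ⊕ Fin q) H, Summable fun j : Fin p ⊕ Fin q → ι =>
      (inner ℂ (basisTensor C e j) x : ℂ) • hermiteL2 hZ e j := fun x =>
    summable_smul_hermiteL2 hZ he ((orthonormal_basisTensor C he).inner_products_summable x)
  LinearMap.mkContinuous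
    { toFun := fun x => ∑' j : Fin p ⊕ Fin q → ι,
        (inner ℂ (basisTensor C e j) x : ℂ) • hermiteL2 hZ e j
      map_add' := fun x y => by
        rw [← (hs x).tsum_add (hs y)]
        simp only [inner_add_right, add_smul]
      map_smul' := fun c x => by
        rw [RingHom.id_apply, ← (hs x).tsum_const_smul c]
        simp only [inner_smul_right, mul_smul] }
    (√(p.factorial * q.factorial)) fun x => by
      refine le_of_tendsto (hs x).hasSum.norm (Eventually.of_forall fun s => ?_)
      refine (sq_le_sq₀ (norm_nonneg _) (by positivity)).1 ?_
      refine (norm_sq_sum_smul_hermiteL2_le hZ he s _).trans ?_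
      rw [mul_pow, Real.sq_sqrt (by positivity)]
      gcongr
      exact (orthonormal_basisTensor C he).sum_inner_products_le x

lemma hasSum_wienerItoCLM (hZ : IsComplexIsonormal P Z) (he : Orthonormal ℂ e)
    (C : H ≃ₗᵢ⋆[ℂ] H) (x : HilbertTensor (Fin p ⊕ Fin q) H) :
    HasSum (fun j : Fin p ⊕ Fin q → ι => (inner ℂ (basisTensor C e j) x : ℂ) • hermiteL2 hZ e j)
      (wienerItoCLM hZ he C p q x) :=
  (summable_smul_hermiteL2 hZ he
    ((orthonormal_basisTensor C he).inner_products_summable x)).hasSum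

lemma wienerItoCLM_basisTensor (hZ : IsComplexIsonormal P Z) (he : Orthonormal ℂ e)
    (C : H ≃ₗᵢ⋆[ℂ] H) (j : Fin p ⊕ Fin q → ι) :
    wienerItoCLM hZ he C p q (basisTensor C e j) = hermiteL2 hZ e j := by
  classical
  refine (hasSum_wienerItoCLM hZ he C _).unique ?_
  have h := orthonormal_iff_ite.1 (orthonormal_basisTensor (p := p) (q := q) C he)
  have h' : ∀ j', j' ≠ j → (inner ℂ (basisTensor C e j') (basisTensor C e j) : ℂ) •
      hermiteL2 hZ e j' = 0 := fun j' hj => by rw [h, if_neg hj, zero_smul]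
  have h2 := hasSum_single j h'
  rwa [h, if_pos rfl, one_smul] at h2

lemma hermiteL2_comp_map (hZ : IsComplexIsonormal P Z) (e : ι → H) (j : Fin p ⊕ Fin q → ι)
    (π : Equiv.Perm (Fin p) × Equiv.Perm (Fin q)) :
    hermiteL2 hZ e (j ∘ Sum.map π.1 π.2) = hermiteL2 hZ e j := by
  classical
  have h1 : ∀ {n : ℕ} (f : Fin n → ι) (σ : Equiv.Perm (Fin n)),
      Finset.univ.val.map (f ∘ σ) = Finset.univ.val.map f := fun f σ => by
    rw [← Multiset.map_map]
    exact congrArg _ (congrArg Finset.val (Finset.map_univ_equiv σ))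
  have h : fourierHermite Z e (j ∘ Sum.map π.1 π.2) = fourierHermite Z e j := by
    rw [fourierHermite_eq_hermiteProd, fourierHermite_eq_hermiteProd]
    have hl : (j ∘ Sum.map π.1 π.2) ∘ Sum.inl = (j ∘ Sum.inl) ∘ π.1 := rfl
    have hr : (j ∘ Sum.map π.1 π.2) ∘ Sum.inr = (j ∘ Sum.inr) ∘ π.2 := rfl
    rw [hl, hr, h1, h1]
  simp only [hermiteL2, h]

/-- The adjoint of the Wiener–Itô integral: its value at `F` has the coefficients
`E[F conj (fourierHermite j)]`. -/
lemma inner_basisTensor_adjoint (hZ : IsComplexIsonormal P Z) (he : Orthonormal ℂ e)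
    (C : H ≃ₗᵢ⋆[ℂ] H) (F : Lp ℂ 2 P) (j : Fin p ⊕ Fin q → ι) :
    inner ℂ (basisTensor C e j) ((wienerItoCLM hZ he C p q).adjoint F) =
      inner ℂ (hermiteL2 hZ e j) F := by
  rw [ContinuousLinearMap.adjoint_inner_right, wienerItoCLM_basisTensor]

/-- On symmetric kernels the coefficients of `I_{p,q}(x)` against the Fourier–Hermite polynomials
are `p! q!` times those of `x`; this is the isometry property of the Wiener–Itô integral. -/
lemma inner_hermiteL2_wienerItoCLM (hZ : IsComplexIsonormal P Z) (he : Orthonormal ℂ e)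
    (C : H ≃ₗᵢ⋆[ℂ] H) {x : HilbertTensor (Fin p ⊕ Fin q) H} (hx : x ∈ SymKernel H p q)
    (j : Fin p ⊕ Fin q → ι) :
    inner ℂ (hermiteL2 hZ e j) (wienerItoCLM hZ he C p q x) =
      (p.factorial * q.factorial : ℂ) * inner ℂ (basisTensor C e j) x := by
  classical
  have h1 := (hasSum_wienerItoCLM hZ he C x).mapL (innerSL ℂ (hermiteL2 hZ e j))
  simp only [innerSL_apply_apply] at h1
  refine h1.unique ?_
  have h2 : HasSum (fun j' : Fin p ⊕ Fin q → ι =>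
      ∑ π : Equiv.Perm (Fin p) × Equiv.Perm (Fin q),
        if j' = j ∘ Sum.map π.1 π.2 then inner ℂ (basisTensor C e j) x else (0 : ℂ))
      (∑ _π : Equiv.Perm (Fin p) × Equiv.Perm (Fin q), inner ℂ (basisTensor C e j) x) :=
    hasSum_sum fun π _ => hasSum_ite_eq (j ∘ Sum.map π.1 π.2) _
  rw [Finset.sum_const, Finset.card_univ, card_perm_prod, nsmul_eq_mul] at h2
  push_cast at h2
  refine h2.congr_fun fun j' => ?_
  rw [inner_smul_right, inner_hermiteL2 hZ he, Finset.mul_sum]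
  refine Finset.sum_congr rfl fun π _ => ?_
  by_cases h : j' = j ∘ Sum.map π.1 π.2
  · subst h
    rw [if_pos rfl, if_pos rfl, mul_one, inner_basisTensor_comp_of_mem_symKernel C e hx]
  · rw [if_neg h, if_neg (Ne.symm h), mul_zero]

lemma inner_hermiteL2_wienerItoCLM_of_ne (hZ : IsComplexIsonormal P Z) (he : Orthonormal ℂ e)
    (C : H ≃ₗᵢ⋆[ℂ] H) {p' q' : ℕ} (h : (p, q) ≠ (p', q')) (x : HilbertTensor (Fin p' ⊕ Fin q') H)
    (j : Fin p ⊕ Fin q → ι) :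
    inner ℂ (hermiteL2 hZ e j) (wienerItoCLM hZ he C p' q' x) = 0 := by
  have h1 := (hasSum_wienerItoCLM hZ he C x).mapL (innerSL ℂ (hermiteL2 hZ e j))
  simp only [innerSL_apply_apply, inner_smul_right, inner_hermiteL2_of_ne hZ he j _ h,
    mul_zero] at h1
  exact h1.unique hasSum_zero

end Integral

/-! ### The chaos expansion and its kernels -/

section Chaos

variable {Ω H ι : Type*} {mΩ : MeasurableSpace Ω} [NormedAddCommGroup H] [InnerProductSpace ℂ H]
  {P : Measure Ω} [IsProbabilityMeasure P] {Z : H → Ω → ℂ} {p q : ℕ}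

variable (hZ : IsComplexIsonormal P Z) (e : HilbertBasis ι ℂ H) (C : H ≃ₗᵢ⋆[ℂ] H)

/-- The kernel `f_{p,q}` of the chaos expansion of `F`: the adjoint of the Wiener–Itô integral at
`F`, divided by `p! q!`. -/
noncomputable def chaosKernel (p q : ℕ) (F : Lp ℂ 2 P) : HilbertTensor (Fin p ⊕ Fin q) H :=
  (p.factorial * q.factorial : ℂ)⁻¹ • (wienerItoCLM hZ e.orthonormal C p q).adjoint F

lemma inner_basisTensor_chaosKernel (F : Lp ℂ 2 P) (j : Fin p ⊕ Fin q → ι) :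
    inner ℂ (basisTensor C e j) (chaosKernel hZ e C p q F) =
      (p.factorial * q.factorial : ℂ)⁻¹ * inner ℂ (hermiteL2 hZ e j) F := by
  rw [chaosKernel, inner_smul_right, inner_basisTensor_adjoint]

lemma chaosKernel_mem_symKernel [CompleteSpace H] (hC : ∀ h, C (C h) = h)
    (p q : ℕ) (F : Lp ℂ 2 P) :
    chaosKernel hZ e C p q F ∈ SymKernel H p q := by
  refine mem_symKernel_of_inner_basisTensor_comp C hC e fun j π => ?_
  rw [inner_basisTensor_chaosKernel, inner_basisTensor_chaosKernel, hermiteL2_comp_map]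

/-- On symmetric kernels, `I_{p,q}` is inverted by `chaosKernel`. -/
lemma chaosKernel_wienerItoCLM [CompleteSpace H] (hC : ∀ h, C (C h) = h)
    {x : HilbertTensor (Fin p ⊕ Fin q) H}
    (hx : x ∈ SymKernel H p q) :
    chaosKernel hZ e C p q (wienerItoCLM hZ e.orthonormal C p q x) = x := by
  refine ext_inner_basisTensor C hC e fun j => ?_
  rw [inner_basisTensor_chaosKernel, inner_hermiteL2_wienerItoCLM hZ e.orthonormal C hx,
    inv_mul_cancel_left₀ (factorial_mul_factorial_ne_zero p q)]

lemma chaosKernel_wienerItoCLM_of_ne [CompleteSpace H] (hC : ∀ h, C (C h) = h)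
    {p' q' : ℕ} (h : (p, q) ≠ (p', q'))
    (x : HilbertTensor (Fin p' ⊕ Fin q') H) :
    chaosKernel hZ e C p q (wienerItoCLM hZ e.orthonormal C p' q' x) = 0 := by
  refine ext_inner_basisTensor C hC e fun j => ?_
  rw [inner_basisTensor_chaosKernel, inner_hermiteL2_wienerItoCLM_of_ne hZ e.orthonormal C h]
  simp

/-- The projection `F ↦ I_{p,q}(f_{p,q})` of `L²` onto the chaos of bidegree `(p, q)`. -/
noncomputable def chaosProj (pq : ℕ × ℕ) (F : Lp ℂ 2 P) : Lp ℂ 2 P :=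
  wienerItoCLM hZ e.orthonormal C pq.1 pq.2 (chaosKernel hZ e C pq.1 pq.2 F)

lemma chaosKernel_add (F G : Lp ℂ 2 P) :
    chaosKernel hZ e C p q (F + G) = chaosKernel hZ e C p q F + chaosKernel hZ e C p q G := by
  rw [chaosKernel, map_add, smul_add]; rfl

lemma chaosKernel_smul (c : ℂ) (F : Lp ℂ 2 P) :
    chaosKernel hZ e C p q (c • F) = c • chaosKernel hZ e C p q F := by
  rw [chaosKernel, map_smul, smul_comm]; rfl

lemma chaosProj_add (pq : ℕ × ℕ) (F G : Lp ℂ 2 P) :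
    chaosProj hZ e C pq (F + G) = chaosProj hZ e C pq F + chaosProj hZ e C pq G := by
  rw [chaosProj, chaosKernel_add, map_add]; rfl

lemma chaosProj_smul (pq : ℕ × ℕ) (c : ℂ) (F : Lp ℂ 2 P) :
    chaosProj hZ e C pq (c • F) = c • chaosProj hZ e C pq F := by
  rw [chaosProj, chaosKernel_smul, map_smul]; rfl

/-- The chaos projections of `F` are orthogonal, and each is the orthogonal projection of `F`. -/
lemma inner_chaosProj [CompleteSpace H] (hC : ∀ h, C (C h) = h)
    (a b : ℕ × ℕ) (F : Lp ℂ 2 P) :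
    inner ℂ (chaosProj hZ e C a F) (chaosProj hZ e C b F) =
      if a = b then inner ℂ (chaosProj hZ e C a F) F else 0 := by
  have h1 : ∀ (x : HilbertTensor (Fin a.1 ⊕ Fin a.2) H) (G : Lp ℂ 2 P),
      inner ℂ (wienerItoCLM hZ e.orthonormal C a.1 a.2 x) G =
        (a.1.factorial * a.2.factorial : ℂ) * inner ℂ x (chaosKernel hZ e C a.1 a.2 G) := by
    intro x G
    rw [chaosKernel, inner_smul_right,
      mul_inv_cancel_left₀ (factorial_mul_factorial_ne_zero a.1 a.2),
      ContinuousLinearMap.adjoint_inner_right]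
  split_ifs with h
  · subst h
    rw [chaosProj, h1, h1, chaosKernel_wienerItoCLM hZ e C hC
      (chaosKernel_mem_symKernel hZ e C hC _ _ F)]
  · rw [chaosProj, h1, chaosProj, chaosKernel_wienerItoCLM_of_ne hZ e C hC h, inner_zero_right,
      mul_zero]

/-- Bessel's inequality for the chaos projections. -/
lemma norm_sum_chaosProj_le [CompleteSpace H] (hC : ∀ h, C (C h) = h)
    (s : Finset (ℕ × ℕ)) (F : Lp ℂ 2 P) :
    ‖∑ a ∈ s, chaosProj hZ e C a F‖ ≤ ‖F‖ := by
  set S := ∑ a ∈ s, chaosProj hZ e C a F with hS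
  have h1 : inner ℂ S S = inner ℂ S F := by
    rw [hS, sum_inner, sum_inner]
    refine Finset.sum_congr rfl fun a ha => ?_
    rw [inner_sum]
    simp only [inner_chaosProj hZ e C hC]
    rw [Finset.sum_ite_eq, if_pos ha]
  have h2 : ‖S‖ * ‖S‖ ≤ ‖S‖ * ‖F‖ := by
    have h3 := norm_inner_le_norm (𝕜 := ℂ) S F
    rw [← h1, inner_self_eq_norm_sq_to_K] at h3
    simpa [pow_two] using h3
  by_cases h : ‖S‖ = 0
  · rw [h]; exact norm_nonneg _
  · exact le_of_mul_le_mul_left h2 (lt_of_le_of_ne (norm_nonneg _) (Ne.symm h))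

/-- Each Fourier–Hermite polynomial is the integral of a symmetrized basis tensor. -/
lemma exists_mem_symKernel_wienerItoCLM_eq (j : Fin p ⊕ Fin q → ι) :
    ∃ x ∈ SymKernel H p q, wienerItoCLM hZ e.orthonormal C p q x = hermiteL2 hZ e j := by
  refine ⟨symTprod (fun a => e (j (Sum.inl a))) (fun b => C (e (j (Sum.inr b)))),
    Submodule.le_topologicalClosure _ (Submodule.subset_span ⟨(_, _), rfl⟩), ?_⟩
  rw [symTprod_basis, map_smul, map_sum]
  simp only [wienerItoCLM_basisTensor, hermiteL2_comp_map]
  rw [Finset.sum_const, Finset.card_univ, card_perm_prod, ← Nat.cast_smul_eq_nsmul ℂ, smul_smul]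
  push_cast
  rw [inv_mul_cancel₀ (factorial_mul_factorial_ne_zero p q), one_smul]

/-- The span of all Fourier–Hermite polynomials in `L²`. -/
noncomputable def hermiteL2Span : Submodule ℂ (Lp ℂ 2 P) :=
  Submodule.span ℂ (Set.range fun x : Σ p : ℕ, Σ q : ℕ, (Fin p ⊕ Fin q → ι) =>
    hermiteL2 hZ e x.2.2)

/-- A polynomial is the sum of finitely many of its chaos projections. -/
lemma eventually_sum_chaosProj_eq [CompleteSpace H] (hC : ∀ h, C (C h) = h)
    {G : Lp ℂ 2 P} (hG : G ∈ hermiteL2Span hZ e) :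
    ∀ᶠ s : Finset (ℕ × ℕ) in atTop, ∑ a ∈ s, chaosProj hZ e C a G = G := by
  induction hG using Submodule.span_induction with
  | mem G hG =>
    obtain ⟨⟨p, q, j⟩, rfl⟩ := hG
    obtain ⟨x, hx, hxj⟩ := exists_mem_symKernel_wienerItoCLM_eq hZ e C j
    filter_upwards [eventually_ge_atTop {(p, q)}] with s hs
    have hs' : (p, q) ∈ s := hs (Finset.mem_singleton_self _)
    simp only [← hxj]
    rw [Finset.sum_eq_single_of_mem (p, q) hs']
    · rw [chaosProj, chaosKernel_wienerItoCLM hZ e C hC hx]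
    · intro b _ hb
      rw [chaosProj, chaosKernel_wienerItoCLM_of_ne hZ e C hC hb, map_zero]
  | zero =>
    refine Eventually.of_forall fun s => Finset.sum_eq_zero fun a _ => ?_
    simpa using chaosProj_smul hZ e C a 0 0
  | add x y _ _ hx hy =>
    filter_upwards [hx, hy] with s h1 h2
    simp only [chaosProj_add, Finset.sum_add_distrib, h1, h2]
  | smul c x _ hx =>
    filter_upwards [hx] with s h1
    simp only [chaosProj_smul, ← Finset.smul_sum, h1]

lemma hermiteL2_mem_lpMeas (j : Fin p ⊕ Fin q → ι) :
    hermiteL2 hZ e j ∈ lpMeas ℂ ℂ (sigmaAlgebra Z) 2 P := by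
  classical
  rw [mem_lpMeas_iff_aestronglyMeasurable]
  refine ⟨fourierHermite Z e j, ?_, MemLp.coeFn_toLp _⟩
  have hm : ∀ h, Measurable[sigmaAlgebra Z] (Z h) := fun h =>
    Measurable.mono (comap_measurable (Z h)) (le_iSup (fun h => MeasurableSpace.comap (Z h) _) h)
      le_rfl
  refine Measurable.stronglyMeasurable ?_
  unfold fourierHermite
  refine Finset.measurable_prod _ fun k _ => ?_
  have hc : Continuous fun z : ℂ => complexHermite
      (Finset.univ.filter fun a : Fin p => j (Sum.inl a) = k).card
      (Finset.univ.filter fun b : Fin q => j (Sum.inr b) = k).card z 1 := by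
    unfold complexHermite
    fun_prop
  exact hc.measurable.comp (hm (e k))

/-- The Fourier–Hermite polynomials span a dense subspace of `L²(σ(Z))`: the difference of `F` and
its projection is still `σ(Z)`-measurable and is orthogonal to all of them. -/
lemma mem_closure_hermiteL2Span (F : Lp ℂ 2 P) (hF : F ∈ lpMeas ℂ ℂ (sigmaAlgebra Z) 2 P) :
    F ∈ (hermiteL2Span hZ e).topologicalClosure := by
  set K := (hermiteL2Span hZ e).topologicalClosure with hK
  have hKc : CompleteSpace K :=
    (Submodule.isClosed_topologicalClosure (hermiteL2Span hZ e)).completeSpace_coe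
  have hle : K ≤ lpMeas ℂ ℂ (sigmaAlgebra Z) 2 P := by
    refine Submodule.topologicalClosure_minimal _ ?_ ?_
    · refine Submodule.span_le.2 ?_
      rintro _ ⟨⟨p, q, j⟩, rfl⟩
      exact hermiteL2_mem_lpMeas hZ e j
    · exact isClosed_aestronglyMeasurable (sigmaAlgebra_le hZ)
  have h0 : F - K.starProjection F = 0 := by
    refine eq_zero_of_forall_inner_hermiteL2 hZ e.dense_span _
      (Submodule.sub_mem _ hF (hle (Submodule.starProjection_apply_mem _ F))) fun p q j => ?_
    exact (Submodule.mem_orthogonal _ _).1 (Submodule.sub_starProjection_mem_orthogonal F) _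
      (Submodule.le_topologicalClosure _ (Submodule.subset_span ⟨⟨p, q, j⟩, rfl⟩))
  rw [sub_eq_zero.1 h0]
  exact Submodule.starProjection_apply_mem _ F

/-- The chaos expansion: partial sums are contractions which are eventually the identity on each
polynomial, and polynomials are dense in `L²(σ(Z))`. -/
theorem hasSum_chaosProj [CompleteSpace H] (hC : ∀ h, C (C h) = h)
    (F : Lp ℂ 2 P) (hF : F ∈ lpMeas ℂ ℂ (sigmaAlgebra Z) 2 P) :
    HasSum (fun a => chaosProj hZ e C a F) F := by
  rw [HasSum, SummationFilter.unconditional_filter, Metric.tendsto_nhds]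
  intro ε hε
  obtain ⟨G, hG, hFG⟩ := Metric.mem_closure_iff.1
    (mem_closure_hermiteL2Span hZ e F hF) (ε / 2) (half_pos hε)
  filter_upwards [eventually_sum_chaosProj_eq hZ e C hC hG] with s hs
  have h1 : ∑ a ∈ s, chaosProj hZ e C a F - F =
      ∑ a ∈ s, chaosProj hZ e C a (F - G) - (F - G) := by
    have : ∀ a, chaosProj hZ e C a (F - G) = chaosProj hZ e C a F - chaosProj hZ e C a G :=
      fun a => by
        rw [eq_sub_iff_add_eq, ← chaosProj_add, sub_add_cancel]
    simp only [this, Finset.sum_sub_distrib, hs]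
    abel
  rw [dist_eq_norm, h1]
  have h2 := norm_sum_chaosProj_le hZ e C hC s (F - G)
  rw [dist_eq_norm] at hFG
  calc _ ≤ ‖F - G‖ + ‖F - G‖ := (norm_sub_le _ _).trans (by gcongr)
    _ < ε := by linarith

/-- Stroock's formula for the elements of the Sobolev space, from the smooth case by continuity of
both sides. -/
theorem chaosKernel_eq_of_isSobolevWithDerivs [CompleteSpace H] (hC : ∀ h, C (C h) = h)
    {m n : ℕ} {F : Lp ℂ 2 P}
    {G : ∀ p q : ℕ, Lp (HilbertTensor (Fin p ⊕ Fin q) H) 2 P}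
    (hF : IsSobolevWithDerivs P Z C m n F G) (hp : p ≤ m) (hq : q ≤ n) :
    chaosKernel hZ e C p q F = (p.factorial * q.factorial : ℂ)⁻¹ • ∫ ω, G p q ω ∂P := by
  obtain ⟨F', G', hs, hF', hG'⟩ := hF
  refine ext_inner_basisTensor C hC e fun j => ?_
  rw [inner_basisTensor_chaosKernel, inner_smul_right]
  congr 1
  -- the coefficients of `E[g]` are inner products with constants, hence continuous in `g ∈ L²`
  have hL2 : ∀ g : Lp (HilbertTensor (Fin p ⊕ Fin q) H) 2 P,
      inner ℂ (basisTensor C e j) (∫ ω, g ω ∂P) =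
        inner ℂ (indicatorConstLp 2 MeasurableSet.univ (measure_ne_top P _)
          (basisTensor C e j)) g := fun g => by
    rw [L2.inner_indicatorConstLp_eq_inner_setIntegral, setIntegral_univ]
  have h1 : Tendsto (fun k => inner ℂ (hermiteL2 hZ e j) (F' k)) atTop
      (𝓝 (inner ℂ (hermiteL2 hZ e j) F)) := tendsto_const_nhds.inner hF'
  have h2 : Tendsto (fun k => inner ℂ (basisTensor C e j) (∫ ω, G' k p q ω ∂P)) atTop
      (𝓝 (inner ℂ (basisTensor C e j) (∫ ω, G p q ω ∂P))) := by
    simp only [hL2]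
    exact tendsto_const_nhds.inner (hG' p hp q hq)
  refine tendsto_nhds_unique h1 (h2.congr fun k => ?_)
  exact (inner_hermiteL2_of_isSmoothWithDerivs hZ e.orthonormal C (hs k) j).symm

end Chaos

end ComplexWiener

open ComplexWiener
theorem mainTheorem1 {Ω H ι : Type*} [MeasurableSpace Ω] {P : Measure Ω} [IsProbabilityMeasure P]
    [NormedAddCommGroup H] [InnerProductSpace ℂ H] [CompleteSpace H]
    [TopologicalSpace.SeparableSpace H]
    (C : H ≃ₗᵢ⋆[ℂ] H) (hC : ∀ h, C (C h) = h) (e : HilbertBasis ι ℂ H)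
    {Z : H → Ω → ℂ} (hZ : IsComplexIsonormal P Z)
    (F : Lp ℂ 2 P) (hF : F ∈ lpMeas ℂ ℂ (sigmaAlgebra Z) 2 P) :
    ∃ f : ∀ p q : ℕ, SymKernel H p q,
      HasSum (fun pq : ℕ × ℕ => wienerIto hZ C e pq.1 pq.2 (f pq.1 pq.2)) F ∧
      (∀ g : ∀ p q : ℕ, SymKernel H p q,
        HasSum (fun pq : ℕ × ℕ => wienerIto hZ C e pq.1 pq.2 (g pq.1 pq.2)) F → g = f) ∧
      ∀ (m n : ℕ) (G : ∀ p q : ℕ, Lp (HilbertTensor (Fin p ⊕ Fin q) H) 2 P),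
        IsSobolevWithDerivs P Z C m n F G →
        ∀ p ≤ m, ∀ q ≤ n, (f p q : HilbertTensor (Fin p ⊕ Fin q) H) =
          ((p.factorial * q.factorial : ℂ)⁻¹) • ∫ ω, G p q ω ∂P := by
  have hW : ∀ (p q : ℕ) (f : SymKernel H p q),
      wienerIto hZ C e p q f = wienerItoCLM hZ e.orthonormal C p q f := fun p q f => rfl
  refine ⟨fun p q => ⟨chaosKernel hZ e C p q F, chaosKernel_mem_symKernel hZ e C hC p q F⟩,
    ?_, ?_, ?_⟩
  · exact hasSum_chaosProj hZ e C hC F hF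
  · intro g hg
    simp only [hW] at hg
    ext1 p
    ext1 q
    ext1
    -- apply the continuous linear map `chaosKernel` to the expansion: only one term survives
    have h1 := hg.mapL ((wienerItoCLM hZ e.orthonormal C p q).adjoint)
    have h2 := h1.const_smul ((p.factorial * q.factorial : ℂ)⁻¹)
    have h3 : ∀ a : ℕ × ℕ, a ≠ (p, q) → chaosKernel hZ e C p q
        (wienerItoCLM hZ e.orthonormal C a.1 a.2 (g a.1 a.2)) = 0 := fun a ha =>
      chaosKernel_wienerItoCLM_of_ne hZ e C hC (Ne.symm ha) _
    have h4 := (hasSum_single (p, q) h3).unique h2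
    rw [chaosKernel_wienerItoCLM hZ e C hC (g p q).2] at h4
    exact h4
  · intro m n G hG p hp q hq
    exact chaosKernel_eq_of_isSobolevWithDerivs hZ e C hC hG hp hq
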